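/- **Setting.** Let $b$ be prime, $m,s\ge 1$, $N=b^m$, let $\alpha\ge2$, and let $P\in\mathbb Z_b[x]$ be irreducible of degree $m$. Let $G_{b,m}$ be the set of nonzero polynomials over $\mathbb Z_b$ of degree less than $m$. For an integer $k=\kappa_0+\kappa_1b+\kappa_2b^2+\cdots\ge 0$ put $\mathrm{tr}_m(k)(x)=\kappa_0+\cdots+\kappa_{m-1}x^{m-1}$, and write $n(x)=\mathrm{tr}_m(n)(x)$ for $n<b^m$. For a Laurent series put $v_m(\sum_{\ell\ge w}t_\ell x^{-\ell})=\sum_{\ell=\max(1,w)}^m t_\ell b^{-\ell}$. The *interlaced polynomial lattice rule of order $\alpha$* with modulus $P$ and generating vector $\boldsymbol q\in G_{b,m}^{\alpha s}$ is $Q_{N,s}(F)=\frac1N\sum_{n=0}^{N-1}F(\boldsymbol y_n)$, where the $j$-th coordinate of $\boldsymbol y_n\in[0,1)^s$ is obtained by interlacing the base $b$ digits of the $\alpha$ numbers $v_m(n(x)q_{\alpha(j-1)+i}(x)/P(x))$, $1\le i\le\alpha$: for $z_i=\sum_{a\ge1}\xi_{i,a}b^{-a}$ the interlaced number is $\sum_{a\ge1}\sum_{i=1}^\alpha\xi_{i,a}b^{-i-(a-1)\alpha}$.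 For a sequence $\boldsymbol\beta=(\beta_j)_{j\ge1}$ of positive reals, $\boldsymbol q\in G_{b,m}^{\alpha s}$ and $1\le d\le\alpha s$ let $$E_d(\boldsymbol q)=\sum_{\emptyset\ne v\subseteq\{1,\dots,d\}}C_{\alpha,b}^{|u(v)|}\,\gamma_{u(v)}\,b^{\alpha(\alpha-1)|u(v)|/2}\sum_{\boldsymbol\ell}b^{-\alpha\sum_{j\in v}\mu_1(\ell_j)},$$ where $u(v)=\{\lceil j/\alpha\rceil:j\in v\}$, the inner sum is over all $\boldsymbol\ell\in\mathbb N^{v}$ with positive entries such that $P$ divides $\sum_{j\in v}\mathrm{tr}_m(\ell_j)q_j$, $\mu_1(\ell)$ is the number of base $b$ digits of $\ell$, $$\gamma_u=\sum_{\boldsymbol\nu\in\{1,\dots,\alpha\}^u}\Big(\sum_{j\in u}\nu_j\Big)!\prod_{j\in u}2^{\delta(\nu_j,\alpha)}\beta_j^{\nu_j}$$ ($\delta(\nu,\alpha)=1$ if $\nu=\alpha$ and $0$ otherwise), and $$C_{\alpha,b}=\max\Big(\tfrac{2}{(2\sin\frac\pi b)^\alpha},\max_{1\le z\le\alpha-1}\tfrac1{(2\sin\frac\pi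 b)^z}\Big)\Big(1+\tfrac1b+\tfrac1{b(b+1)}\Big)^{\alpha-2}\Big(3+\tfrac2b+\tfrac{2b+1}{b-1}\Big).$$ A vector $\boldsymbol q\in G_{b,m}^{\alpha s}$ is a *component-by-component (CBC) vector* if $q_1=1$ and, for every $d$, the component $q_d$ minimizes $E_d(q_1,\dots,q_{d-1},\,\cdot\,)$ over $G_{b,m}$. An *operation* is an addition, subtraction or multiplication of real numbers, the loading of a real constant, or a comparison of two real numbers. An algorithm for given $b,m,\alpha,s,P$ is an algebraic computation tree over these operations whose only input is $(\beta_1,\dots,\beta_s)$; thus data that depend only on $b,m,\alpha,s,P$ may be precomputed. **Theorem.** There are an absolute constant $K$ and, for all $b,m,\alpha,s,P$, an algorithm (the fast CBC algorithm) with output $\boldsymbol q\in\mathbb Z_b[x]^{\alpha s}$ such that the following holds for every prime $b$. Let $\boldsymbol\beta=(\beta_j)_{j\ge1}$ be a sequence of positive numbers with $\sum_{j}\beta_j^p<\infty$ for some $p\in(0,1]$, and put $\alpha=\lfloor 1/p\rfloor+1$. If $\sum_j\beta_j^{p'}$ diverges for all $p'\in(0,1)$ (so that $p=1$), assume in addition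 that $$\sum_{j=1}^\infty\beta_j<\bigg(4\max\Big(\tfrac{2}{(2\sin\frac\pi b)^2},\tfrac1{2\sin\frac\pi b}\Big)\Big(3+\tfrac2b+\tfrac{2b+1}{b-1}\Big)\Big(2+\tfrac1b\Big)\bigg)^{-1}.$$ Then there is a constant $C\in(0,\infty)$, depending only on $\alpha,\boldsymbol\beta,b,p$, such that for all $s,m\ge1$, with $N=b^m$, and all irreducible $P\in\mathbb Z_b[x]$ of degree $m$: 1. on input $(\beta_1,\dots,\beta_s)$ the algorithm uses at most $K(\alpha sN\log N+\alpha^2s^2N)$ operations; 2. its output $\boldsymbol q$ is a CBC vector; 3. for every $c>0$ and every $F:[0,1]^s\to\mathbb R$ whose mixed partial derivatives $\partial^{\boldsymbol\nu}F$ exist on $[0,1]^s$ (one-sided at the boundary, independently of the order of differentiation) and satisfy $$|\partial^{\boldsymbol\nu}F(\boldsymbol y)|\le c\,|\boldsymbol\nu|!\,\prod_{j=1}^s\beta_j^{\nu_j}\qquad\text{for all }\boldsymbol\nu\in\{0,\dots,\alpha\}^s,\ \boldsymbol y\in[0,1]^s,$$ $F$ is integrable and the interlaced polynomial lattice rule of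 order $\alpha$ with modulus $P$ and generating vector $\boldsymbol q$ satisfies $$\Big|\int_{[0,1]^s}F(\boldsymbol y)\,d\boldsymbol y-Q_{N,s}(F)\Big|\le c\,C\,N^{-1/p}.$$ -/

import Mathlib

open scoped Polynomial

noncomputable section

namespace QMC

/-! ### Computations on real numbers and their cost

An algebraic computation tree with real memory cells `0, 1, 2, …`.  A node either performs one
arithmetic instruction, or compares two cells and branches, or stops with a (discrete) output.
The tree never sees the content of a cell except through comparisons. -/

/-- One arithmetic instruction; `dst`, `x`, `y` are addresses of memory cells. -/
inductive Instr : Type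
  | const (dst : ℕ) (c : ℝ)
  | add (dst x y : ℕ)
  | sub (dst x y : ℕ)
  | mul (dst x y : ℕ)

/-- The effect of an instruction on the memory. -/
def Instr.exec : Instr → (ℕ → ℝ) → (ℕ → ℝ)
  | .const dst c, M => Function.update M dst c
  | .add dst x y, M => Function.update M dst (M x + M y)
  | .sub dst x y, M => Function.update M dst (M x - M y)
  | .mul dst x y, M => Function.update M dst (M x * M y)

/-- Algebraic computation trees with outputs in `O`. -/
inductive CompTree (O : Type) : Type
  | ret (o : O) : CompTree O
  | step (i : Instr) (next : CompTree O) : CompTree O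
  | branch (x y : ℕ) (ifLe ifGt : CompTree O) : CompTree O

/-- The output of the computation started with memory `M`. -/
def CompTree.output {O : Type} : CompTree O → (ℕ → ℝ) → O
  | .ret o, _ => o
  | .step i next, M => next.output (i.exec M)
  | .branch x y ifLe ifGt, M =>
      open Classical in if M x ≤ M y then ifLe.output M else ifGt.output M

/-- The number of operations (instructions and comparisons) that are executed when the
computation is started with memory `M`. -/
def CompTree.cost {O : Type} : CompTree O → (ℕ → ℝ) → ℕ
  | .ret _, _ => 0
  | .step i next, M => next.cost (i.exec M) + 1
  | .branch x y ifLe ifGt, M =>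
      (open Classical in if M x ≤ M y then ifLe.cost M else ifGt.cost M) + 1

/-- The initial memory: the first `s` terms of `β` in the cells `0, …, s - 1`, zero elsewhere. -/
def inputMemory (s : ℕ) (β : ℕ → ℝ) : ℕ → ℝ := fun i => if i < s then β i else 0

/-! ### Polynomial lattice point sets and digit interlacing -/

/-- The polynomial `κ₀ + κ₁ x + ⋯ + κ_{m-1} x^{m-1}` over `ℤ_b` attached to the first `m` digits of
`k = κ₀ + κ₁ b + κ₂ b² + ⋯`.  For `k < b ^ m` this is `k(x)`, in general it is `tr_m(k)(x)`. -/
def digitPoly (b m k : ℕ) : (ZMod b)[X] :=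
  ∑ r ∈ Finset.range m, Polynomial.C ((k / b ^ r % b : ℕ) : ZMod b) * Polynomial.X ^ r

/-- The set `G_{b,m}` of nonzero polynomials over `ℤ_b` of degree less than `m`. -/
def genSet (b m : ℕ) : Set (ZMod b)[X] := {q | q ≠ 0 ∧ q.degree < m}

/-- A polynomial in `x` as an element of `ℤ_b((x⁻¹))`: Laurent series in the indeterminate
`x⁻¹ = single 1 1`, so that `x = single (-1) 1`. -/
def laurentOfPoly {b : ℕ} (f : (ZMod b)[X]) : LaurentSeries (ZMod b) :=
  Polynomial.aeval (HahnSeries.single (-1 : ℤ) (1 : ZMod b) : LaurentSeries (ZMod b)) f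

/-- The map `v_m : ∑_ℓ t_ℓ x^{-ℓ} ↦ ∑_{ℓ=1}^m t_ℓ b^{-ℓ}`. -/
def vMap {b : ℕ} (m : ℕ) (L : LaurentSeries (ZMod b)) : ℝ :=
  ∑ ℓ ∈ Finset.Icc 1 m, ((L.coeff (ℓ : ℤ)).val : ℝ) * ((b : ℝ)⁻¹) ^ ℓ

/-- The coordinate `v_m (n(x) q(x) / P(x))` of the `n`-th point of a polynomial lattice rule. -/
def latticeCoord {b : ℕ} [Fact b.Prime] (m : ℕ) (P q : (ZMod b)[X]) (n : ℕ) : ℝ :=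
  vMap m (laurentOfPoly (digitPoly b m n * q) / laurentOfPoly P)

/-- The `a`-th digit (`a ≥ 1`) of `x ∈ [0,1)` in base `b`. -/
def digit (b : ℕ) (x : ℝ) (a : ℕ) : ℕ := ⌊x * (b : ℝ) ^ a⌋₊ % b

/-- The digit interlacing function `[0,1)^α → [0,1)` (the indices `j` and `a` start from `0`). -/
def interlace (b : ℕ) {α : ℕ} (x : Fin α → ℝ) : ℝ :=
  ∑' a : ℕ, ∑ j : Fin α, (digit b (x j) (a + 1) : ℝ) * ((b : ℝ)⁻¹) ^ ((j : ℕ) + 1 + a * α)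

/-- The `n`-th point of the interlaced polynomial lattice rule of order `α` with modulus `P` and
generating vector `q`; the `j`-th block of `q` consists of the components `α * j + i`, `i < α`. -/
def interlacedPoint {b : ℕ} [Fact b.Prime] (m : ℕ) (P : (ZMod b)[X]) {α s : ℕ}
    (q : Fin (s * α) → (ZMod b)[X]) (n : ℕ) : Fin s → ℝ :=
  fun j => interlace b fun i : Fin α => latticeCoord m P (q (finProdFinEquiv (j, i))) n

/-! ### Weights and the component-by-component construction -/

/-- The constant `C_{α,b}` (for `α ≥ 2`). -/
def walshConst (α b : ℕ) : ℝ :=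
  (Finset.Icc 1 (α - 1)).fold max (2 / (2 * Real.sin (Real.pi / b)) ^ α)
      (fun z => 1 / (2 * Real.sin (Real.pi / b)) ^ z)
    * (1 + 1 / (b : ℝ) + 1 / ((b : ℝ) * (b + 1))) ^ (α - 2)
    * (3 + 2 / (b : ℝ) + (2 * (b : ℝ) + 1) / ((b : ℝ) - 1))

/-- The smoothness-driven product and order dependent (SPOD) weight `γ_u`. -/
def spodWeight (α : ℕ) (β : ℕ → ℝ) (u : Finset ℕ) : ℝ :=
  ∑ ν ∈ Fintype.piFinset (fun _ : {j // j ∈ u} => Finset.Icc 1 α),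
    ((∑ j, ν j).factorial : ℝ) * ∏ j, ((if ν j = α then 2 else 1) * β j ^ ν j)

/-- The set `u(v)` of the blocks that `v` meets; with indices from `0`, `j` is in block `⌊j/α⌋`. -/
def blocks (α : ℕ) {D : ℕ} (v : Finset (Fin D)) : Finset ℕ := v.image fun j : Fin D => (j : ℕ) / α

/-- The weight `C_{α,b}^{|u(v)|} γ_{u(v)} b^{α(α-1)|u(v)|/2}`. -/
def cbcWeight (b α : ℕ) (β : ℕ → ℝ) {D : ℕ} (v : Finset (Fin D)) : ℝ :=
  walshConst α b ^ (blocks α v).card * spodWeight α β (blocks α v)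
    * (b : ℝ) ^ (α * (α - 1) / 2 * (blocks α v).card)

/-- `μ₁(k)`: the number of digits of `k` in base `b`, and `μ₁(0) = 0`. -/
def muOne (b k : ℕ) : ℕ := if k = 0 then 0 else Nat.log b k + 1

/-- The dual net without zero components, for the components in `v`. -/
def dualNet {b : ℕ} (m : ℕ) (P : (ZMod b)[X]) {D : ℕ} (q : Fin D → (ZMod b)[X])
    (v : Finset (Fin D)) : Set ({j // j ∈ v} → ℕ) :=
  {ℓ | (∀ j, 0 < ℓ j) ∧ P ∣ ∑ j, digitPoly b m (ℓ j) * q j}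

/-- The search criterion `E_d(q)`; it depends on the first `d` components of `q` only. -/
def searchCriterion {b : ℕ} (m α : ℕ) (P : (ZMod b)[X]) (β : ℕ → ℝ) {D : ℕ}
    (q : Fin D → (ZMod b)[X]) (d : ℕ) : ℝ :=
  ∑ v : Finset (Fin D) with v.Nonempty ∧ ∀ j : Fin D, j ∈ v → (j : ℕ) < d,
    cbcWeight b α β v * ∑' ℓ : dualNet m P q v, ((b : ℝ)⁻¹) ^ (α * ∑ j, muOne b (ℓ.1 j))

/-- `q` is a generating vector produced by the component-by-component algorithm: its components are
in `G_{b,m}`, the first one is `1`, and each component minimizes the search criterion over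
`G_{b,m}` with the preceding components fixed. -/
def IsCBCVector {b : ℕ} (m α : ℕ) (P : (ZMod b)[X]) (β : ℕ → ℝ) {D : ℕ}
    (q : Fin D → (ZMod b)[X]) : Prop :=
  (∀ d, q d ∈ genSet b m) ∧ (∀ d : Fin D, (d : ℕ) = 0 → q d = 1) ∧
    ∀ d : Fin D, ∀ g ∈ genSet b m,
      searchCriterion m α P β q (d + 1) ≤
        searchCriterion m α P β (Function.update q d g) (d + 1)

/-- The bound in the smallness condition on `∑ β_j`. -/
def smallBound (b : ℕ) : ℝ :=
  (4 * max (2 / (2 * Real.sin (Real.pi / b)) ^ 2) (1 / (2 * Real.sin (Real.pi / b)))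
    * (3 + 2 / (b : ℝ) + (2 * (b : ℝ) + 1) / ((b : ℝ) - 1)) * (2 + 1 / (b : ℝ)))⁻¹

/-! ### Integrands and quadrature -/

/-- `D ν = ∂^ν F` on `[0,1]^s` for all `ν ∈ {0, …, α}^s`: the mixed partial derivatives exist (one-sided
ones at the boundary), and `∂^{ν + e_j} F` is the partial derivative of `∂^ν F` in the variable
`y_j`. -/
def HasMixedPartials {s : ℕ} (α : ℕ) (F : (Fin s → ℝ) → ℝ)
    (D : (Fin s → ℕ) → (Fin s → ℝ) → ℝ) : Prop :=
  (∀ y ∈ Set.Icc (0 : Fin s → ℝ) 1, D 0 y = F y) ∧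
    ∀ (ν : Fin s → ℕ) (j : Fin s), (∀ i, ν i ≤ α) → ν j < α →
      ∀ y ∈ Set.Icc (0 : Fin s → ℝ) 1,
        HasDerivWithinAt (fun t : ℝ => D ν (Function.update y j t)) (D (ν + Pi.single j 1) y)
          (Set.Icc 0 1) (y j)

/-- The equal-weight quadrature rule with the points `y 0, …, y (N - 1)`. -/
def quadrature {s : ℕ} (N : ℕ) (y : ℕ → Fin s → ℝ) (F : (Fin s → ℝ) → ℝ) : ℝ :=
  (1 / (N : ℝ)) * ∑ n ∈ Finset.range N, F (y n)

end QMC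

end

/-! The theorem rests on three facts about the field F of residues modulo P, which has N = b^m
elements: the criterion E can be minimized fast, its stepwise minimizers make it small, and it
dominates the integration error.

Speed. Divisibility by P sees residue classes only. Summing b^(-α μ₁(ℓ)) over each class gives a
function w on F (`classSum`), and the inner sum of E becomes a sum of products of w over the
solutions of one linear equation in F. Additive characters detect that equation (`crossSum_eq`) and
turn the sum into N⁻¹ ∑_n ∏_j ω(n q_j), with ω the Fourier transform of w. The factorial in the
weight couples the blocks through |ν| alone; reading k! as the value of a linear functional at z^k
makes the weight a product of polynomials over the blocks (`cbcWeight_eq`). For each n the sum over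
v then satisfies a recursion from block to block (`blockSum_succ_mul`), and the part of E that
depends on the new component is ∑_n ω(n q_d) c_n with c_n already known (`blockCoeff_mul_add`).
Since the multiplicative group of F is cyclic, all N - 1 candidates are evaluated by one Hankel
matrix-vector product, that is, by FFT (`computes_hankel`). Updating N polynomials of degree at most
αs costs O(α²sN) per block, hence the term α²s²N.

Size. The minimum over the candidates is at most their mean; this is used for r-th powers with 0 < r
≤ 1 (`searchCriterion_rpow_le_sum`). The resulting sum over v is majorized, coefficient by
coefficient, by exp(z ∑ x_j) with x_j proportional to β_j^r (`coeff_blockSum_bound`). Thus E^r is at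
most 4/N times ∑_k (k!)^r X^k / k! with X = ∑ x_j. The series converges for r < 1, and for r = 1
when X < 1, which is where the smallness condition enters.

Error. For M ≥ m the nodes lie on the grid of mesh b^(-αM), and the difference between the rule and
the grid average expands into discrete Walsh functions. A character sum over the nodes vanishes
outside the dual net (`sum_stdAddChar_residueHom`). Walsh coefficients are bounded by iterated
summation by parts, with one derivative per nonzero wave number of a block
(`norm_sum_walshProd_le`), and the weights are such that each coefficient is at most c times a term
of E (`norm_walsh_le_cbcWeight`). The bound c E does not depend on M, and M → ∞ turns the grid
averages into the integral. -/

namespace QMC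

/-! ### Algorithms as existence statements -/

/-- `Solvable Good S D k`: if the values of the functions in `S` at an unknown `x ∈ D` are stored in
memory, then some `o` with `Good x o` can be found with at most `k` operations. -/
inductive Solvable {X O : Type} (Good : X → O → Prop) : Set (X → ℝ) → Set X → ℕ → Prop
  | ret {S D k} (o : O) (h : ∀ x ∈ D, Good x o) : Solvable Good S D k
  | const {S D k} (c : ℝ) (h : Solvable Good (insert (fun _ => c) S) D k) :
      Solvable Good S D (k + 1)
  | add {S D k f g} (hf : f ∈ S) (hg : g ∈ S)
      (h : Solvable Good (insert (fun x => f x + g x) S) D k) : Solvable Good S D (k + 1)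
  | sub {S D k f g} (hf : f ∈ S) (hg : g ∈ S)
      (h : Solvable Good (insert (fun x => f x - g x) S) D k) : Solvable Good S D (k + 1)
  | mul {S D k f g} (hf : f ∈ S) (hg : g ∈ S)
      (h : Solvable Good (insert (fun x => f x * g x) S) D k) : Solvable Good S D (k + 1)
  | branch {S D k f g} (hf : f ∈ S) (hg : g ∈ S)
      (h₁ : Solvable Good S {x | x ∈ D ∧ f x ≤ g x} k)
      (h₂ : Solvable Good S {x | x ∈ D ∧ g x < f x} k) : Solvable Good S D (k + 1)

theorem Solvable.mono {X O : Type} {Good : X → O → Prop} {S : Set (X → ℝ)} {D : Set X} {k : ℕ}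
    (h : Solvable Good S D k) {S' : Set (X → ℝ)} {D' : Set X} {k' : ℕ} (hS : S ⊆ S') (hD : D' ⊆ D)
    (hk : k ≤ k') : Solvable Good S' D' k' := by
  induction h generalizing S' D' k' with
  | ret o h => exact .ret o fun x hx => h x (hD hx)
  | const c _ ih =>
    obtain ⟨l, rfl⟩ : ∃ l, k' = l + 1 := ⟨k' - 1, by omega⟩
    exact .const c (ih (Set.insert_subset_insert hS) hD (by omega))
  | add hf hg _ ih =>
    obtain ⟨l, rfl⟩ : ∃ l, k' = l + 1 := ⟨k' - 1, by omega⟩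
    exact .add (hS hf) (hS hg) (ih (Set.insert_subset_insert hS) hD (by omega))
  | sub hf hg _ ih =>
    obtain ⟨l, rfl⟩ : ∃ l, k' = l + 1 := ⟨k' - 1, by omega⟩
    exact .sub (hS hf) (hS hg) (ih (Set.insert_subset_insert hS) hD (by omega))
  | mul hf hg _ ih =>
    obtain ⟨l, rfl⟩ : ∃ l, k' = l + 1 := ⟨k' - 1, by omega⟩
    exact .mul (hS hf) (hS hg) (ih (Set.insert_subset_insert hS) hD (by omega))
  | branch hf hg _ _ ih₁ ih₂ =>
    obtain ⟨l, rfl⟩ : ∃ l, k' = l + 1 := ⟨k' - 1, by omega⟩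
    exact .branch (hS hf) (hS hg) (ih₁ hS (fun x hx => ⟨hD hx.1, hx.2⟩) (by omega))
      (ih₂ hS (fun x hx => ⟨hD hx.1, hx.2⟩) (by omega))

/-- Every new value goes to the fresh cell `a`, so nothing that was stored is ever overwritten and
addresses need not be tracked in `Solvable`. -/
theorem stored_insert {X : Type} {S : Set (X → ℝ)} {D : Set X} {M : X → ℕ → ℝ} {a : ℕ}
    (hM : ∀ f ∈ S, ∃ i < a, ∀ x ∈ D, M x i = f x) (g : X → ℝ) :
    ∀ f ∈ insert g S, ∃ i < a + 1, ∀ x ∈ D, Function.update (M x) a (g x) i = f x := by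
  rintro f (rfl | hf)
  · exact ⟨a, by omega, fun x _ => by simp⟩
  · obtain ⟨i, hi, h⟩ := hM f hf
    exact ⟨i, by omega, fun x hx => by rw [Function.update_of_ne (by omega), h x hx]⟩

/-- A solvable search problem is solved by an algebraic computation tree. -/
theorem Solvable.exists_compTree {X O : Type} {Good : X → O → Prop} {S : Set (X → ℝ)} {D : Set X}
    {k : ℕ} (h : Solvable Good S D k) (M : X → ℕ → ℝ) (a : ℕ)
    (hM : ∀ f ∈ S, ∃ i < a, ∀ x ∈ D, M x i = f x) :
    ∃ t : CompTree O, ∀ x ∈ D, Good x (t.output (M x)) ∧ t.cost (M x) ≤ k := by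
  induction h generalizing M a with
  | ret o h => exact ⟨.ret o, fun x hx => ⟨h x hx, by simp [CompTree.cost]⟩⟩
  | const c _ ih =>
    obtain ⟨t, ht⟩ := ih (fun x => Function.update (M x) a c) (a + 1) (stored_insert hM _)
    exact ⟨.step (.const a c) t, fun x hx => ⟨(ht x hx).1, Nat.succ_le_succ (ht x hx).2⟩⟩
  | add hf hg _ ih =>
    obtain ⟨i, -, hi⟩ := hM _ hf
    obtain ⟨j, -, hj⟩ := hM _ hg
    obtain ⟨t, ht⟩ := ih _ (a + 1) (stored_insert hM _)
    refine ⟨.step (.add a i j) t, fun x hx => ?_⟩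
    simp only [CompTree.output, CompTree.cost, Instr.exec, hi x hx, hj x hx]
    exact ⟨(ht x hx).1, Nat.succ_le_succ (ht x hx).2⟩
  | sub hf hg _ ih =>
    obtain ⟨i, -, hi⟩ := hM _ hf
    obtain ⟨j, -, hj⟩ := hM _ hg
    obtain ⟨t, ht⟩ := ih _ (a + 1) (stored_insert hM _)
    refine ⟨.step (.sub a i j) t, fun x hx => ?_⟩
    simp only [CompTree.output, CompTree.cost, Instr.exec, hi x hx, hj x hx]
    exact ⟨(ht x hx).1, Nat.succ_le_succ (ht x hx).2⟩
  | mul hf hg _ ih =>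
    obtain ⟨i, -, hi⟩ := hM _ hf
    obtain ⟨j, -, hj⟩ := hM _ hg
    obtain ⟨t, ht⟩ := ih _ (a + 1) (stored_insert hM _)
    refine ⟨.step (.mul a i j) t, fun x hx => ?_⟩
    simp only [CompTree.output, CompTree.cost, Instr.exec, hi x hx, hj x hx]
    exact ⟨(ht x hx).1, Nat.succ_le_succ (ht x hx).2⟩
  | branch hf hg _ _ ih₁ ih₂ =>
    obtain ⟨i, -, hi⟩ := hM _ hf
    obtain ⟨j, -, hj⟩ := hM _ hg
    obtain ⟨t₁, ht₁⟩ := ih₁ M a fun f hf =>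
      (hM f hf).imp fun _ h => ⟨h.1, fun x hx => h.2 x hx.1⟩
    obtain ⟨t₂, ht₂⟩ := ih₂ M a fun f hf =>
      (hM f hf).imp fun _ h => ⟨h.1, fun x hx => h.2 x hx.1⟩
    refine ⟨.branch i j t₁ t₂, fun x hx => ?_⟩
    simp only [CompTree.output, CompTree.cost, hi x hx, hj x hx]
    split_ifs with hle
    · exact ⟨(ht₁ x ⟨hx, hle⟩).1, Nat.succ_le_succ (ht₁ x ⟨hx, hle⟩).2⟩
    · have hx' := And.intro hx (not_le.1 hle)
      exact ⟨(ht₂ x hx').1, Nat.succ_le_succ (ht₂ x hx').2⟩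

/-- Branching on the index of the smallest of `n` stored numbers costs `n` comparisons. -/
theorem Solvable.argmin {X O : Type} {Good : X → O → Prop} {S : Set (X → ℝ)} {D : Set X} {k n : ℕ}
    (hn : 0 < n) (f : ℕ → X → ℝ) (hf : ∀ i < n, f i ∈ S)
    (h : ∀ i < n, Solvable Good S {x | x ∈ D ∧ ∀ j < n, f i x ≤ f j x} k) :
    Solvable Good S D (k + n) := by
  -- Here `i` is the best index among the first `r`, and `d` comparisons remain. The index is known
  -- on each branch of the tree and occupies no memory. The start `r = 0`, `i = 0` compares `f 0`
  -- with itself, hence `n` comparisons rather than `n - 1`.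
  have key : ∀ d r, r + d = n → ∀ i < n,
      Solvable Good S {x | x ∈ D ∧ ∀ j < r, f i x ≤ f j x} (k + d) := by
    intro d
    induction d with
    | zero => rintro r rfl i hi; exact h i hi
    | succ d ih =>
      intro r hr i hi
      refine .branch (hf i hi) (hf r (by omega))
        ((ih (r + 1) (by omega) i hi).mono le_rfl ?_ le_rfl)
        ((ih (r + 1) (by omega) r (by omega)).mono le_rfl ?_ le_rfl)
      · rintro x ⟨⟨hx, h1⟩, h2⟩
        refine ⟨hx, fun j hj => ?_⟩
        rcases Nat.lt_succ_iff_lt_or_eq.1 hj with hj | rfl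
        exacts [h1 j hj, h2]
      · rintro x ⟨⟨hx, h1⟩, h2⟩
        refine ⟨hx, fun j hj => ?_⟩
        rcases Nat.lt_succ_iff_lt_or_eq.1 hj with hj | rfl
        exacts [h2.le.trans (h1 j hj), le_rfl]
  exact (key n 0 (by omega) 0 hn).mono le_rfl (fun x hx => ⟨hx, by simp⟩) le_rfl

/-- From the functions in `S` all functions in `T` can be computed with `k` operations. -/
def Computes {X : Type} (S T : Set (X → ℝ)) (k : ℕ) : Prop :=
  ∀ (O : Type) (Good : X → O → Prop) (S' : Set (X → ℝ)) (D : Set X) (l : ℕ), S ⊆ S' →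
    Solvable Good (S' ∪ T) D l → Solvable Good S' D (k + l)

section Computes

variable {X : Type} {S S' T T' U : Set (X → ℝ)} {k k' : ℕ}

theorem Computes.mono (h : Computes S T k) (hS : S ⊆ S') (hT : T' ⊆ T) (hk : k ≤ k') :
    Computes S' T' k' := fun O Good _ D l hR hs =>
  (h O Good _ D l (hS.trans hR) (hs.mono (Set.union_subset_union_right _ hT) le_rfl le_rfl)).mono
    le_rfl le_rfl (by omega)

theorem Computes.of_subset (h : T ⊆ S) : Computes S T k := fun _ _ _ _ _ hR hs =>
  hs.mono (Set.union_subset le_rfl (h.trans hR)) le_rfl (by omega)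

/-- `Computes` is in continuation form: it prefixes any later computation. Composition is therefore
application, and the costs add up. -/
theorem Computes.trans (h : Computes S T k) (h' : Computes (S ∪ T) U k') :
    Computes S (T ∪ U) (k + k') := fun O Good R D l hR hs => by
  have h1 := h' O Good (R ∪ T) D l (Set.union_subset_union_left _ hR)
    (hs.mono (by rw [Set.union_assoc]) le_rfl le_rfl)
  exact (h O Good R D _ hR h1).mono le_rfl le_rfl (by omega)

theorem Computes.trans_right (h : Computes S T k) (h' : Computes (S ∪ T) U k') :
    Computes S U (k + k') := (h.trans h').mono le_rfl Set.subset_union_right le_rfl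

theorem Computes.union (h : Computes S T k) (h' : Computes S U k') :
    Computes S (T ∪ U) (k + k') := h.trans (h'.mono Set.subset_union_left le_rfl le_rfl)

theorem Computes.family {n : ℕ} {T : ℕ → Set (X → ℝ)} (h : ∀ i < n, Computes S (T i) k) :
    Computes S {f | ∃ i < n, f ∈ T i} (n * k) := by
  induction n with
  | zero => exact .of_subset (by rintro f ⟨i, hi, -⟩; omega)
  | succ n ih =>
    refine ((ih fun i hi => h i (by omega)).union (h n (by omega))).mono le_rfl ?_
      (by rw [Nat.succ_mul])
    rintro f ⟨i, hi, hf⟩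
    rcases Nat.lt_succ_iff_lt_or_eq.1 hi with hi | rfl
    exacts [Or.inl ⟨i, hi, hf⟩, Or.inr hf]

theorem Computes.const (c : ℝ) : Computes S {fun _ => c} 1 := fun _ _ _ _ l _ hs => by
  rw [add_comm 1 l]; rw [Set.union_singleton] at hs; exact .const c hs

variable {f g : X → ℝ}

theorem Computes.add (hf : f ∈ S) (hg : g ∈ S) : Computes S {fun x => f x + g x} 1 :=
  fun _ _ _ _ l hR hs => by
    rw [add_comm 1 l]; rw [Set.union_singleton] at hs; exact .add (hR hf) (hR hg) hs

theorem Computes.sub (hf : f ∈ S) (hg : g ∈ S) : Computes S {fun x => f x - g x} 1 :=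
  fun _ _ _ _ l hR hs => by
    rw [add_comm 1 l]; rw [Set.union_singleton] at hs; exact .sub (hR hf) (hR hg) hs

theorem Computes.mul (hf : f ∈ S) (hg : g ∈ S) : Computes S {fun x => f x * g x} 1 :=
  fun _ _ _ _ l hR hs => by
    rw [add_comm 1 l]; rw [Set.union_singleton] at hs; exact .mul (hR hf) (hR hg) hs

theorem Computes.const_mul (hf : f ∈ S) (c : ℝ) : Computes S {fun x => c * f x} 2 :=
  (Computes.const c).trans_right (.mul (Or.inr rfl) (Or.inl hf))

theorem Computes.mem (hf : f ∈ S) : Computes S {f} 0 := .of_subset (by simpa using hf)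

theorem Computes.add' (h : Computes S {f} k) (h' : Computes S {g} k') :
    Computes S {fun x => f x + g x} (k + k' + 1) :=
  (h.union h').trans_right (.add (by simp) (by simp))

theorem Computes.sub' (h : Computes S {f} k) (h' : Computes S {g} k') :
    Computes S {fun x => f x - g x} (k + k' + 1) :=
  (h.union h').trans_right (.sub (by simp) (by simp))

theorem Computes.mul' (h : Computes S {f} k) (h' : Computes S {g} k') :
    Computes S {fun x => f x * g x} (k + k' + 1) :=
  (h.union h').trans_right (.mul (by simp) (by simp))

theorem Computes.sum {n : ℕ} {f : ℕ → X → ℝ} (h : ∀ i < n, Computes S {f i} k) :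
    Computes S {fun x => ∑ i ∈ Finset.range n, f i x} (n * (k + 1) + 1) := by
  induction n with
  | zero => simpa using Computes.const 0
  | succ n ih =>
    simp only [Finset.sum_range_succ]
    refine ((ih fun i hi => h i (by omega)).add' (h n (by omega))).mono le_rfl le_rfl ?_
    rw [Nat.succ_mul]; omega

end Computes

/-! ### The fast Fourier transform -/

/-- The real and imaginary parts of a complex function. -/
def reIm {X : Type} (f : X → ℂ) : Set (X → ℝ) := {fun x => (f x).re, fun x => (f x).im}

/-- The real and imaginary parts of the first `n` functions of a sequence. -/
def reImFamily {X : Type} (n : ℕ) (v : ℕ → X → ℂ) : Set (X → ℝ) := {f | ∃ i < n, f ∈ reIm (v i)}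

theorem computes_reIm_add {X : Type} (f g : X → ℂ) :
    Computes (reIm f ∪ reIm g) (reIm fun x => f x + g x) 2 := by
  refine (Computes.union (k := 1) (k' := 1) (.add (f := fun x => (f x).re)
    (g := fun x => (g x).re) ?_ ?_) (.add (f := fun x => (f x).im)
    (g := fun x => (g x).im) ?_ ?_)).mono le_rfl ?_ le_rfl <;>
  simp [reIm, Set.insert_subset_iff]

theorem computes_reIm_sub {X : Type} (f g : X → ℂ) :
    Computes (reIm f ∪ reIm g) (reIm fun x => f x - g x) 2 := by
  refine (Computes.union (k := 1) (k' := 1) (.sub (f := fun x => (f x).re)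
    (g := fun x => (g x).re) ?_ ?_) (.sub (f := fun x => (f x).im)
    (g := fun x => (g x).im) ?_ ?_)).mono le_rfl ?_ le_rfl <;>
  simp [reIm, Set.insert_subset_iff]

theorem computes_reIm_const_mul {X : Type} (f : X → ℂ) (c : ℂ) :
    Computes (reIm f) (reIm fun x => c * f x) 10 := by
  have hr : (fun x => (f x).re) ∈ reIm f := by simp [reIm]
  have hi : (fun x => (f x).im) ∈ reIm f := by simp [reIm]
  refine (((Computes.const_mul hr c.re).sub' (.const_mul hi c.im)).union
    ((Computes.const_mul hi c.re).add' (.const_mul hr c.im))).mono le_rfl ?_ le_rfl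
  simp [reIm, Set.insert_subset_iff]

theorem sum_range_two_mul {M : Type*} [AddCommMonoid M] (n : ℕ) (f : ℕ → M) :
    ∑ i ∈ Finset.range (2 * n), f i
      = ∑ i ∈ Finset.range n, f (2 * i) + ∑ i ∈ Finset.range n, f (2 * i + 1) := by
  induction n with
  | zero => simp
  | succ n ih =>
    rw [show 2 * (n + 1) = 2 * n + 1 + 1 by ring, Finset.sum_range_succ, Finset.sum_range_succ, ih,
      Finset.sum_range_succ, Finset.sum_range_succ]
    abel

/-- Cooley–Tukey. -/
theorem computes_dft {X : Type} (t : ℕ) (z : ℂ) (hz : t = 0 ∨ z ^ 2 ^ (t - 1) = -1)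
    (v : ℕ → X → ℂ) :
    Computes (reImFamily (2 ^ t) v)
      (reImFamily (2 ^ t) fun k x => ∑ i ∈ Finset.range (2 ^ t), z ^ (i * k) * v i x)
      (14 * (t * 2 ^ t)) := by
  induction t generalizing z v with
  | zero => exact .of_subset (by simp [reImFamily])
  | succ t ih =>
    have hz : z ^ 2 ^ t = -1 := by simpa using hz
    -- The hypothesis on `z` says that it is a primitive root of unity of order `2 ^ t`, in a form
    -- inherited by `z ^ 2`; order 1 needs no condition.
    have hz2 : t = 0 ∨ (z ^ 2) ^ 2 ^ (t - 1) = -1 := by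
      rcases t with - | t
      · simp
      · right; rw [← hz, ← pow_mul]; congr 1; rw [Nat.add_sub_cancel, pow_succ]; ring
    set A : ℕ → X → ℂ := fun k x => ∑ i ∈ Finset.range (2 ^ t), (z ^ 2) ^ (i * k) * v (2 * i) x
      with hA
    set B : ℕ → X → ℂ := fun k x => ∑ i ∈ Finset.range (2 ^ t), (z ^ 2) ^ (i * k) * v (2 * i + 1) x
      with hB
    have h1 : Computes (reImFamily (2 ^ (t + 1)) v) (reImFamily (2 ^ t) A) (14 * (t * 2 ^ t)) := by
      refine (ih (z ^ 2) hz2 fun i => v (2 * i)).mono ?_ le_rfl le_rfl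
      rintro f ⟨i, hi, hf⟩
      exact ⟨2 * i, by rw [pow_succ]; omega, hf⟩
    have h2 : Computes (reImFamily (2 ^ (t + 1)) v) (reImFamily (2 ^ t) B) (14 * (t * 2 ^ t)) := by
      refine (ih (z ^ 2) hz2 fun i => v (2 * i + 1)).mono ?_ le_rfl le_rfl
      rintro f ⟨i, hi, hf⟩
      exact ⟨2 * i + 1, by rw [pow_succ]; omega, hf⟩
    -- One butterfly: 10 operations for the complex multiple `z ^ k * B k`, then 2 for the sum and 2
    -- for the difference.
    have h3 : ∀ k < 2 ^ t, Computes (reImFamily (2 ^ t) A ∪ reImFamily (2 ^ t) B)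
        ((reIm fun x => A k x + z ^ k * B k x) ∪ (reIm fun x => A k x - z ^ k * B k x)) 14 := by
      intro k hk
      have hAk : reIm (A k) ⊆ reImFamily (2 ^ t) A := fun f hf => ⟨k, hk, hf⟩
      have hBk : reIm (B k) ⊆ reImFamily (2 ^ t) B := fun f hf => ⟨k, hk, hf⟩
      refine ((computes_reIm_const_mul (B k) (z ^ k)).mono (hBk.trans Set.subset_union_right)
        le_rfl le_rfl).trans_right (k' := 4) ?_
      refine Computes.union (k := 2) (k' := 2) ?_ ?_
      · exact (computes_reIm_add _ _).mono (Set.union_subset_union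
          (hAk.trans Set.subset_union_left) le_rfl) le_rfl le_rfl
      · exact (computes_reIm_sub _ _).mono (Set.union_subset_union
          (hAk.trans Set.subset_union_left) le_rfl) le_rfl le_rfl
    refine ((h1.union h2).trans_right ((Computes.family h3).mono Set.subset_union_right
      le_rfl le_rfl)).mono le_rfl ?_ ?_
    · rintro f ⟨k, hk, hf⟩
      have hsum : ∀ k x, ∑ i ∈ Finset.range (2 ^ (t + 1)), z ^ (i * k) * v i x
          = A k x + z ^ k * B k x := by
        intro k x
        rw [pow_succ, mul_comm (2 ^ t) 2, sum_range_two_mul, hA, hB, Finset.mul_sum]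
        congr 1 <;> refine Finset.sum_congr rfl fun i _ => ?_
        · rw [← pow_mul]; ring_nf
        · rw [← pow_mul]; ring_nf
      simp only [hsum] at hf
      rcases lt_or_ge k (2 ^ t) with hk' | hk'
      · exact ⟨k, hk', Or.inl hf⟩
      -- Outputs in the upper half are the differences, because `z ^ 2 ^ t = -1`.
      · obtain ⟨l, rfl⟩ := Nat.exists_eq_add_of_le hk'
        have hl : l < 2 ^ t := by rw [pow_succ] at hk; omega
        have hp : ∀ i, (z ^ 2) ^ (i * (2 ^ t + l)) = (z ^ 2) ^ (i * l) := by
          intro i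
          rw [mul_add, pow_add, mul_comm i, pow_mul (z ^ 2), ← pow_mul z, mul_comm 2, pow_mul z, hz]
          simp
        refine ⟨l, hl, Or.inr ?_⟩
        convert hf using 3 with x
        rw [hA, hB]
        simp only [hp, pow_add, hz]
        ring
    · rw [pow_succ]; ring_nf; omega

/-- Products with a fixed Hankel matrix of size `n` take `O(n log n)` operations. -/
theorem computes_hankel {X : Type} (n : ℕ) (c : ℕ → ℝ) (v : ℕ → X → ℝ) :
    Computes {f | ∃ i < n, f = v i}
      {f | ∃ i < n, f = fun x => ∑ j ∈ Finset.range n, c (i + j) * v j x}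
      (160 * (n * (Nat.clog 2 n + 1))) := by
  rcases Nat.eq_zero_or_pos n with rfl | hn
  · exact .of_subset (by rintro f ⟨i, hi, -⟩; omega)
  -- The transform length `L = 2 ^ t` is at least `2 * n`, so the indices `i + j` do not wrap
  -- around, and at most `4 * n`, so the cost stays of order `n log n`.
  set t := Nat.clog 2 n + 1 with ht
  have hnt : 2 * n ≤ 2 ^ t := by
    rw [ht, pow_succ, mul_comm]; exact Nat.mul_le_mul_right _ (Nat.le_pow_clog one_lt_two n)
  have hnt' : 2 ^ t ≤ 4 * n := by
    rcases Nat.lt_or_ge 1 n with h1 | h1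
    · have := Nat.pow_pred_clog_lt_self one_lt_two h1
      have hc : 0 < Nat.clog 2 n := Nat.clog_pos one_lt_two h1
      rw [ht, show Nat.clog 2 n + 1 = Nat.clog 2 n - 1 + 1 + 1 by omega, pow_succ, pow_succ]
      have h2 : 2 ^ (Nat.clog 2 n - 1) < n := this
      omega
    · obtain rfl : n = 1 := by omega
      simp [ht]
  have ht0 : 0 < t := by omega
  set L := 2 ^ t with hL
  have hL0 : L ≠ 0 := by positivity
  set z : ℂ := Complex.exp (2 * Real.pi * Complex.I / L) with hzdef
  have hz : IsPrimitiveRoot z L := Complex.isPrimitiveRoot_exp L hL0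
  have hz0 : z ≠ 0 := Complex.exp_ne_zero _
  have hzhalf : t = 0 ∨ z ^ 2 ^ (t - 1) = -1 := by
    right
    have hsq : (z ^ 2 ^ (t - 1)) ^ 2 = 1 := by
      rw [← pow_mul, ← pow_succ, Nat.sub_add_cancel ht0]; exact hz.pow_eq_one
    rcases sq_eq_one_iff.1 hsq with h | h
    · exact absurd h (hz.pow_ne_one_of_pos_of_lt (by positivity)
        (Nat.pow_lt_pow_right one_lt_two (by omega)))
    · exact h
  have horth : ∀ a < L, ∀ l < L,
      ∑ k ∈ Finset.range L, z ^ (k * a) * (z ^ (l * k))⁻¹ = if l = a then (L : ℂ) else 0 := by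
    intro a ha l hl
    have hterm : ∀ k, z ^ (k * a) * (z ^ (l * k))⁻¹ = (z ^ a * (z ^ l)⁻¹) ^ k := by
      intro k
      rw [mul_pow, inv_pow, ← pow_mul, ← pow_mul, mul_comm a k]
    simp only [hterm]
    split_ifs with h
    · subst h
      rw [mul_inv_cancel₀ (pow_ne_zero _ hz0)]
      simp
    · have h1 : z ^ a * (z ^ l)⁻¹ ≠ 1 := fun h1 =>
        h (hz.pow_inj hl ha ((mul_inv_eq_one₀ (pow_ne_zero _ hz0)).1 h1).symm)
      rw [geom_sum_eq h1, mul_pow, inv_pow, ← pow_mul, ← pow_mul, mul_comm a, mul_comm l, pow_mul,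
        pow_mul, hz.pow_eq_one]
      simp
  set S : Set (X → ℝ) := {f | ∃ i < n, f = v i} with hS
  set v' : ℕ → X → ℂ := fun j x => if j < n then (v j x : ℂ) else 0 with hv'
  set W : ℕ → X → ℂ := fun k x => ∑ j ∈ Finset.range L, z ^ (j * k) * v' j x with hW
  -- The inverse transform of `c`. The Hankel product is a cyclic correlation of the zero-padded
  -- vector, which the transform diagonalizes. The numbers `e k` depend on `c` only and are loaded
  -- as constants.
  set e : ℕ → ℂ := fun k => (∑ l ∈ Finset.range L, (c l : ℂ) * (z ^ (l * k))⁻¹) / L with he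
  have h1 : Computes S (reImFamily L W) (1 + 14 * (t * L)) := by
    refine (Computes.const 0).trans_right ((computes_dft t z hzhalf v').mono ?_ le_rfl le_rfl)
    rintro f ⟨i, hi, rfl | rfl⟩
    · by_cases hin : i < n
      · exact Or.inl ⟨i, hin, by ext x; simp [hv', hin]⟩
      · exact Or.inr (by ext x; simp [hv', hin])
    · exact Or.inr (by ext x; by_cases hin : i < n <;> simp [hv', hin])
  have h2 : Computes (reImFamily L W) (reImFamily L fun k x => e k * W k x) (L * 10) :=
    Computes.family fun k hk => (computes_reIm_const_mul (W k) (e k)).mono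
      (fun f hf => ⟨k, hk, hf⟩) le_rfl le_rfl
  have h3 := computes_dft t z hzhalf fun k x => e k * W k x
  refine ((h1.trans_right (h2.mono Set.subset_union_right le_rfl le_rfl)).trans_right
    (h3.mono Set.subset_union_right le_rfl le_rfl)).mono le_rfl ?_ ?_
  · rintro f ⟨i, hi, rfl⟩
    refine ⟨i, by omega, Or.inl ?_⟩
    ext x
    have : ∑ k ∈ Finset.range L, z ^ (k * i) * (e k * W k x)
        = ((∑ j ∈ Finset.range n, c (i + j) * v j x : ℝ) : ℂ) := by
      calc _ = ∑ j ∈ Finset.range L, ∑ l ∈ Finset.range L, (c l : ℂ) * v' j x / L *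
            ∑ k ∈ Finset.range L, z ^ (k * (i + j)) * (z ^ (l * k))⁻¹ := by
            simp only [hW, he, Finset.mul_sum, Finset.sum_mul, Finset.sum_div]
            rw [Finset.sum_comm]
            refine Finset.sum_congr rfl fun j _ => ?_
            rw [Finset.sum_comm]
            refine Finset.sum_congr rfl fun l _ => Finset.sum_congr rfl fun k _ => ?_
            rw [mul_add, pow_add, mul_comm j k]
            ring
        _ = ∑ j ∈ Finset.range n, ∑ l ∈ Finset.range L, (c l : ℂ) * v' j x / L *
            ∑ k ∈ Finset.range L, z ^ (k * (i + j)) * (z ^ (l * k))⁻¹ := by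
            symm
            refine Finset.sum_subset (Finset.range_subset_range.2 (by omega)) fun j _ hj => ?_
            rw [Finset.mem_range] at hj
            simp [hv', hj]
        _ = _ := by
            push_cast
            refine Finset.sum_congr rfl fun j hj => ?_
            rw [Finset.mem_range] at hj
            rw [Finset.sum_eq_single_of_mem (i + j) (Finset.mem_range.2 (by omega))]
            · rw [horth _ (by omega) _ (by omega), if_pos rfl]
              simp only [hv', hj, if_true]
              field_simp
            · intro l hl hne
              rw [horth _ (by omega) _ (Finset.mem_range.1 hl), if_neg hne, mul_zero]
    have h8 := congrArg Complex.re this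
    rw [Complex.ofReal_re] at h8
    exact h8.symm
  · have : t * L ≤ t * (4 * n) := Nat.mul_le_mul_left _ hnt'
    have h5 : L ≤ t * L := Nat.le_mul_of_pos_left _ ht0
    have h6 : 1 ≤ L := Nat.one_le_iff_ne_zero.2 hL0
    have h7 : t * (4 * n) = 4 * (n * t) := by ring
    rw [← hL]
    omega


/-! ### Digits, digit polynomials and the sums of `ρ ^ μ₁` -/

theorem digitPoly_coeff (b m k r : ℕ) :
    (digitPoly b m k).coeff r = if r < m then ((k / b ^ r % b : ℕ) : ZMod b) else 0 := by
  simp [digitPoly, Polynomial.coeff_X_pow]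

theorem degree_digitPoly_lt (b m k : ℕ) : (digitPoly b m k).degree < m := by
  rw [Polynomial.degree_lt_iff_coeff_zero]
  intro r hr
  rw [digitPoly_coeff, if_neg (by omega)]

theorem eq_of_digits_eq {b : ℕ} (m : ℕ) {k l : ℕ} (hk : k < b ^ m) (hl : l < b ^ m)
    (h : ∀ r < m, k / b ^ r % b = l / b ^ r % b) : k = l := by
  induction m generalizing k l with
  | zero => simp at hk hl; omega
  | succ m ih =>
    have h0 := h 0 (by omega)
    simp only [pow_zero, Nat.div_one] at h0
    have h1 : k / b = l / b := by
      refine ih (Nat.div_lt_of_lt_mul (by rwa [← pow_succ'])) (Nat.div_lt_of_lt_mul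
        (by rwa [← pow_succ'])) fun r hr => ?_
      rw [Nat.div_div_eq_div_mul, Nat.div_div_eq_div_mul, ← pow_succ']
      exact h (r + 1) (by omega)
    rw [← Nat.div_add_mod k b, ← Nat.div_add_mod l b, h0, h1]

theorem digitPoly_injOn {b : ℕ} [Fact b.Prime] (m : ℕ) {k l : ℕ} (hk : k < b ^ m)
    (hl : l < b ^ m) (h : digitPoly b m k = digitPoly b m l) : k = l := by
  refine eq_of_digits_eq m hk hl fun r hr => ?_
  have := congrArg (fun f => f.coeff r) h
  simp only [digitPoly_coeff, if_pos hr] at this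
  rw [ZMod.natCast_eq_natCast_iff'] at this
  simpa using this

theorem sum_digits_lt {b : ℕ} (hb : 0 < b) (m : ℕ) (a : ℕ → ℕ) (ha : ∀ r < m, a r < b) :
    ∑ r ∈ Finset.range m, a r * b ^ r < b ^ m := by
  induction m with
  | zero => simp
  | succ m ih =>
    rw [Finset.sum_range_succ, pow_succ]
    have h1 := ih fun r hr => ha r (by omega)
    have h2 : a m * b ^ m ≤ (b - 1) * b ^ m :=
      Nat.mul_le_mul_right _ (by have := ha m (by omega); omega)
    obtain ⟨c, rfl⟩ : ∃ c, b = c + 1 := ⟨b - 1, by omega⟩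
    simp only [Nat.add_sub_cancel] at h2
    nlinarith

theorem digit_sum_digits {b : ℕ} (hb : 0 < b) (m : ℕ) (a : ℕ → ℕ) (ha : ∀ r < m, a r < b) {r : ℕ}
    (hr : r < m) : (∑ i ∈ Finset.range m, a i * b ^ i) / b ^ r % b = a r := by
  induction m generalizing a r with
  | zero => omega
  | succ m ih =>
    rw [Finset.sum_range_succ']
    have e : ∑ k ∈ Finset.range m, a (k + 1) * b ^ (k + 1) + a 0 * b ^ 0
        = a 0 + b * ∑ k ∈ Finset.range m, a (k + 1) * b ^ k := by
      rw [Finset.mul_sum, add_comm, pow_zero, mul_one]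
      congr 1
      exact Finset.sum_congr rfl fun k _ => by ring
    rw [e]
    rcases r with - | r
    · simp [Nat.add_mul_mod_self_left, Nat.mod_eq_of_lt (ha 0 (by omega))]
    · rw [pow_succ', ← Nat.div_div_eq_div_mul, Nat.add_mul_div_left _ _ hb,
        Nat.div_eq_of_lt (ha 0 (by omega)), zero_add]
      exact ih (fun k => a (k + 1)) (fun k hk => ha _ (by omega)) (by omega)

theorem exists_digitPoly_eq {b : ℕ} [Fact b.Prime] (m : ℕ) (f : (ZMod b)[X]) (hf : f.degree < m) :
    ∃ k < b ^ m, digitPoly b m k = f := by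
  have hb := (Fact.out : b.Prime).pos
  refine ⟨∑ r ∈ Finset.range m, (f.coeff r).val * b ^ r,
    sum_digits_lt hb m _ fun r _ => ZMod.val_lt _, ?_⟩
  ext r
  rw [digitPoly_coeff]
  split_ifs with hr
  · rw [digit_sum_digits hb m _ (fun r _ => ZMod.val_lt _) hr]
    simp
  · rw [(Polynomial.degree_lt_iff_coeff_zero _ _).1 hf r (by omega)]

theorem digitPoly_add_mul (b m k t : ℕ) (hb : 0 < b) :
    digitPoly b m (k + b ^ m * t) = digitPoly b m k := by
  refine Finset.sum_congr rfl fun r hr => ?_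
  have hr := Finset.mem_range.1 hr
  have : (k + b ^ m * t) / b ^ r % b = k / b ^ r % b := by
    rw [show b ^ m = b ^ r * (b * b ^ (m - r - 1)) by rw [← pow_succ', ← pow_add]; congr 1; omega,
      mul_assoc, Nat.add_mul_div_left _ _ (by positivity), mul_assoc, Nat.add_mul_mod_self_left]
  rw [this]

theorem muOne_of_lt_of_le {b a k : ℕ} (h1 : b ^ a ≤ k) (h2 : k < b ^ (a + 1)) (hb : 0 < b) :
    muOne b k = a + 1 := by
  rw [muOne, if_neg (by have := Nat.pow_pos (n := a) hb; omega),
    Nat.log_eq_of_pow_le_of_lt_pow h1 h2]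

theorem muOne_add_mul {b m k t : ℕ} (hb : 1 < b) (hk : k < b ^ m) (ht : 0 < t) :
    muOne b (k + b ^ m * t) = m + muOne b t := by
  have h1 := Nat.pow_log_le_self b ht.ne'
  have h2 := Nat.lt_pow_succ_log_self hb t
  rw [muOne_of_lt_of_le (a := m + Nat.log b t) ?_ ?_ (by omega), muOne, if_neg ht.ne']
  · ring
  · rw [pow_add]; nlinarith [Nat.mul_le_mul_left (b ^ m) h1]
  · rw [add_assoc, pow_add]
    have : b ^ m * (t + 1) ≤ b ^ m * b ^ (Nat.log b t).succ := Nat.mul_le_mul_left _ h2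
    have e : (Nat.log b t).succ = Nat.log b t + 1 := rfl
    rw [e] at this
    nlinarith

theorem muOne_eq_natDegree {b : ℕ} [Fact b.Prime] {m k : ℕ} (h0 : 0 < k) (hk : k < b ^ m) :
    muOne b k = (digitPoly b m k).natDegree + 1 := by
  have hb := (Fact.out : b.Prime).one_lt
  rw [muOne, if_neg h0.ne']
  congr 1
  have h1 := Nat.pow_log_le_self b h0.ne'
  have h2 := Nat.lt_pow_succ_log_self hb k
  have hlt : Nat.log b k < m := Nat.log_lt_of_lt_pow h0.ne' hk
  symm
  refine Polynomial.natDegree_eq_of_le_of_coeff_ne_zero ?_ ?_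
  · rw [Polynomial.natDegree_le_iff_coeff_eq_zero]
    intro r hr
    rw [digitPoly_coeff]
    split_ifs
    · rw [Nat.div_eq_of_lt (h2.trans_le (Nat.pow_le_pow_right (by omega) hr))]; simp
    · rfl
  · rw [digitPoly_coeff, if_pos hlt, Nat.mod_eq_of_lt, Ne, ZMod.natCast_eq_zero_iff]
    · intro hd
      have := Nat.le_of_dvd (Nat.div_pos h1 (by positivity)) hd
      have h3 : k / b ^ Nat.log b k < b := Nat.div_lt_of_lt_mul (by rwa [← pow_succ])
      omega
    · exact Nat.div_lt_of_lt_mul (by rwa [← pow_succ])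

/-- `ρ ^ μ₁(k)` for `k > 0`, and `0` for `k = 0`. -/
noncomputable def posPow (b : ℕ) (ρ : ℝ) (k : ℕ) : ℝ := if k = 0 then 0 else ρ ^ muOne b k

theorem posPow_nonneg {b : ℕ} {ρ : ℝ} (hρ : 0 ≤ ρ) (k : ℕ) : 0 ≤ posPow b ρ k := by
  unfold posPow; split_ifs <;> positivity

/-- There are `(b - 1) * b ^ i` numbers with exactly `i + 1` digits. -/
theorem sum_range_pow_posPow {b : ℕ} (hb : 0 < b) (ρ : ℝ) (a : ℕ) :
    ∑ k ∈ Finset.range (b ^ a), posPow b ρ k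
      = ∑ i ∈ Finset.range a, ((b : ℝ) - 1) * ρ * (b * ρ) ^ i := by
  induction a with
  | zero => simp [posPow]
  | succ a ih =>
    rw [← Finset.sum_range_add_sum_Ico _ (Nat.pow_le_pow_right hb (Nat.le_succ a)), ih,
      Finset.sum_range_succ]
    congr 1
    rw [Finset.sum_congr rfl (g := fun _ => ρ ^ (a + 1))]
    · rw [Finset.sum_const, Nat.card_Ico, nsmul_eq_mul,
        Nat.cast_sub (Nat.pow_le_pow_right hb (Nat.le_succ a))]
      push_cast
      rw [Nat.succ_eq_add_one]
      ring
    · intro k hk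
      rw [Finset.mem_Ico] at hk
      rw [posPow, if_neg (by have := Nat.pow_pos (n := a) hb; omega),
        muOne_of_lt_of_le hk.1 hk.2 hb]

/-- The sum of `ρ ^ μ₁(k)` over all `k ≥ 1`. -/
noncomputable def posSum (b : ℕ) (ρ : ℝ) : ℝ := ((b : ℝ) - 1) * ρ / (1 - b * ρ)

theorem sum_range_pow_posPow' {b : ℕ} (hb : 0 < b) {ρ : ℝ} (h1 : b * ρ < 1) (a : ℕ) :
    ∑ k ∈ Finset.range (b ^ a), posPow b ρ k = posSum b ρ * (1 - (b * ρ) ^ a) := by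
  rw [sum_range_pow_posPow hb, ← Finset.mul_sum, geom_sum_eq h1.ne, posSum]
  have : (b * ρ - 1 : ℝ) ≠ 0 := by linarith
  have : (1 - b * ρ : ℝ) ≠ 0 := by linarith
  field_simp
  ring

theorem posSum_nonneg {b : ℕ} (hb : 0 < b) {ρ : ℝ} (hρ : 0 ≤ ρ) (h1 : b * ρ < 1) :
    0 ≤ posSum b ρ := by
  have : (1 : ℝ) ≤ b := by exact_mod_cast hb
  exact div_nonneg (mul_nonneg (by linarith) hρ) (by linarith)

theorem hasSum_posPow {b : ℕ} (hb : 1 < b) {ρ : ℝ} (hρ : 0 ≤ ρ) (h1 : b * ρ < 1) :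
    HasSum (posPow b ρ) (posSum b ρ) := by
  have h0 : 0 ≤ b * ρ := by positivity
  have hS := posSum_nonneg (by omega) hρ h1
  have hs : Summable (posPow b ρ) := by
    refine summable_of_sum_range_le (c := posSum b ρ) (posPow_nonneg hρ) fun n => ?_
    calc _ ≤ ∑ k ∈ Finset.range (b ^ n), posPow b ρ k :=
          Finset.sum_le_sum_of_subset_of_nonneg
            (Finset.range_subset_range.2 (Nat.lt_pow_self hb).le) fun _ _ _ => posPow_nonneg hρ _
      _ ≤ _ := by
          rw [sum_range_pow_posPow' (by omega) h1]
          nlinarith [pow_nonneg h0 n]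
  have ht := hs.hasSum.tendsto_sum_nat.comp (tendsto_pow_atTop_atTop_of_one_lt hb)
  have ht' : Filter.Tendsto (fun a => ∑ k ∈ Finset.range (b ^ a), posPow b ρ k) Filter.atTop
      (nhds (posSum b ρ * (1 - 0))) := by
    simp only [sum_range_pow_posPow' (show 0 < b by omega) h1]
    exact tendsto_const_nhds.mul (tendsto_const_nhds.sub (tendsto_pow_atTop_nhds_zero_of_lt_one h0 h1))
  rw [← mul_one (posSum b ρ), ← sub_zero (1 : ℝ), ← tendsto_nhds_unique ht ht']
  exact hs.hasSum

/-- For `t ≥ 1` the number `k + b ^ m * t` has `m` digits more than `t`, whatever `k` is. Only the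
term `t = 0` sees `k`. -/
theorem hasSum_posPow_residue {b : ℕ} (hb : 1 < b) {ρ : ℝ} (hρ : 0 ≤ ρ) (h1 : b * ρ < 1) {m k : ℕ}
    (hk : k < b ^ m) :
    HasSum (fun t => posPow b ρ (k + b ^ m * t)) (posPow b ρ k + ρ ^ m * posSum b ρ) := by
  have h := (hasSum_ite_eq 0 (posPow b ρ k)).add ((hasSum_posPow hb hρ h1).mul_left (ρ ^ m))
  refine h.congr_fun fun t => ?_
  rcases Nat.eq_zero_or_pos t with rfl | ht
  · simp [posPow]
  · have hpos : 0 < b ^ m * t := by positivity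
    rw [if_neg ht.ne', posPow, posPow, if_neg (by omega), if_neg ht.ne', muOne_add_mul hb hk ht]
    ring

/-! ### Residue classes modulo `P` -/

/-- `π` identifies the field `F` with the polynomials modulo `P`, where `deg P = m`. -/
structure IsResidueMap {b : ℕ} (P : (ZMod b)[X]) (m : ℕ) {F : Type} [Field F]
    (π : (ZMod b)[X] →+* F) : Prop where
  eq_zero_iff : ∀ f, π f = 0 ↔ P ∣ f
  surjective : Function.Surjective π
  natDegree_eq : P.natDegree = m
  ne_zero : P ≠ 0

namespace IsResidueMap

variable {b m : ℕ} [Fact b.Prime] {P : (ZMod b)[X]} {F : Type} [Field F] {π : (ZMod b)[X] →+* F}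
  (h : IsResidueMap P m π)

include h

theorem eq_of_degree_lt {f g : (ZMod b)[X]} (hf : f.degree < m) (hg : g.degree < m)
    (hfg : π f = π g) : f = g := by
  rw [← sub_eq_zero]
  refine Polynomial.eq_zero_of_dvd_of_degree_lt ((h.eq_zero_iff _).1 (by rw [map_sub, hfg, sub_self]))
    ?_
  rw [Polynomial.degree_eq_natDegree h.ne_zero, h.natDegree_eq]
  exact (Polynomial.degree_sub_le _ _).trans_lt (max_lt hf hg)

theorem exists_degree_lt (y : F) : ∃ f : (ZMod b)[X], f.degree < m ∧ π f = y := by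
  obtain ⟨f, rfl⟩ := h.surjective y
  refine ⟨f % P, ?_, ?_⟩
  · have := Polynomial.degree_mod_lt f h.ne_zero
    rwa [Polynomial.degree_eq_natDegree h.ne_zero, h.natDegree_eq] at this
  · conv_rhs => rw [← EuclideanDomain.div_add_mod f P]
    rw [map_add, map_mul, (h.eq_zero_iff P).2 dvd_rfl, zero_mul, zero_add]

theorem exists_digitPoly (y : F) : ∃ k < b ^ m, π (digitPoly b m k) = y := by
  obtain ⟨f, hf, rfl⟩ := h.exists_degree_lt y
  obtain ⟨k, hk, rfl⟩ := exists_digitPoly_eq m f hf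
  exact ⟨k, hk, rfl⟩

theorem digitPoly_inj {k l : ℕ} (hk : k < b ^ m) (hl : l < b ^ m)
    (hkl : π (digitPoly b m k) = π (digitPoly b m l)) : k = l :=
  digitPoly_injOn m hk hl
    (h.eq_of_degree_lt (degree_digitPoly_lt b m k) (degree_digitPoly_lt b m l) hkl)

theorem sum_range_digitPoly [Fintype F] {M : Type*} [AddCommMonoid M] (f : F → M) :
    ∑ k ∈ Finset.range (b ^ m), f (π (digitPoly b m k)) = ∑ y, f y := by
  refine Finset.sum_bij (fun k _ => π (digitPoly b m k)) (fun _ _ => Finset.mem_univ _)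
    (fun k hk l hl hkl => h.digitPoly_inj (Finset.mem_range.1 hk) (Finset.mem_range.1 hl) hkl)
    (fun y _ => ?_) fun _ _ => rfl
  obtain ⟨k, hk, rfl⟩ := h.exists_digitPoly y
  exact ⟨k, Finset.mem_range.2 hk, rfl⟩

theorem card_eq [Fintype F] : Fintype.card F = b ^ m := by
  have := h.sum_range_digitPoly (fun _ => 1)
  simpa using this.symm

theorem map_genSet_ne_zero {g : (ZMod b)[X]} (hg : g ∈ genSet b m) : π g ≠ 0 := fun h0 =>
  hg.1 (h.eq_of_degree_lt hg.2 (by simp) (by rw [h0, map_zero]))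

theorem exists_mem_genSet {y : F} (hy : y ≠ 0) : ∃ g ∈ genSet b m, π g = y := by
  obtain ⟨f, hf, rfl⟩ := h.exists_degree_lt y
  exact ⟨f, ⟨fun h0 => hy (by rw [h0, map_zero]), hf⟩, rfl⟩

end IsResidueMap

/-- The sum of `ρ ^ μ₁(ℓ)` over all `ℓ ≥ 1` in a residue class. -/
noncomputable def classSum {b : ℕ} {F : Type} [Field F] [DecidableEq F] (m : ℕ) (ρ : ℝ)
    (π : (ZMod b)[X] →+* F) (y : F) : ℝ :=
  ∑' ℓ, if π (digitPoly b m ℓ) = y then posPow b ρ ℓ else 0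

section classSum

variable {b m : ℕ} [Fact b.Prime] {P : (ZMod b)[X]} {F : Type} [Field F] [DecidableEq F]
  {π : (ZMod b)[X] →+* F} (h : IsResidueMap P m π) {ρ : ℝ} (hρ : 0 ≤ ρ) (h1 : b * ρ < 1)

include h hρ h1

/-- `digitPoly` forgets all digits from the `m`-th on and is injective below `b ^ m`, also modulo
`P`; so the class of `k` is the progression `k + b ^ m * t`. -/
theorem hasSum_class {k : ℕ} (hk : k < b ^ m) :
    HasSum (fun ℓ => if π (digitPoly b m ℓ) = π (digitPoly b m k) then posPow b ρ ℓ else 0)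
      (posPow b ρ k + ρ ^ m * posSum b ρ) := by
  have hb := (Fact.out : b.Prime).one_lt
  have hN : 0 < b ^ m := by positivity
  have hinj : Function.Injective fun t => k + b ^ m * t := fun s t hst => by
    have : b ^ m * s = b ^ m * t := by simpa using hst
    exact Nat.eq_of_mul_eq_mul_left hN this
  rw [← hinj.hasSum_iff]
  · refine (hasSum_posPow_residue hb hρ h1 hk).congr_fun fun t => ?_
    simp [digitPoly_add_mul b m k t (by omega)]
  · intro ℓ hℓ
    rw [if_neg]
    intro he
    refine hℓ ⟨ℓ / b ^ m, ?_⟩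
    have h2 := digitPoly_add_mul b m (ℓ % b ^ m) (ℓ / b ^ m) (by omega)
    rw [Nat.mod_add_div] at h2
    rw [h2] at he
    have := h.digitPoly_inj (Nat.mod_lt _ hN) hk he
    simp only
    rw [← this, Nat.mod_add_div]

theorem classSum_digitPoly {k : ℕ} (hk : k < b ^ m) :
    classSum m ρ π (π (digitPoly b m k)) = posPow b ρ k + ρ ^ m * posSum b ρ :=
  (hasSum_class h hρ h1 hk).tsum_eq

theorem hasSum_classSum (y : F) :
    HasSum (fun ℓ => if π (digitPoly b m ℓ) = y then posPow b ρ ℓ else 0) (classSum m ρ π y) := by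
  obtain ⟨k, hk, rfl⟩ := h.exists_digitPoly y
  exact (hasSum_class h hρ h1 hk).summable.hasSum

theorem classSum_zero : classSum m ρ π 0 = ρ ^ m * posSum b ρ := by
  have hN : 0 < b ^ m := Nat.pow_pos (Fact.out : b.Prime).pos
  have := classSum_digitPoly h hρ h1 hN
  simpa [digitPoly, posPow] using this

/-- The class of zero lacks its shortest member, since `ℓ = 0` is excluded. This minimality pays for
the degenerate tuples in `sum_crossSum_update_le`. -/
theorem classSum_zero_le (y : F) : classSum m ρ π 0 ≤ classSum m ρ π y := by
  obtain ⟨k, hk, rfl⟩ := h.exists_digitPoly y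
  rw [classSum_zero h hρ h1, classSum_digitPoly h hρ h1 hk]
  linarith [posPow_nonneg (b := b) hρ k]

theorem classSum_zero_nonneg : 0 ≤ classSum m ρ π 0 := by
  rw [classSum_zero h hρ h1]
  have := posSum_nonneg (Fact.out : b.Prime).pos hρ h1
  positivity

theorem classSum_nonneg (y : F) : 0 ≤ classSum m ρ π y :=
  (classSum_zero_nonneg h hρ h1).trans (classSum_zero_le h hρ h1 y)

/-- The number of digits is one more than the degree, which negation preserves. Evenness is what
makes the Fourier transform of `classSum` real. -/
theorem classSum_neg (y : F) : classSum m ρ π (-y) = classSum m ρ π y := by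
  obtain ⟨k, hk, rfl⟩ := h.exists_digitPoly y
  obtain ⟨l, hl, hlk⟩ := exists_digitPoly_eq m (-digitPoly b m k)
    (by rw [Polynomial.degree_neg]; exact degree_digitPoly_lt b m k)
  rw [← map_neg, ← hlk, classSum_digitPoly h hρ h1 hk, classSum_digitPoly h hρ h1 hl]
  congr 1
  have h0 : ∀ k < b ^ m, digitPoly b m k = 0 ↔ k = 0 := fun k hk => by
    constructor
    · intro h0
      refine digitPoly_injOn m hk (Nat.pow_pos (Fact.out : b.Prime).pos) (h0.trans ?_)
      simp [digitPoly]
    · rintro rfl; simp [digitPoly]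
  by_cases hk0 : k = 0
  · have : l = 0 := by rw [← h0 l hl, hlk, (h0 k hk).2 hk0, neg_zero]
    rw [hk0, this]
  · have hl0 : l ≠ 0 := fun hl0 => hk0 (by rw [← h0 k hk, ← neg_eq_zero, ← hlk, (h0 l hl).2 hl0])
    rw [posPow, posPow, if_neg hk0, if_neg hl0, muOne_eq_natDegree (Nat.pos_of_ne_zero hk0) hk,
      muOne_eq_natDegree (Nat.pos_of_ne_zero hl0) hl, hlk, Polynomial.natDegree_neg]

end classSum

/-! ### The inner sums of the search criterion -/

theorem hasSum_pi_fin_prod (n : ℕ) (r : Fin n → ℕ → ℝ) (a : Fin n → ℝ) (h0 : ∀ i k, 0 ≤ r i k)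
    (hr : ∀ i, HasSum (r i) (a i)) :
    HasSum (fun ℓ : Fin n → ℕ => ∏ i, r i (ℓ i)) (∏ i, a i) := by
  induction n with
  | zero => simp [hasSum_unique]
  | succ n ih =>
    have h2 := ih (fun i => r i.succ) (fun i => a i.succ) (fun i => h0 _) (fun i => hr _)
    have hs : Summable fun x : ℕ × (Fin n → ℕ) => r 0 x.1 * ∏ i, r (Fin.succ i) (x.2 i) :=
      Summable.mul_of_nonneg (g := fun ℓ : Fin n → ℕ => ∏ i, r (Fin.succ i) (ℓ i))
        (hr 0).summable h2.summable (fun k => h0 0 k)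
        fun ℓ => Finset.prod_nonneg fun i _ => h0 _ _
    have h3 := (hr 0).mul h2 hs
    rw [← (Fin.consEquiv fun _ : Fin (n + 1) => ℕ).symm.hasSum_iff] at h3
    rw [Fin.prod_univ_succ]
    refine h3.congr_fun fun ℓ => ?_
    rw [Fin.prod_univ_succ]
    rfl

theorem hasSum_pi_prod {ι : Type} [Fintype ι] (r : ι → ℕ → ℝ) (a : ι → ℝ) (h0 : ∀ i n, 0 ≤ r i n)
    (hr : ∀ i, HasSum (r i) (a i)) :
    HasSum (fun ℓ : ι → ℕ => ∏ i, r i (ℓ i)) (∏ i, a i) := by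
  have e := (Fintype.equivFin ι).symm
  have h2 := hasSum_pi_fin_prod _ (fun i => r (e i)) (fun i => a (e i)) (fun i => h0 _)
    (fun i => hr _)
  rw [e.prod_comp] at h2
  rw [← (Equiv.arrowCongr e.symm (Equiv.refl ℕ)).hasSum_iff] at h2
  refine h2.congr_fun fun ℓ => ?_
  rw [← e.prod_comp]
  rfl

/-- The sum of `∏ w (g_j)` over all solutions of `∑ g_j y_j = 0`. -/
noncomputable def crossSum {F : Type} [Field F] [Fintype F] [DecidableEq F] (w : F → ℝ) {ι : Type}
    [Fintype ι]
    [DecidableEq ι] (y : ι → F) : ℝ :=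
  ∑ g : ι → F, if ∑ j, g j * y j = 0 then ∏ j, w (g j) else 0

theorem mul_inv_pow_lt_one {b α : ℕ} (hb : 1 < b) (hα : 2 ≤ α) :
    (b : ℝ) * ((b : ℝ)⁻¹) ^ α < 1 := by
  have hb' : (1 : ℝ) < b := by exact_mod_cast hb
  obtain ⟨c, rfl⟩ := Nat.exists_eq_add_of_le hα
  have h2 : ((b : ℝ)⁻¹) ^ (1 + c) < 1 :=
    pow_lt_one₀ (by positivity) (inv_lt_one_of_one_lt₀ hb') (by omega)
  rw [show 2 + c = 1 + c + 1 by ring, pow_succ, mul_comm, mul_assoc, inv_mul_cancel₀ (by positivity),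
    mul_one]
  exact h2

section dualNet

variable {b m : ℕ} [Fact b.Prime] {P : (ZMod b)[X]} {F : Type} [Field F] [Fintype F]
  [DecidableEq F] {π : (ZMod b)[X] →+* F} (h : IsResidueMap P m π) {D : ℕ}
  (q : Fin D → (ZMod b)[X]) (v : Finset (Fin D))

include h

/-- Sorts the dual net by the tuple `g` of residue classes. Only one `g` survives for each `ℓ`, and
positivity of the entries is enforced by `posPow` being zero at zero. -/
theorem sum_ite_residues_eq_indicator (ρ : ℝ) (ℓ : {j // j ∈ v} → ℕ) :
    (∑ g : {j // j ∈ v} → F, if ∑ j, g j * π (q j) = 0 then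
        ∏ j, (if π (digitPoly b m (ℓ j)) = g j then posPow b ρ (ℓ j) else 0) else 0)
      = (dualNet m P q v).indicator (fun ℓ => ∏ j, ρ ^ muOne b (ℓ j)) ℓ := by
  rw [Finset.sum_eq_single_of_mem (fun j => π (digitPoly b m (ℓ j))) (Finset.mem_univ _)]
  · simp only [if_true]
    have hdvd : (∑ j : {j // j ∈ v}, π (digitPoly b m (ℓ j)) * π (q j) = 0) ↔
        P ∣ ∑ j : {j // j ∈ v}, digitPoly b m (ℓ j) * q j := by
      rw [← h.eq_zero_iff, map_sum]
      simp only [map_mul]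
    by_cases hd : P ∣ ∑ j : {j // j ∈ v}, digitPoly b m (ℓ j) * q j
    · rw [if_pos (hdvd.2 hd)]
      by_cases hpos : ∀ j, 0 < ℓ j
      · rw [Set.indicator_of_mem (show ℓ ∈ dualNet m P q v from ⟨hpos, hd⟩)]
        exact Finset.prod_congr rfl fun j _ => by rw [posPow, if_neg (hpos j).ne']
      · rw [Set.indicator_of_notMem (fun hm => hpos hm.1)]
        push Not at hpos
        obtain ⟨j, hj⟩ := hpos
        exact Finset.prod_eq_zero (Finset.mem_univ j) (by rw [posPow, if_pos (by omega)])
    · rw [if_neg (fun h0 => hd (hdvd.1 h0)), Set.indicator_of_notMem (fun hm => hd hm.2)]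
  · intro g _ hg
    split_ifs
    · obtain ⟨j, hj⟩ := Function.ne_iff.1 hg
      exact Finset.prod_eq_zero (Finset.mem_univ j) (if_neg (Ne.symm hj))
    · rfl

theorem hasSum_dualNet_of_lt {ρ : ℝ} (hρ : 0 ≤ ρ) (h1 : b * ρ < 1) :
    HasSum (fun ℓ : dualNet m P q v => ∏ j, ρ ^ muOne b (ℓ.1 j))
      (crossSum (classSum m ρ π) fun j : {j // j ∈ v} => π (q j)) := by
  have hg : ∀ g : {j // j ∈ v} → F, HasSum (fun ℓ : {j // j ∈ v} → ℕ =>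
      if ∑ j, g j * π (q j) = 0 then
        ∏ j, (if π (digitPoly b m (ℓ j)) = g j then posPow b ρ (ℓ j) else 0) else 0)
      (if ∑ j, g j * π (q j) = 0 then ∏ j, classSum m ρ π (g j) else 0) := by
    intro g
    by_cases hg : ∑ j, g j * π (q j) = 0
    · simp only [if_pos hg]
      refine hasSum_pi_prod (fun j ℓ => if π (digitPoly b m ℓ) = g j then posPow b ρ ℓ else 0) _
        (fun j ℓ => ?_) fun j => hasSum_classSum h hρ h1 (g j)
      split_ifs
      exacts [posPow_nonneg hρ _, le_rfl]
    · simp only [if_neg hg]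
      exact hasSum_zero
  have key := hasSum_sum (s := Finset.univ) fun g _ => hg g
  simp only [sum_ite_residues_eq_indicator h q v] at key
  exact (hasSum_subtype_iff_indicator (f := fun ℓ : {j // j ∈ v} → ℕ => ∏ j, ρ ^ muOne b (ℓ j))).2
    key

theorem hasSum_dualNet {α : ℕ} (hα : 2 ≤ α) :
    HasSum (fun ℓ : dualNet m P q v => ((b : ℝ)⁻¹) ^ (α * ∑ j, muOne b (ℓ.1 j)))
      (crossSum (classSum m (((b : ℝ)⁻¹) ^ α) π) fun j : {j // j ∈ v} => π (q j)) := by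
  refine (hasSum_dualNet_of_lt h q v (by positivity)
    (mul_inv_pow_lt_one (Fact.out : b.Prime).one_lt hα)).congr_fun fun ℓ => ?_
  rw [pow_mul, Finset.prod_pow_eq_pow_sum]

end dualNet

theorem searchCriterion_eq {b m : ℕ} [Fact b.Prime] {P : (ZMod b)[X]} {F : Type} [Field F]
    [Fintype F] [DecidableEq F] {π : (ZMod b)[X] →+* F} (h : IsResidueMap P m π) {α : ℕ}
    (hα : 2 ≤ α) (β : ℕ → ℝ) {D : ℕ} (q : Fin D → (ZMod b)[X]) (d : ℕ) :
    searchCriterion m α P β q d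
      = ∑ v : Finset (Fin D) with v.Nonempty ∧ ∀ j : Fin D, j ∈ v → (j : ℕ) < d,
        cbcWeight b α β v *
          crossSum (classSum m (((b : ℝ)⁻¹) ^ α) π) fun j : {j // j ∈ v} => π (q j) :=
  Finset.sum_congr rfl fun v _ => by rw [(hasSum_dualNet h q v hα).tsum_eq]

/-! ### Fourier transform on the residue field -/

/-- The Fourier transform of a function on a finite field. -/
noncomputable def fieldFourier {F : Type} [Field F] [Fintype F] (w : F → ℝ) (x : F) : ℝ :=
  (∑ g, (w g : ℂ) * AddChar.FiniteField.primitiveChar_to_Complex F (g * x)).re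

/-- Conjugating the character amounts to `g ↦ -g`, so for even `w` the real part in the definition
discards nothing. -/
theorem fieldFourier_eq {F : Type} [Field F] [Fintype F] (w : F → ℝ) (hw : ∀ g, w (-g) = w g)
    (x : F) :
    (fieldFourier w x : ℂ) = ∑ g, (w g : ℂ) * AddChar.FiniteField.primitiveChar_to_Complex F (g * x) := by
  rw [fieldFourier, ← Complex.conj_eq_iff_re, map_sum]
  rw [← Equiv.sum_comp (Equiv.neg F)]
  refine Finset.sum_congr rfl fun g _ => ?_
  simp only [Equiv.neg_apply, map_mul, Complex.conj_ofReal, hw, neg_mul]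
  rw [AddChar.starComp_apply (Nat.pos_of_ne_zero (CharP.ringChar_ne_zero_of_finite F)),
    AddChar.inv_apply, neg_neg]

theorem addChar_map_sum {A M ι : Type*} [AddCommMonoid A] [CommMonoid M] (ψ : AddChar A M)
    (s : Finset ι) (f : ι → A) : ψ (∑ i ∈ s, f i) = ∏ i ∈ s, ψ (f i) :=
  map_prod ψ.toMonoidHom (fun i => Multiplicative.ofAdd (f i)) s

/-- Orthogonality: the average over `n` of `ψ (n * ∑ g_j y_j)` is the indicator of the linear
equation, and for fixed `n` the sum over `g` factors. -/
theorem crossSum_eq {F : Type} [Field F] [Fintype F] [DecidableEq F] (w : F → ℝ)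
    (hw : ∀ g, w (-g) = w g) {ι : Type} [Fintype ι] [DecidableEq ι] (y : ι → F) :
    crossSum w y = (Fintype.card F : ℝ)⁻¹ * ∑ n, ∏ j, fieldFourier w (n * y j) := by
  have hN : (Fintype.card F : ℂ) ≠ 0 := Nat.cast_ne_zero.2 Fintype.card_ne_zero
  apply Complex.ofReal_injective
  push_cast
  rw [eq_inv_mul_iff_mul_eq₀ hN]
  have h1 : ∀ n : F, ∏ j, (fieldFourier w (n * y j) : ℂ) = ∑ g : ι → F, (∏ j, (w (g j) : ℂ)) *
      AddChar.FiniteField.primitiveChar_to_Complex F (n * ∑ j, g j * y j) := by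
    intro n
    simp only [fieldFourier_eq w hw, Finset.prod_univ_sum, Fintype.piFinset_univ]
    refine Finset.sum_congr rfl fun g _ => ?_
    rw [Finset.prod_mul_distrib, Finset.mul_sum, addChar_map_sum]
    congr 1
    exact Finset.prod_congr rfl fun j _ => by congr 1; ring
  simp only [h1]
  rw [Finset.sum_comm, crossSum]
  push_cast
  rw [Finset.mul_sum]
  refine Finset.sum_congr rfl fun g _ => ?_
  rw [← Finset.mul_sum,
    AddChar.sum_mulShift _ (AddChar.FiniteField.primitiveChar_to_Complex_isPrimitive F)]
  split_ifs <;> simp [mul_comm]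


/-! ### Sums over index sets that are weighted by the blocks they meet -/

section blockSum

variable {R : Type*} [CommRing R] (α : ℕ) (p ω : ℕ → R)

/-- The sum over all `v ⊆ {0, …, d - 1}` of the product of `p` over the blocks of `v` and of `ω`
over `v`. -/
def blockSum (d : ℕ) : R :=
  ∑ v ∈ (Finset.range d).powerset, (∏ J ∈ v.image (· / α), p J) * ∏ j ∈ v, ω j

/-- The coefficient of `ω d` in `blockSum α p ω (d + 1)`. -/
def blockCoeff (d : ℕ) : R :=
  ∑ v ∈ (Finset.range d).powerset, (∏ J ∈ (insert d v).image (· / α), p J) * ∏ j ∈ v, ω j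

theorem blockSum_zero : blockSum α p ω 0 = 1 := by simp [blockSum]

theorem blockSum_succ (d : ℕ) :
    blockSum α p ω (d + 1) = blockSum α p ω d + ω d * blockCoeff α p ω d := by
  rw [blockSum, Finset.range_add_one, Finset.sum_powerset_insert Finset.notMem_range_self, blockSum,
    blockCoeff, Finset.mul_sum]
  congr 1
  refine Finset.sum_congr rfl fun v hv => ?_
  rw [Finset.prod_insert (fun h => Finset.notMem_range_self (Finset.mem_powerset.1 hv h))]
  ring

/-- The first index of a block opens a block that no smaller index meets, so its factor `p J` splits
off. -/
theorem blockCoeff_mul (hα : 0 < α) (J : ℕ) :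
    blockCoeff α p ω (J * α) = p J * blockSum α p ω (J * α) := by
  rw [blockSum, blockCoeff, Finset.mul_sum]
  refine Finset.sum_congr rfl fun v hv => ?_
  rw [Finset.image_insert, Nat.mul_div_cancel _ hα, Finset.prod_insert, mul_assoc]
  intro h
  obtain ⟨j, hj, h⟩ := Finset.mem_image.1 h
  have h1 := Finset.mem_range.1 (Finset.mem_powerset.1 hv hj)
  have := (Nat.div_lt_iff_lt_mul hα).2 h1
  omega

/-- When `d` and `d + 1` share a block, adding `d` to a set that will receive `d + 1` changes no
block factor; it contributes only `ω d`. -/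
theorem blockCoeff_succ {d : ℕ} (hd : (d + 1) / α = d / α) :
    blockCoeff α p ω (d + 1) = (1 + ω d) * blockCoeff α p ω d := by
  rw [blockCoeff, Finset.range_add_one, Finset.sum_powerset_insert Finset.notMem_range_self,
    blockCoeff, add_mul, one_mul, Finset.mul_sum]
  congr 1
  · refine Finset.sum_congr rfl fun v _ => ?_
    rw [Finset.image_insert, Finset.image_insert, hd]
  · refine Finset.sum_congr rfl fun v hv => ?_
    rw [Finset.prod_insert (fun h => Finset.notMem_range_self (Finset.mem_powerset.1 hv h)),
      Finset.image_insert, hd, Finset.insert_eq_self.2]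
    · ring
    · exact Finset.mem_image_of_mem _ (Finset.mem_insert_self _ _)

/-- Everything except the last product is fixed while block `J` is processed. This is why the
expensive polynomial work is done once per block and not once per component. -/
theorem blockCoeff_mul_add {i : ℕ} (J : ℕ) (hi : i < α) :
    blockCoeff α p ω (J * α + i)
      = p J * blockSum α p ω (J * α) * ∏ k ∈ Finset.range i, (1 + ω (J * α + k)) := by
  induction i with
  | zero => simp [blockCoeff_mul α p ω (by omega) J]
  | succ i ih =>
    have hd : ∀ i < α, (J * α + i) / α = J := fun i hi => by
      rw [mul_comm, Nat.mul_add_div (by omega), Nat.div_eq_of_lt hi, add_zero]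
    rw [← add_assoc, blockCoeff_succ, ih (by omega), Finset.prod_range_succ]
    · ring
    · rw [add_assoc, hd _ hi, hd _ (by omega)]

theorem blockSum_mul_add {i : ℕ} (J : ℕ) (hi : i ≤ α) :
    blockSum α p ω (J * α + i) = blockSum α p ω (J * α)
      + (∏ k ∈ Finset.range i, (1 + ω (J * α + k)) - 1) * (p J * blockSum α p ω (J * α)) := by
  induction i with
  | zero => simp
  | succ i ih =>
    rw [← add_assoc, blockSum_succ, ih (by omega), blockCoeff_mul_add α p ω J (by omega),
      Finset.prod_range_succ]
    ring

theorem blockSum_succ_mul (J : ℕ) :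
    blockSum α p ω ((J + 1) * α) = blockSum α p ω (J * α)
      + (∏ k ∈ Finset.range α, (1 + ω (J * α + k)) - 1) * (p J * blockSum α p ω (J * α)) := by
  rw [Nat.succ_mul, blockSum_mul_add α p ω J le_rfl]

theorem blockSum_congr {ω' : ℕ → R} {d : ℕ} (h : ∀ j < d, ω j = ω' j) :
    blockSum α p ω d = blockSum α p ω' d :=
  Finset.sum_congr rfl fun v hv => by
    rw [Finset.prod_congr rfl fun j hj =>
      h j (Finset.mem_range.1 (Finset.mem_powerset.1 hv hj))]

theorem blockCoeff_congr {ω' : ℕ → R} {d : ℕ} (h : ∀ j < d, ω j = ω' j) :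
    blockCoeff α p ω d = blockCoeff α p ω' d :=
  Finset.sum_congr rfl fun v hv => by
    rw [Finset.prod_congr rfl fun j hj =>
      h j (Finset.mem_range.1 (Finset.mem_powerset.1 hv hj))]

/-- Nonempty index sets below `d`, as sets of elements of `Fin D`. -/
theorem sum_blocks_eq {D d : ℕ} (hd : d ≤ D) :
    ∑ v : Finset (Fin D) with v.Nonempty ∧ ∀ j : Fin D, j ∈ v → (j : ℕ) < d,
      (∏ J ∈ blocks α v, p J) * ∏ j ∈ v, ω j = blockSum α p ω d - 1 := by
  have h0 : (∅ : Finset ℕ) ∈ (Finset.range d).powerset := Finset.empty_mem_powerset _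
  rw [blockSum, ← Finset.add_sum_erase _ _ h0]
  simp only [Finset.image_empty, Finset.prod_empty, mul_one, add_sub_cancel_left]
  refine Finset.sum_bij (fun v _ => v.map Fin.valEmbedding) ?_ ?_ ?_ ?_
  · intro v hv
    simp only [Finset.mem_filter, Finset.mem_univ, true_and] at hv
    simp only [Finset.mem_erase, Finset.mem_powerset, ne_eq, Finset.map_eq_empty]
    refine ⟨hv.1.ne_empty, fun j hj => ?_⟩
    obtain ⟨i, hi, rfl⟩ := Finset.mem_map.1 hj
    exact Finset.mem_range.2 (hv.2 i hi)
  · intro v _ v' _ h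
    exact Finset.map_injective _ h
  · intro v hv
    simp only [Finset.mem_erase, Finset.mem_powerset] at hv
    have hlt : ∀ j ∈ v, j < d := fun j hj => Finset.mem_range.1 (hv.2 hj)
    refine ⟨Finset.univ.filter fun j : Fin D => (j : ℕ) ∈ v, ?_, ?_⟩
    · simp only [Finset.mem_filter, Finset.mem_univ, true_and]
      obtain ⟨j, hj⟩ := Finset.nonempty_iff_ne_empty.2 hv.1
      exact ⟨⟨⟨j, (hlt j hj).trans_le hd⟩, by simpa using hj⟩, fun j hj => hlt j hj⟩
    · ext j
      simp only [Finset.mem_map, Finset.mem_filter, Finset.mem_univ, true_and,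
        Fin.valEmbedding_apply]
      exact ⟨by rintro ⟨i, hi, rfl⟩; exact hi,
        fun hj => ⟨⟨j, (hlt j hj).trans_le hd⟩, hj, rfl⟩⟩
  · intro v _
    rw [Finset.prod_map, blocks, Finset.map_eq_image, Finset.image_image]
    rfl

end blockSum

/-! ### Weights as values of linear functionals on polynomials -/

/-- The linear functional `z ^ k ↦ φ k` on polynomials. -/
noncomputable def coeffFunctional (φ : ℕ → ℝ) : ℝ[X] →ₗ[ℝ] ℝ :=
  Polynomial.lsum fun k => φ k • LinearMap.id

theorem coeffFunctional_monomial (φ : ℕ → ℝ) (k : ℕ) (a : ℝ) :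
    coeffFunctional φ (Polynomial.monomial k a) = φ k * a := by
  simp [coeffFunctional, Polynomial.lsum_apply, Polynomial.sum_monomial_index]

theorem coeffFunctional_one (φ : ℕ → ℝ) : coeffFunctional φ 1 = φ 0 := by
  rw [← Polynomial.monomial_zero_one, coeffFunctional_monomial, mul_one]

theorem coeffFunctional_C_mul (φ : ℕ → ℝ) (c : ℝ) (f : ℝ[X]) :
    coeffFunctional φ (Polynomial.C c * f) = c * coeffFunctional φ f := by
  rw [← Polynomial.smul_eq_C_mul, map_smul, smul_eq_mul]

theorem coeffFunctional_eq_sum (φ : ℕ → ℝ) (f : ℝ[X]) {n : ℕ} (hf : f.natDegree < n) :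
    coeffFunctional φ f = ∑ k ∈ Finset.range n, φ k * f.coeff k := by
  conv_lhs => rw [f.as_sum_range' n hf]
  simp [coeffFunctional_monomial]

/-- The polynomial `∑_{1 ≤ ν ≤ α} t_ν z ^ ν`. -/
noncomputable def rowPoly (α : ℕ) (t : ℕ → ℝ) : ℝ[X] :=
  ∑ ν ∈ Finset.Icc 1 α, Polynomial.monomial ν (t ν)

theorem natDegree_rowPoly_le (α : ℕ) (t : ℕ → ℝ) : (rowPoly α t).natDegree ≤ α :=
  Polynomial.natDegree_sum_le_of_forall_le _ _ fun _ hν =>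
    (Polynomial.natDegree_monomial_le _).trans (Finset.mem_Icc.1 hν).2

theorem coeff_rowPoly_mul (α : ℕ) (t : ℕ → ℝ) (f : ℝ[X]) (k : ℕ) :
    (rowPoly α t * f).coeff k
      = ∑ i ∈ Finset.range α, if i + 1 ≤ k then t (i + 1) * f.coeff (k - (i + 1)) else 0 := by
  rw [rowPoly, Finset.sum_mul, Polynomial.finsetSum_coeff, Finset.range_eq_Ico,
    Finset.sum_Ico_add' (fun ν => if ν ≤ k then t ν * f.coeff (k - ν) else 0) 0 α 1, zero_add]
  refine Finset.sum_congr (by ext; simp) fun ν _ => ?_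
  split_ifs with h
  · obtain ⟨l, rfl⟩ := Nat.exists_eq_add_of_le' h
    rw [Polynomial.coeff_monomial_mul, Nat.add_sub_cancel]
  · rw [← Polynomial.C_mul_X_pow_eq_monomial, mul_assoc, Polynomial.coeff_C_mul,
      Polynomial.coeff_X_pow_mul', if_neg h, mul_zero]

/-- The factor `φ (∑ ν)` is the only coupling between the elements of `u`. Recording `∑ ν` as the
exponent of a formal variable decouples them. -/
theorem sum_piFinset_eq_coeffFunctional (φ : ℕ → ℝ) (α : ℕ) (t : ℕ → ℕ → ℝ) (u : Finset ℕ) :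
    ∑ ν ∈ Fintype.piFinset (fun _ : {j // j ∈ u} => Finset.Icc 1 α),
        φ (∑ j, ν j) * ∏ j : {j // j ∈ u}, t j (ν j)
      = coeffFunctional φ (∏ j ∈ u, rowPoly α (t j)) := by
  rw [← Finset.prod_coe_sort]
  simp only [rowPoly]
  rw [Finset.prod_univ_sum, map_sum]
  refine Finset.sum_congr rfl fun ν _ => ?_
  rw [← coeffFunctional_monomial]
  congr 1
  simp only [← Polynomial.C_mul_X_pow_eq_monomial, Finset.prod_mul_distrib,
    Finset.prod_pow_eq_pow_sum, map_prod]

/-- The factor `2 ^ δ(ν, α) β ^ ν` times a constant `B`. -/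
noncomputable def rowWeight (B : ℝ) (α : ℕ) (x : ℝ) (ν : ℕ) : ℝ :=
  B * ((if ν = α then 2 else 1) * x ^ ν)

/-- The constant that each block contributes to the weight. -/
noncomputable def blockConst (b α : ℕ) : ℝ := walshConst α b * (b : ℝ) ^ (α * (α - 1) / 2)

theorem cbcWeight_eq (b α : ℕ) (β : ℕ → ℝ) {D : ℕ} (v : Finset (Fin D)) :
    cbcWeight b α β v = coeffFunctional (fun k => (k.factorial : ℝ))
      (∏ J ∈ blocks α v, rowPoly α (rowWeight (blockConst b α) α (β J))) := by
  rw [← sum_piFinset_eq_coeffFunctional, cbcWeight, spodWeight, pow_mul, mul_right_comm, ← mul_pow,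
    ← blockConst, Finset.mul_sum]
  refine Finset.sum_congr rfl fun ν _ => ?_
  simp only [rowWeight]
  simp only [Finset.prod_mul_distrib, Finset.prod_const, Finset.card_univ, Fintype.card_coe]
  ring

/-! ### The search criterion as a function of the last component -/

/-- The weight polynomials of the blocks. -/
noncomputable def weightPoly (b α : ℕ) (β : ℕ → ℝ) (J : ℕ) : ℝ[X] :=
  rowPoly α (rowWeight (blockConst b α) α (β J))

/-- The residue classes of the components, extended by zero. -/
noncomputable def residues {b : ℕ} {F : Type} [Field F] (π : (ZMod b)[X] →+* F) {D : ℕ}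
    (q : Fin D → (ZMod b)[X]) (j : ℕ) : F := if hj : j < D then π (q ⟨j, hj⟩) else 0

theorem residues_val {b : ℕ} {F : Type} [Field F] (π : (ZMod b)[X] →+* F) {D : ℕ}
    (q : Fin D → (ZMod b)[X]) (j : Fin D) : residues π q j = π (q j) := by
  rw [residues, dif_pos j.2]

section criterion

variable {b m : ℕ} [Fact b.Prime] {P : (ZMod b)[X]} {F : Type} [Field F] [Fintype F]
  [DecidableEq F] {π : (ZMod b)[X] →+* F} (h : IsResidueMap P m π)

/-- The Fourier transform of `classSum`. -/
noncomputable def kernelFourier (m α : ℕ) (π : (ZMod b)[X] →+* F) (x : F) : ℝ :=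
  fieldFourier (classSum m (((b : ℝ)⁻¹) ^ α) π) x

/-- The factors `ω (n q_j)` as constant polynomials. -/
noncomputable def kernelValues (m α : ℕ) (π : (ZMod b)[X] →+* F) {D : ℕ}
    (q : Fin D → (ZMod b)[X]) (n : F) (j : ℕ) : ℝ[X] :=
  Polynomial.C (kernelFourier m α π (n * residues π q j))

include h

/-- For fixed `n` the summand of `v` is a product over the elements of `v` times a product over its
blocks, as in `blockSum`; the `- 1` removes the empty set. -/
theorem searchCriterion_eq_blockSum {α : ℕ} (hα : 2 ≤ α) (β : ℕ → ℝ) {D : ℕ}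
    (q : Fin D → (ZMod b)[X]) {d : ℕ} (hd : d ≤ D) :
    searchCriterion m α P β q d = (Fintype.card F : ℝ)⁻¹ * ∑ n : F,
      coeffFunctional (fun k => (k.factorial : ℝ))
        (blockSum α (weightPoly b α β) (kernelValues m α π q n) d - 1) := by
  rw [searchCriterion_eq h hα]
  simp only [crossSum_eq _ (classSum_neg h (show (0 : ℝ) ≤ ((b : ℝ)⁻¹) ^ α by positivity)
    (mul_inv_pow_lt_one (Fact.out : b.Prime).one_lt hα))]
  simp only [← sum_blocks_eq α _ _ hd, map_sum]
  rw [Finset.sum_comm, Finset.mul_sum]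
  refine Finset.sum_congr rfl fun v _ => ?_
  rw [mul_left_comm, Finset.mul_sum]
  congr 1
  refine Finset.sum_congr rfl fun n _ => ?_
  simp only [kernelValues, residues_val]
  rw [← map_prod, mul_comm _ (Polynomial.C _), coeffFunctional_C_mul, ← Finset.prod_coe_sort v,
    cbcWeight_eq, mul_comm]
  rfl

theorem searchCriterion_succ {α : ℕ} (hα : 2 ≤ α) (β : ℕ → ℝ) {D : ℕ}
    (q : Fin D → (ZMod b)[X]) (d : Fin D) :
    searchCriterion m α P β q (d + 1) = searchCriterion m α P β q d
      + (Fintype.card F : ℝ)⁻¹ * ∑ n : F, kernelFourier m α π (n * π (q d)) *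
        coeffFunctional (fun k => (k.factorial : ℝ))
          (blockCoeff α (weightPoly b α β) (kernelValues m α π q n) d) := by
  rw [searchCriterion_eq_blockSum h hα β q d.2, searchCriterion_eq_blockSum h hα β q d.2.le,
    ← mul_add, ← Finset.sum_add_distrib]
  congr 1
  refine Finset.sum_congr rfl fun n _ => ?_
  rw [blockSum_succ, add_sub_right_comm, map_add, ← coeffFunctional_C_mul, kernelValues,
    residues_val]

theorem searchCriterion_congr {α : ℕ} (hα : 2 ≤ α) (β : ℕ → ℝ) {D : ℕ}
    {q q' : Fin D → (ZMod b)[X]} {d : ℕ} (hd : d ≤ D) (hq : ∀ j : Fin D, (j : ℕ) < d → q j = q' j) :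
    searchCriterion m α P β q d = searchCriterion m α P β q' d := by
  have hv : ∀ n : F, blockSum α (weightPoly b α β) (kernelValues m α π q n) d
      = blockSum α (weightPoly b α β) (kernelValues m α π q' n) d := fun n =>
    blockSum_congr α _ _ fun j hj => by
      rw [kernelValues, kernelValues, residues, residues, dif_pos (hj.trans_le hd),
        dif_pos (hj.trans_le hd), hq _ hj]
  rw [searchCriterion_eq_blockSum h hα β q hd, searchCriterion_eq_blockSum h hα β q' hd]
  simp only [hv]

omit h in
theorem blockCoeff_update (α : ℕ) (β : ℕ → ℝ) {D : ℕ} (q : Fin D → (ZMod b)[X]) (d : Fin D)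
    (g : (ZMod b)[X]) (n : F) :
    blockCoeff α (weightPoly b α β) (kernelValues m α π (Function.update q d g) n) d
      = blockCoeff α (weightPoly b α β) (kernelValues m α π q n) d := by
  refine blockCoeff_congr α _ _ fun j hj => ?_
  have hjD := hj.trans d.2
  rw [kernelValues, kernelValues, residues, residues, dif_pos hjD, dif_pos hjD,
    Function.update_of_ne (fun he => by rw [← he] at hj; exact lt_irrefl _ hj)]

/-- Minimality of a component, in terms of the sums that the algorithm computes. -/
theorem searchCriterion_le_iff {α : ℕ} (hα : 2 ≤ α) (β : ℕ → ℝ) {D : ℕ}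
    (q : Fin D → (ZMod b)[X]) (d : Fin D) (g g' : (ZMod b)[X]) :
    searchCriterion m α P β (Function.update q d g) (d + 1)
        ≤ searchCriterion m α P β (Function.update q d g') (d + 1) ↔
      ∑ n ∈ Finset.univ.erase (0 : F), kernelFourier m α π (n * π g) *
        coeffFunctional (fun k => (k.factorial : ℝ))
          (blockCoeff α (weightPoly b α β) (kernelValues m α π q n) d) ≤
      ∑ n ∈ Finset.univ.erase (0 : F), kernelFourier m α π (n * π g') *
        coeffFunctional (fun k => (k.factorial : ℝ))
          (blockCoeff α (weightPoly b α β) (kernelValues m α π q n) d) := by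
  have hN : (0 : ℝ) < (Fintype.card F : ℝ)⁻¹ := inv_pos.2 (Nat.cast_pos.2 Fintype.card_pos)
  rw [searchCriterion_succ h hα, searchCriterion_succ h hα]
  simp only [blockCoeff_update, Function.update_self]
  have hc : ∀ g, searchCriterion m α P β (Function.update q d g) d = searchCriterion m α P β q d :=
    fun g => searchCriterion_congr h hα β d.2.le fun j hj =>
      Function.update_of_ne (fun he => by rw [he] at hj; exact lt_irrefl _ hj) _ _
  -- The term `n = 0` is the same for both candidates. Without it the sum runs over the cyclic group
  -- of nonzero residues.
  rw [hc, hc, add_le_add_iff_left, mul_le_mul_iff_right₀ hN,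
    ← Finset.add_sum_erase _ _ (Finset.mem_univ (0 : F)),
    ← Finset.add_sum_erase _ _ (Finset.mem_univ (0 : F))]
  simp

end criterion


/-! ### The fast component-by-component algorithm -/

/-- With `n = ζ ^ i` and the candidate `ζ ^ j`, the kernel depends on `i + j` only, which is the
Hankel structure. -/
theorem exists_generator (F : Type) [Field F] [Fintype F] [DecidableEq F] :
    ∃ ζ : F, ζ ≠ 0 ∧ (∀ x : F, x ≠ 0 → ∃ i < Fintype.card F - 1, ζ ^ i = x) ∧
      ∀ f : F → ℝ, ∑ n ∈ Finset.univ.erase 0, f n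
        = ∑ i ∈ Finset.range (Fintype.card F - 1), f (ζ ^ i) := by
  obtain ⟨g, hg⟩ := IsCyclic.exists_generator (α := Fˣ)
  have ho : orderOf g = Fintype.card F - 1 := by
    rw [orderOf_eq_card_of_forall_mem_zpowers hg, Nat.card_eq_fintype_card, Fintype.card_units]
  have hex : ∀ x : F, x ≠ 0 → ∃ i < Fintype.card F - 1, (g : F) ^ i = x := by
    intro x hx
    have hm : Units.mk0 x hx ∈ Submonoid.powers g :=
      mem_powers_iff_mem_zpowers.2 (hg (Units.mk0 x hx))
    obtain ⟨i, hi⟩ := hm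
    refine ⟨i % orderOf g, ho ▸ Nat.mod_lt _ (orderOf_pos g), ?_⟩
    have : g ^ (i % orderOf g) = Units.mk0 x hx := by rw [pow_mod_orderOf]; exact hi
    have := congrArg Units.val this
    rwa [Units.val_pow_eq_pow_val] at this
  refine ⟨g, g.ne_zero, hex, fun f => ?_⟩
  symm
  refine Finset.sum_bij (fun i _ => (g : F) ^ i) (fun i _ => ?_) (fun i hi j hj hij => ?_)
    (fun x hx => ?_) fun _ _ => rfl
  · simp
  · rw [Finset.mem_range, ← ho] at hi hj
    refine pow_injOn_Iio_orderOf hi hj (Units.ext ?_)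
    simpa using hij
  · obtain ⟨i, hi, rfl⟩ := hex x (Finset.ne_of_mem_erase hx)
    exact ⟨i, Finset.mem_range.2 hi, rfl⟩

/-- The first `e` components of `q` minimize the search criterion. -/
def IsCBCUpTo {b : ℕ} (m α : ℕ) (P : (ZMod b)[X]) (β : ℕ → ℝ) {D : ℕ}
    (q : Fin D → (ZMod b)[X]) (e : ℕ) : Prop :=
  ∀ d : Fin D, (d : ℕ) < e → ∀ g ∈ genSet b m,
    searchCriterion m α P β q (d + 1) ≤ searchCriterion m α P β (Function.update q d g) (d + 1)

theorem Computes.pow {X : Type} {S : Set (X → ℝ)} {f : X → ℝ} (hf : f ∈ S) (n : ℕ) :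
    Computes S {fun x => f x ^ n} (n + 1) := by
  induction n with
  | zero => simpa using Computes.const 1
  | succ n ih => simpa only [pow_succ] using ih.mul' (.mem hf)

section algorithm

variable {b m : ℕ} [Fact b.Prime] {P : (ZMod b)[X]} {F : Type} [Field F] [Fintype F]
  [DecidableEq F] {π : (ZMod b)[X] →+* F} (h : IsResidueMap P m π)

/-- The coefficients of the block sums at the powers of `ζ`. -/
noncomputable def stateCoeff (m α : ℕ) (π : (ZMod b)[X] →+* F) {D : ℕ}
    (q : Fin D → (ZMod b)[X]) (ζ : F) (d i k : ℕ) (β : ℕ → ℝ) : ℝ :=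
  (blockSum α (weightPoly b α β) (kernelValues m α π q (ζ ^ i)) d).coeff k

/-- The numbers that are kept in memory before a block is processed. -/
def blockState (m α : ℕ) (π : (ZMod b)[X] →+* F) {s : ℕ}
    (q : Fin (s * α) → (ZMod b)[X]) (ζ : F) (J : ℕ) : Set ((ℕ → ℝ) → ℝ) :=
  {f | ∃ j < s, f = fun β => β j} ∪ {f | ∃ i < Fintype.card F - 1, ∃ k < s * α + 1,
    f = stateCoeff m α π q ζ (J * α) i k}

/-- The product of the weight polynomial of a block and the block sum. -/
noncomputable def stepPoly (m α : ℕ) (π : (ZMod b)[X] →+* F) {D : ℕ}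
    (q : Fin D → (ZMod b)[X]) (ζ : F) (J i : ℕ) (β : ℕ → ℝ) : ℝ[X] :=
  weightPoly b α β J * blockSum α (weightPoly b α β) (kernelValues m α π q (ζ ^ i)) (J * α)

/-- The product of the factors `1 + ω (n q_j)` within a block. -/
noncomputable def prefixProd (m α : ℕ) (π : (ZMod b)[X] →+* F) {D : ℕ}
    (q : Fin D → (ZMod b)[X]) (n : F) (J r : ℕ) : ℝ :=
  ∏ k ∈ Finset.range r, (1 + kernelFourier m α π (n * residues π q (J * α + k)))

theorem prod_kernelValues (m α : ℕ) (π : (ZMod b)[X] →+* F) {D : ℕ}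
    (q : Fin D → (ZMod b)[X]) (n : F) (J r : ℕ) :
    ∏ k ∈ Finset.range r, (1 + kernelValues m α π q n (J * α + k))
      = Polynomial.C (prefixProd m α π q n J r) := by
  simp [prefixProd, kernelValues, map_prod]

theorem natDegree_blockSum_le (b m α : ℕ) [Fact b.Prime] (π : (ZMod b)[X] →+* F) {D : ℕ}
    (q : Fin D → (ZMod b)[X]) (n : F) (J : ℕ) (β : ℕ → ℝ) :
    (blockSum α (weightPoly b α β) (kernelValues m α π q n) (J * α)).natDegree ≤ J * α := by
  induction J with
  | zero => simp [blockSum_zero]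
  | succ J ih =>
    rw [blockSum_succ_mul, prod_kernelValues, ← Polynomial.C_1, ← Polynomial.C_sub]
    refine (Polynomial.natDegree_add_le _ _).trans (max_le (ih.trans (by rw [Nat.succ_mul]; omega)) ?_)
    refine (Polynomial.natDegree_C_mul_le _ _).trans (Polynomial.natDegree_mul_le.trans ?_)
    have := natDegree_rowPoly_le α (rowWeight (blockConst b α) α (β J))
    rw [weightPoly, Nat.succ_mul]
    omega

theorem computes_rowWeight (α : ℕ) (B : ℝ) {S : Set ((ℕ → ℝ) → ℝ)} (J : ℕ)
    (hJ : (fun β : ℕ → ℝ => β J) ∈ S) :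
    Computes S {f | ∃ ν < α, f ∈ ({fun β => rowWeight B α (β J) (ν + 1)} : Set ((ℕ → ℝ) → ℝ))}
      (α * (α + 3)) := by
  refine Computes.family fun ν hν => ?_
  have h1 := (Computes.const (S := S) (B * if ν + 1 = α then 2 else 1)).mul' (.pow hJ (ν + 1))
  refine h1.mono le_rfl ?_ (by omega)
  simp only [rowWeight, mul_assoc]
  exact le_rfl

/-- Each of the `s * α + 1` coefficients is a convolution with only `α` terms, because a weight
polynomial has degree at most `α`. -/
theorem computes_stepPoly (α s : ℕ) (q : Fin (s * α) → (ZMod b)[X]) (ζ : F) {J : ℕ} (hJ : J < s) :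
    Computes (blockState m α π q ζ J)
      {f | ∃ i < Fintype.card F - 1, f ∈ {f : (ℕ → ℝ) → ℝ | ∃ k < s * α + 1, f ∈
        ({fun β => (stepPoly m α π q ζ J i β).coeff k} : Set ((ℕ → ℝ) → ℝ))}}
      (α * (α + 3) + (Fintype.card F - 1) * ((s * α + 1) * (2 * α + 1))) := by
  refine (computes_rowWeight α (blockConst b α) J (Or.inl ⟨J, hJ, rfl⟩)).trans_right ?_
  refine Computes.family fun i hi => Computes.family fun k hk => ?_
  simp only [stepPoly, weightPoly, coeff_rowPoly_mul]
  rw [show 2 * α + 1 = α * (1 + 1) + 1 by ring]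
  refine Computes.sum fun ν hν => ?_
  by_cases hk' : ν + 1 ≤ k
  · simp only [if_pos hk']
    exact .mul (Or.inr ⟨ν, hν, rfl⟩) (Or.inl (Or.inr ⟨i, hi, k - (ν + 1), by omega, rfl⟩))
  · simp only [if_neg hk']
    exact .const 0

theorem computes_stepValue (α s : ℕ) (q : Fin (s * α) → (ZMod b)[X]) (ζ : F) {J : ℕ} (hJ : J < s) :
    Computes {f | ∃ i < Fintype.card F - 1, f ∈ {f : (ℕ → ℝ) → ℝ | ∃ k < s * α + 1, f ∈
        ({fun β => (stepPoly m α π q ζ J i β).coeff k} : Set ((ℕ → ℝ) → ℝ))}}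
      {f | ∃ i < Fintype.card F - 1, f ∈ ({fun β => coeffFunctional (fun k => (k.factorial : ℝ))
        (stepPoly m α π q ζ J i β)} : Set ((ℕ → ℝ) → ℝ))}
      ((Fintype.card F - 1) * ((s * α + 1) * (2 + 1) + 1)) := by
  refine Computes.family fun i hi => ?_
  have hd : ∀ β, (stepPoly m α π q ζ J i β).natDegree < s * α + 1 := fun β => by
    refine Nat.lt_succ_of_le (Polynomial.natDegree_mul_le.trans ?_)
    have h1 := natDegree_blockSum_le b m α π q (ζ ^ i) J β
    have h2 := natDegree_rowPoly_le α (rowWeight (blockConst b α) α (β J))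
    have h3 : (J + 1) * α ≤ s * α := Nat.mul_le_mul_right _ hJ
    rw [Nat.succ_mul] at h3
    rw [weightPoly]
    omega
  have : (fun β => coeffFunctional (fun k => (k.factorial : ℝ)) (stepPoly m α π q ζ J i β))
      = fun β => ∑ k ∈ Finset.range (s * α + 1),
        (k.factorial : ℝ) * (stepPoly m α π q ζ J i β).coeff k :=
    funext fun β => coeffFunctional_eq_sum _ _ (hd β)
  rw [this]
  refine Computes.sum fun k hk => .const_mul (f := fun β => (stepPoly m α π q ζ J i β).coeff k) ?_ _
  exact ⟨i, hi, k, hk, rfl⟩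

/-- Along a branch of the tree the components of `q` are known, so `prefixProd` is a constant that
can be loaded; only the dependence on `β` has to be computed. -/
theorem computes_blockState_succ (α s : ℕ) (q : Fin (s * α) → (ZMod b)[X]) (ζ : F) {J : ℕ} :
    Computes (blockState m α π q ζ J ∪
        {f | ∃ i < Fintype.card F - 1, f ∈ {f : (ℕ → ℝ) → ℝ | ∃ k < s * α + 1, f ∈
          ({fun β => (stepPoly m α π q ζ J i β).coeff k} : Set ((ℕ → ℝ) → ℝ))}})
      (blockState m α π q ζ (J + 1))
      ((Fintype.card F - 1) * ((s * α + 1) * 3)) := by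
  have h1 : Computes (blockState m α π q ζ J ∪
        {f | ∃ i < Fintype.card F - 1, f ∈ {f : (ℕ → ℝ) → ℝ | ∃ k < s * α + 1, f ∈
          ({fun β => (stepPoly m α π q ζ J i β).coeff k} : Set ((ℕ → ℝ) → ℝ))}})
      {f | ∃ i < Fintype.card F - 1, f ∈ {f : (ℕ → ℝ) → ℝ | ∃ k < s * α + 1, f ∈
          ({stateCoeff m α π q ζ ((J + 1) * α) i k} : Set ((ℕ → ℝ) → ℝ))}}
      ((Fintype.card F - 1) * ((s * α + 1) * 3)) := by
    refine Computes.family fun i hi => Computes.family fun k hk => ?_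
    have he : stateCoeff m α π q ζ ((J + 1) * α) i k = fun β => stateCoeff m α π q ζ (J * α) i k β
        + (prefixProd m α π q (ζ ^ i) J α - 1) * (stepPoly m α π q ζ J i β).coeff k := by
      funext β
      rw [stateCoeff, stateCoeff, blockSum_succ_mul, prod_kernelValues, ← Polynomial.C_1,
        ← Polynomial.C_sub, Polynomial.coeff_add, Polynomial.coeff_C_mul, stepPoly]
    rw [he]
    exact (Computes.mem (Or.inl (Or.inr ⟨i, hi, k, hk, rfl⟩))).add'
      (.const_mul (f := fun β => (stepPoly m α π q ζ J i β).coeff k)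
        (Or.inr ⟨i, hi, k, hk, rfl⟩) _)
  refine ((Computes.of_subset (k := 0) (T := {f | ∃ j < s, f = fun β : ℕ → ℝ => β j})
    fun f hf => Or.inl (Or.inl hf)).union h1).mono le_rfl ?_ (by omega)
  rintro f (hf | ⟨i, hi, k, hk, rfl⟩)
  exacts [Or.inl hf, Or.inr ⟨i, hi, k, hk, rfl⟩]

/-- The cost of the selection of one component. -/
def componentCost (n : ℕ) : ℕ := n * 2 + 160 * (n * (Nat.clog 2 n + 1)) + n

/-- The cost of one block besides the selection of its components. -/
def overheadCost (α s n : ℕ) : ℕ :=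
  α * (α + 3) + n * ((s * α + 1) * (2 * α + 1)) + n * ((s * α + 1) * (2 + 1) + 1)
    + n * ((s * α + 1) * 3)

/-- The sums that are compared in the selection of a component. -/
noncomputable def candidateSum (m α : ℕ) (π : (ZMod b)[X] →+* F) {D : ℕ}
    (q : Fin D → (ZMod b)[X]) (ζ : F) (J r j : ℕ) (β : ℕ → ℝ) : ℝ :=
  ∑ i ∈ Finset.range (Fintype.card F - 1), kernelFourier m α π (ζ ^ (j + i)) *
    (prefixProd m α π q (ζ ^ i) J r *
      coeffFunctional (fun k => (k.factorial : ℝ)) (stepPoly m α π q ζ J i β))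

/-- Two operations per entry scale the vector by the constants `prefixProd`; a single Hankel product
then serves all candidates. -/
theorem computes_candidateSum (α : ℕ) {D : ℕ} (q : Fin D → (ZMod b)[X]) (ζ : F) (J r : ℕ) :
    Computes
      {f | ∃ i < Fintype.card F - 1, f ∈ ({fun β => coeffFunctional (fun k => (k.factorial : ℝ))
        (stepPoly m α π q ζ J i β)} : Set ((ℕ → ℝ) → ℝ))}
      {f | ∃ j < Fintype.card F - 1, f = candidateSum m α π q ζ J r j}
      ((Fintype.card F - 1) * 2
        + 160 * ((Fintype.card F - 1) * (Nat.clog 2 (Fintype.card F - 1) + 1))) := by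
  refine Computes.trans_right (T := {f | ∃ i < Fintype.card F - 1,
    f ∈ ({fun β => prefixProd m α π q (ζ ^ i) J r * coeffFunctional (fun k => (k.factorial : ℝ))
        (stepPoly m α π q ζ J i β)} : Set ((ℕ → ℝ) → ℝ))})
    (Computes.family fun i hi => .const_mul (by exact ⟨i, hi, rfl⟩) _) ?_
  exact (computes_hankel (Fintype.card F - 1) (fun k => kernelFourier m α π (ζ ^ k)) _).mono
    Set.subset_union_right le_rfl le_rfl

theorem candidateSum_eq {α : ℕ} {D : ℕ} (q : Fin D → (ZMod b)[X]) {ζ : F}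
    (hζ : ∀ f : F → ℝ, ∑ n ∈ Finset.univ.erase 0, f n
      = ∑ i ∈ Finset.range (Fintype.card F - 1), f (ζ ^ i)) {J r : ℕ} (hr : r < α) (β : ℕ → ℝ)
    (j : ℕ) :
    ∑ n ∈ Finset.univ.erase (0 : F), kernelFourier m α π (n * ζ ^ j) *
        coeffFunctional (fun k => (k.factorial : ℝ))
          (blockCoeff α (weightPoly b α β) (kernelValues m α π q n) (J * α + r))
      = candidateSum m α π q ζ J r j β := by
  rw [hζ, candidateSum]
  refine Finset.sum_congr rfl fun i _ => ?_
  rw [blockCoeff_mul_add α _ _ J hr, prod_kernelValues, mul_comm _ (Polynomial.C _),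
    coeffFunctional_C_mul, ← pow_add, add_comm i j, stepPoly]

include h

/-- The choice of a minimizing candidate preserves minimality of the preceding components. -/
theorem IsCBCUpTo.update {α : ℕ} (hα : 2 ≤ α) {β : ℕ → ℝ} {D : ℕ} {q : Fin D → (ZMod b)[X]}
    {d : Fin D} (hq : IsCBCUpTo m α P β q d) {g : (ZMod b)[X]}
    (hg : ∀ g' ∈ genSet b m, searchCriterion m α P β (Function.update q d g) (d + 1)
      ≤ searchCriterion m α P β (Function.update q d g') (d + 1)) :
    IsCBCUpTo m α P β (Function.update q d g) (d + 1) := by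
  intro e he g' hg'
  rcases Nat.lt_succ_iff_lt_or_eq.1 he with he | he
  · have hne : ∀ j : Fin D, (j : ℕ) < e + 1 → j ≠ d := fun j hj hjd => by rw [hjd] at hj; omega
    have e1 : searchCriterion m α P β (Function.update q d g) (e + 1)
        = searchCriterion m α P β q (e + 1) :=
      searchCriterion_congr h hα β e.2 fun j hj => Function.update_of_ne (hne j hj) _ _
    have e2 : searchCriterion m α P β (Function.update (Function.update q d g) e g') (e + 1)
        = searchCriterion m α P β (Function.update q e g') (e + 1) := by
      refine searchCriterion_congr h hα β e.2 fun j hj => ?_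
      by_cases hje : j = e
      · rw [hje, Function.update_self, Function.update_self]
      · rw [Function.update_of_ne hje, Function.update_of_ne hje, Function.update_of_ne (hne j hj)]
    rw [e1, e2]
    exact hq e he g' hg'
  · obtain rfl : e = d := Fin.ext he
    rw [Function.update_idem]
    exact hg g' hg'

/-- The search criterion for the first component is constant. -/
theorem isCBCUpTo_one {α : ℕ} (hα : 2 ≤ α) (β : ℕ → ℝ) {D : ℕ} {q : Fin D → (ZMod b)[X]}
    (hq : ∀ d, q d ∈ genSet b m) : IsCBCUpTo m α P β q 1 := by
  intro d hd g hg
  have hd0 : (d : ℕ) = 0 := by omega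
  refine le_of_eq ?_
  have hE : searchCriterion m α P β (Function.update q d g) d = searchCriterion m α P β q d :=
    searchCriterion_congr h hα β d.2.le fun j hj => by omega
  rw [searchCriterion_succ h hα, searchCriterion_succ h hα, hE]
  congr 2
  have hc : ∀ (q : Fin D → (ZMod b)[X]) (n : F), blockCoeff α (weightPoly b α β)
      (kernelValues m α π q n) d = weightPoly b α β 0 := fun q n => by
    simp [blockCoeff, hd0]
  simp only [hc, ← Finset.sum_mul]
  rw [Function.update_self]
  congr 1
  -- Multiplication by a nonzero residue permutes `F`, so the sum over `n` does not depend on the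
  -- candidate.
  exact (Equiv.sum_comp (Equiv.mulRight₀ _ (h.map_genSet_ne_zero (hq d)))
    (kernelFourier m α π)).trans (Equiv.sum_comp (Equiv.mulRight₀ _ (h.map_genSet_ne_zero hg))
    (kernelFourier m α π)).symm

omit h in
theorem blockSum_update (α : ℕ) (β : ℕ → ℝ) {D : ℕ} (q : Fin D → (ZMod b)[X]) {d : Fin D}
    (g : (ZMod b)[X]) (n : F) {e : ℕ} (he : e ≤ d) :
    blockSum α (weightPoly b α β) (kernelValues m α π (Function.update q d g) n) e
      = blockSum α (weightPoly b α β) (kernelValues m α π q n) e := by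
  refine blockSum_congr α _ _ fun j hj => ?_
  have hjD := (hj.trans_le he).trans d.2
  rw [kernelValues, kernelValues, residues, residues, dif_pos hjD, dif_pos hjD,
    Function.update_of_ne (fun h => by rw [← h] at he; exact absurd hj (not_lt.2 he))]

omit h in
theorem stepPoly_update (α : ℕ) {D : ℕ} (q : Fin D → (ZMod b)[X]) {d : Fin D}
    (g : (ZMod b)[X]) (ζ : F) {J : ℕ} (hJ : J * α ≤ d) :
    stepPoly m α π (Function.update q d g) ζ J = stepPoly m α π q ζ J := by
  ext i β : 2
  rw [stepPoly, blockSum_update α β q g _ hJ, stepPoly]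

omit h in
theorem blockState_update (α : ℕ) {s : ℕ} (q : Fin (s * α) → (ZMod b)[X]) {d : Fin (s * α)}
    (g : (ZMod b)[X]) (ζ : F) {J : ℕ} (hJ : J * α ≤ d) :
    blockState m α π (Function.update q d g) ζ J = blockState m α π q ζ J := by
  have : stateCoeff m α π (Function.update q d g) ζ (J * α) = stateCoeff m α π q ζ (J * α) := by
    ext i k β
    rw [stateCoeff, blockSum_update α β q g _ hJ, stateCoeff]
  rw [blockState, this, blockState]

/-- Induction on the number `k` of components of block `J` still to be chosen; `hnext` is the
computation for the later blocks. The stored `stepPoly` data involve only components before the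
block, so they stay valid whichever candidates are selected. -/
theorem solvable_within_block {α s : ℕ}
    {Good : (ℕ → ℝ) → (Fin (s * α) → (ZMod b)[X]) → Prop} (hα : 2 ≤ α) {J : ℕ} (hJ : J < s) {ζ : F} (hζ0 : ζ ≠ 0)
    (hζ : ∀ x : F, x ≠ 0 → ∃ i < Fintype.card F - 1, ζ ^ i = x)
    (hsum : ∀ f : F → ℝ, ∑ n ∈ Finset.univ.erase 0, f n
      = ∑ i ∈ Finset.range (Fintype.card F - 1), f (ζ ^ i)) (c : ℕ)
    (hnext : ∀ q : Fin (s * α) → (ZMod b)[X], (∀ d, q d ∈ genSet b m) →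
      (∀ d : Fin (s * α), (d : ℕ) = 0 → q d = 1) →
      Solvable Good (blockState m α π q ζ (J + 1))
        {β | IsCBCUpTo m α P β q ((J + 1) * α)} c) (k : ℕ) :
    ∀ (r : ℕ), r + k = α → ∀ (q : Fin (s * α) → (ZMod b)[X]), (∀ d, q d ∈ genSet b m) →
      (∀ d : Fin (s * α), (d : ℕ) = 0 → q d = 1) → ∀ S : Set ((ℕ → ℝ) → ℝ),
      blockState m α π q ζ J ⊆ S →
      {f | ∃ i < Fintype.card F - 1, f ∈ {f : (ℕ → ℝ) → ℝ | ∃ k < s * α + 1, f ∈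
        ({fun β => (stepPoly m α π q ζ J i β).coeff k} : Set ((ℕ → ℝ) → ℝ))}} ⊆ S →
      {f | ∃ i < Fintype.card F - 1, f ∈ ({fun β => coeffFunctional (fun k => (k.factorial : ℝ))
        (stepPoly m α π q ζ J i β)} : Set ((ℕ → ℝ) → ℝ))} ⊆ S →
      Solvable Good S {β | IsCBCUpTo m α P β q (J * α + r)}
        ((Fintype.card F - 1) * ((s * α + 1) * 3) + c
          + k * componentCost (Fintype.card F - 1)) := by
  induction k with
  | zero =>
    intro r hr q hq hq1 S hS1 hS2 hS3
    rw [zero_mul, add_zero]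
    rw [add_zero] at hr
    refine computes_blockState_succ _ s q ζ _ _ _ _ _ (Set.union_subset hS1 hS2) ?_
    refine (hnext q hq hq1).mono Set.subset_union_right (fun β hβ => ?_) le_rfl
    have hβ : IsCBCUpTo m α P β q (J * α + r) := hβ
    have he : J * α + r = (J + 1) * α := by rw [hr, Nat.succ_mul]
    rw [he] at hβ
    exact hβ
  | succ k ih =>
    intro r hr q hq hq1 S hS1 hS2 hS3
    have hrα : r < α := by omega
    have hdlt : J * α + r < s * α := by
      have : (J + 1) * α ≤ s * α := Nat.mul_le_mul_right _ hJ
      rw [Nat.succ_mul] at this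
      omega
    set d : Fin (s * α) := ⟨J * α + r, hdlt⟩ with hd
    -- The very first component keeps its value 1 and needs no search, by `isCBCUpTo_one`.
    rcases Nat.eq_zero_or_pos (J * α + r) with h0 | hpos
    · refine (ih (r + 1) (by omega) q hq hq1 S hS1 hS2 hS3).mono le_rfl (fun β _ => ?_) ?_
      · have := isCBCUpTo_one h hα β hq
        change IsCBCUpTo m α P β q (J * α + (r + 1))
        rwa [← add_assoc, h0]
      · exact Nat.add_le_add_left (Nat.mul_le_mul_right _ (Nat.le_succ k)) _
    · have hn : 0 < Fintype.card F - 1 := by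
        have := Fintype.one_lt_card (α := F); omega
      have hcand : ∀ j, ∃ g ∈ genSet b m, π g = ζ ^ j := fun j =>
        h.exists_mem_genSet (pow_ne_zero j hζ0)
      choose g hg hgζ using hcand
      have hcost : (Fintype.card F - 1) * ((s * α + 1) * 3) + c
          + (k + 1) * componentCost (Fintype.card F - 1)
          = ((Fintype.card F - 1) * 2
            + 160 * ((Fintype.card F - 1) * (Nat.clog 2 (Fintype.card F - 1) + 1)))
            + ((Fintype.card F - 1) * ((s * α + 1) * 3) + c
              + k * componentCost (Fintype.card F - 1) + (Fintype.card F - 1)) := by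
        rw [Nat.succ_mul, componentCost]
        ring
      rw [hcost]
      refine computes_candidateSum α q ζ J r _ _ _ _ _ hS3 ?_
      refine Solvable.argmin hn (candidateSum m α π q ζ J r) (fun j hj => Or.inr ⟨j, hj, rfl⟩)
        fun j hj => ?_
      have hJd : J * α ≤ d := Nat.le_add_right _ _
      refine (ih (r + 1) (by omega) (Function.update q d (g j)) (fun e => ?_) (fun e he => ?_) S
        ?_ ?_ ?_).mono Set.subset_union_left ?_ le_rfl
      · rcases eq_or_ne e d with rfl | hne
        · rw [Function.update_self]; exact hg j
        · rw [Function.update_of_ne hne]; exact hq e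
      · have hed : e ≠ d := fun hed => hpos.ne' ((congrArg Fin.val hed).symm.trans he)
        rw [Function.update_of_ne hed]
        exact hq1 e he
      · rwa [blockState_update α q _ ζ hJd]
      · rwa [stepPoly_update α q _ ζ hJd]
      · rwa [stepPoly_update α q _ ζ hJd]
      · rintro β ⟨hβ, hmin⟩
        refine IsCBCUpTo.update h hα (d := d) hβ fun g' hg' => ?_
        obtain ⟨j', hj', hgj'⟩ := hζ (π g') (h.map_genSet_ne_zero hg')
        rw [searchCriterion_le_iff h hα, hgζ j, ← hgj', candidateSum_eq q hsum hrα,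
          candidateSum_eq q hsum hrα]
        exact hmin j' hj'

/-- The cost of the algorithm. -/
def totalCost (α s n : ℕ) : ℕ :=
  n * ((s * α + 1) * 1) + s * (overheadCost α s n + α * componentCost n)

/-- Induction on the number `k` of remaining blocks, for every `q` at once, since each branch of the
tree arrives with its own components. -/
theorem solvable_from_block {α s : ℕ} (hα : 2 ≤ α) {ζ : F} (hζ0 : ζ ≠ 0)
    (hζ : ∀ x : F, x ≠ 0 → ∃ i < Fintype.card F - 1, ζ ^ i = x)
    (hsum : ∀ f : F → ℝ, ∑ n ∈ Finset.univ.erase 0, f n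
      = ∑ i ∈ Finset.range (Fintype.card F - 1), f (ζ ^ i)) (k : ℕ) :
    ∀ J, J + k = s → ∀ q : Fin (s * α) → (ZMod b)[X], (∀ d, q d ∈ genSet b m) →
      (∀ d : Fin (s * α), (d : ℕ) = 0 → q d = 1) →
      Solvable (fun β (q : Fin (s * α) → (ZMod b)[X]) => IsCBCVector m α P β q)
        (blockState m α π q ζ J) {β | IsCBCUpTo m α P β q (J * α)}
        (k * (overheadCost α s (Fintype.card F - 1)
          + α * componentCost (Fintype.card F - 1))) := by
  induction k with
  | zero =>
    intro J hJ q hq hq1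
    rw [add_zero] at hJ
    subst hJ
    exact .ret q fun β hβ => ⟨hq, hq1, fun d g hg => hβ d d.2 g hg⟩
  | succ k ih =>
    intro J hJ q hq hq1
    have hJs : J < s := by omega
    have h1 := computes_stepPoly (m := m) (π := π) α s q ζ hJs
    have h2 := computes_stepValue (m := m) (π := π) α s q ζ hJs
    have h3 := solvable_within_block h hα hJs hζ0 hζ hsum _
      (fun q hq hq1 => ih (J + 1) (by omega) q hq hq1) α 0 (zero_add α) q hq hq1 _
      (Set.subset_union_left.trans Set.subset_union_left)
      (Set.subset_union_right.trans Set.subset_union_left) Set.subset_union_right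
    have h4 := h1 _ _ _ _ _ le_rfl (h2 _ _ _ _ _ Set.subset_union_right h3)
    refine h4.mono le_rfl le_rfl (le_of_eq ?_)
    rw [overheadCost]
    ring

theorem solvable_cbc {α : ℕ} (hα : 2 ≤ α) (s : ℕ) :
    Solvable (fun β (q : Fin (s * α) → (ZMod b)[X]) => IsCBCVector m α P β q)
      {f | ∃ j < s, f = fun β : ℕ → ℝ => β j} Set.univ (totalCost α s (Fintype.card F - 1)) := by
  obtain ⟨ζ, hζ0, hζ, hsum⟩ := exists_generator F
  obtain ⟨g, hg, -⟩ := h.exists_mem_genSet (one_ne_zero (α := F))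
  have hm : 0 < m := by
    rcases Nat.eq_zero_or_pos m with rfl | hm
    · exact absurd (Polynomial.degree_lt_iff_coeff_zero g 0 |>.1 hg.2) fun h0 =>
        hg.1 (by ext k; simpa using h0 k (Nat.zero_le k))
    · exact hm
  have hone : (1 : (ZMod b)[X]) ∈ genSet b m :=
    ⟨one_ne_zero, by rw [Polynomial.degree_one]; exact_mod_cast hm⟩
  have h1 := solvable_from_block h hα hζ0 hζ hsum s 0 (zero_add s) (fun _ => 1) (fun _ => hone)
    fun _ _ => rfl
  -- Before the first block every block sum is the polynomial 1, so the initial coefficients are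
  -- constants.
  have h2 : Computes {f | ∃ j < s, f = fun β : ℕ → ℝ => β j}
      {f | ∃ i < Fintype.card F - 1, f ∈ {f : (ℕ → ℝ) → ℝ | ∃ k < s * α + 1, f ∈
        ({stateCoeff m α π (fun _ : Fin (s * α) => 1) ζ (0 * α) i k} : Set ((ℕ → ℝ) → ℝ))}}
      ((Fintype.card F - 1) * ((s * α + 1) * 1)) := by
    refine Computes.family fun i _ => Computes.family fun k _ => ?_
    have : stateCoeff m α π (fun _ : Fin (s * α) => 1) ζ (0 * α) i k
        = fun _ => (1 : ℝ[X]).coeff k := by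
      ext β
      rw [stateCoeff, zero_mul, blockSum_zero]
    rw [this]
    exact .const _
  refine h2 _ _ _ _ _ le_rfl (h1.mono ?_ ?_ le_rfl)
  · rintro f (hf | ⟨i, hi, k, hk, rfl⟩)
    exacts [Or.inl hf, Or.inr ⟨i, hi, k, hk, rfl⟩]
  · intro β _ d hd
    omega

end algorithm

/-- The fast component-by-component algorithm as a computation tree. -/
theorem exists_cbc_compTree {b m : ℕ} [Fact b.Prime] {P : (ZMod b)[X]} {F : Type} [Field F]
    [Fintype F] [DecidableEq F] {π : (ZMod b)[X] →+* F} (h : IsResidueMap P m π) {α : ℕ}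
    (hα : 2 ≤ α) (s : ℕ) :
    ∃ t : CompTree (Fin (s * α) → (ZMod b)[X]), ∀ β : ℕ → ℝ,
      IsCBCVector m α P β (t.output (inputMemory s β)) ∧
        t.cost (inputMemory s β) ≤ totalCost α s (b ^ m - 1) := by
  obtain ⟨t, ht⟩ := (solvable_cbc h hα s).exists_compTree (inputMemory s) s (by
    rintro f ⟨j, hj, rfl⟩
    exact ⟨j, hj, fun β _ => by rw [inputMemory, if_pos hj]⟩)
  rw [h.card_eq] at ht
  exact ⟨t, fun β => ht β trivial⟩

theorem totalCost_le {b m α s : ℕ} (hb : 2 ≤ b) (hm : 1 ≤ m) (hα : 2 ≤ α) (hs : 1 ≤ s) :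
    (totalCost α s (b ^ m - 1) : ℝ) ≤ 1000 * (α * s * ((b : ℝ) ^ m) * Real.log ((b : ℝ) ^ m)
      + (α : ℝ) ^ 2 * (s : ℝ) ^ 2 * (b : ℝ) ^ m) := by
  have hN2 : 2 ≤ b ^ m := hb.trans (Nat.le_self_pow (by omega) b)
  have hcast : (b : ℝ) ^ m = ((b ^ m : ℕ) : ℝ) := by push_cast; rfl
  rw [hcast]
  generalize b ^ m = N at hN2
  clear hcast
  set n := N - 1 with hn
  set C := Nat.clog 2 n with hC
  -- A crude form of `C ≤ log₂ n + 1` that also covers `n = 1`; it gives `C ≤ 2 log N / log 2`.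
  have hpow : 2 ^ C ≤ N ^ 2 := by
    rcases Nat.lt_or_ge 1 n with h1 | h1
    · have h2 : 2 ^ (C - 1) < n := Nat.pow_pred_clog_lt_self one_lt_two h1
      have h3 : 0 < C := Nat.clog_pos one_lt_two h1
      have h4 : n ≤ N := Nat.sub_le N 1
      have h5 : N * 2 ≤ N ^ 2 := by rw [pow_two]; exact Nat.mul_le_mul_left N hN2
      rw [show C = C - 1 + 1 by omega, pow_succ]
      omega
    · have h0 : n = 1 := by omega
      have : C = 0 := by rw [hC, h0]; simp
      rw [this]
      nlinarith
  have hN : (2 : ℝ) ≤ N := by exact_mod_cast hN2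
  have hnN : (n : ℝ) ≤ N := by exact_mod_cast Nat.sub_le N 1
  have hn0 : (0 : ℝ) ≤ n := Nat.cast_nonneg n
  have hlog2 : (0.69 : ℝ) ≤ Real.log 2 := by have := Real.log_two_gt_d9; linarith
  have hlogN : Real.log 2 ≤ Real.log N := Real.log_le_log (by norm_num) hN
  have hClog : (C : ℝ) * 0.69 ≤ 2 * Real.log N := by
    have h1 : Real.log ((2 : ℝ) ^ C) ≤ Real.log ((N : ℝ) ^ 2) :=
      Real.log_le_log (by positivity) (by exact_mod_cast hpow)
    rw [Real.log_pow, Real.log_pow] at h1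
    push_cast at h1
    have h0 : (0 : ℝ) ≤ C := Nat.cast_nonneg C
    nlinarith
  have ha : (2 : ℝ) ≤ α := by exact_mod_cast hα
  have hs' : (1 : ℝ) ≤ s := by exact_mod_cast hs
  set x : ℝ := s * α with hx
  have hxa : (α : ℝ) ≤ x := by nlinarith
  have hover : (overheadCost α s n : ℝ) ≤ 10 * (N * x * α) := by
    have e : (overheadCost α s n : ℝ) = α * (α + 3) + n * ((x + 1) * (2 * α + 1))
        + n * ((x + 1) * (2 + 1) + 1) + n * ((x + 1) * 3) := by
      rw [overheadCost, hx]; push_cast; ring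
    have e2 : (overheadCost α s n : ℝ) ≤ α * (α + 3) + N * ((x + 1) * (2 * α + 1))
        + N * ((x + 1) * (2 + 1) + 1) + N * ((x + 1) * 3) := by
      rw [e]; gcongr
    have h1 : (x + 1) * (2 * α + 1) ≤ 3.75 * (x * α) := by nlinarith
    have h2 : (α : ℝ) * (α + 3) ≤ 2.5 * (x * α) := by nlinarith
    have h3 : 2.5 * (x * α) ≤ 1.25 * (N * (x * α)) := by nlinarith [mul_nonneg (by linarith : 0 ≤ x) (by linarith : (0 : ℝ) ≤ α)]
    have h4 : (x + 1) * (2 + 1) + 1 ≤ 2.5 * (x * α) := by nlinarith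
    have h5 : (x + 1) * 3 ≤ 2.25 * (x * α) := by nlinarith
    have h6 : N * ((x + 1) * (2 * α + 1)) ≤ N * (3.75 * (x * α)) := by gcongr
    have h7 : N * ((x + 1) * (2 + 1) + 1) ≤ N * (2.5 * (x * α)) := by gcongr
    have h8 : N * ((x + 1) * 3) ≤ N * (2.25 * (x * α)) := by gcongr
    have h9 : 0 ≤ N * (x * α) := by positivity
    linarith
  have hcomp : (componentCost n : ℝ) ≤ 800 * (N * Real.log N) := by
    have e : (componentCost n : ℝ) = n * (163 + 160 * C) := by
      rw [componentCost]; push_cast; ring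
    -- With `log 2 ≥ 0.69` the two summands are at most `163 / 0.69` and `320 / 0.69` times `log N`,
    -- about 700 together.
    have h1 : (163 + 160 * C : ℝ) ≤ 800 * Real.log N := by linarith
    rw [e]
    calc (n : ℝ) * (163 + 160 * C) ≤ N * (800 * Real.log N) := by gcongr
      _ = _ := by ring
  have e : (totalCost α s n : ℝ) = n * (x + 1) + s * (overheadCost α s n + α * componentCost n) := by
    rw [totalCost, hx]; push_cast; ring
  rw [e]
  have h1 : n * (x + 1) ≤ N * (1.5 * (x * x)) := by
    have : x + 1 ≤ 1.5 * (x * x) := by nlinarith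
    gcongr
  have h2 : s * (overheadCost α s n + α * componentCost n)
      ≤ s * (10 * (N * x * α) + α * (800 * (N * Real.log N))) := by gcongr
  have h3 : s * (10 * (N * x * α) + α * (800 * (N * Real.log N)))
      = 10 * (N * (x * x)) + 800 * (α * s * N * Real.log N) := by rw [hx]; ring
  have h4 : (α : ℝ) ^ 2 * (s : ℝ) ^ 2 * N = N * (x * x) := by rw [hx]; ring
  have h5 : 0 ≤ N * (x * x) := by positivity
  have h6 : 0 ≤ α * s * N * Real.log N := by
    have : 0 ≤ Real.log N := by linarith
    positivity
  rw [h4]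
  linarith


/-! ### The error of component-by-component vectors -/

/-- Subadditivity of `t ↦ t ^ r` for `r ≤ 1`. It moves the exponent inside all sums, so that
averaging is done with r-th powers and the rate improves from `N⁻¹` to `N ^ (-1/r)`. -/
theorem rpow_sum_le_sum_rpow {ι : Type*} (s : Finset ι) (f : ι → ℝ) (hf : ∀ i ∈ s, 0 ≤ f i)
    {r : ℝ} (h0 : 0 < r) (h1 : r ≤ 1) : (∑ i ∈ s, f i) ^ r ≤ ∑ i ∈ s, f i ^ r := by
  classical
  induction s using Finset.induction_on with
  | empty => simp [Real.zero_rpow h0.ne']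
  | insert a s ha ih =>
    rw [Finset.sum_insert ha, Finset.sum_insert ha]
    have hs := Finset.sum_nonneg fun i hi => hf i (Finset.mem_insert_of_mem hi)
    exact (Real.rpow_add_le_add_rpow (hf a (Finset.mem_insert_self a s)) hs h0.le h1).trans
      (by have := ih fun i hi => hf i (Finset.mem_insert_of_mem hi); linarith)

section crossSum

variable {F : Type} [Field F] [Fintype F] [DecidableEq F] {ι : Type} [Fintype ι] [DecidableEq ι]

theorem crossSum_nonneg {w : F → ℝ} (hw : ∀ g, 0 ≤ w g) (y : ι → F) : 0 ≤ crossSum w y :=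
  Finset.sum_nonneg fun g _ => by
    split_ifs
    exacts [Finset.prod_nonneg fun j _ => hw _, le_rfl]

theorem crossSum_rpow_le {w : F → ℝ} (hw : ∀ g, 0 ≤ w g) (y : ι → F) {r : ℝ} (h0 : 0 < r)
    (h1 : r ≤ 1) : crossSum w y ^ r ≤ crossSum (fun g => w g ^ r) y := by
  refine (rpow_sum_le_sum_rpow _ _ (fun g _ => ?_) h0 h1).trans (Finset.sum_le_sum fun g _ => ?_)
  · split_ifs
    exacts [Finset.prod_nonneg fun j _ => hw _, le_rfl]
  · split_ifs
    · rw [Real.finsetProd_rpow _ _ fun j _ => hw _]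
    · rw [Real.zero_rpow h0.ne']

/-- If `g i ≠ 0`, the equation fixes `x`; these tuples give one full product. If `g i = 0`, all `x`
may occur, but then the factor `card F * w 0` is at most `∑ w` because `w 0` is minimal. Hence the
2. -/
theorem sum_crossSum_update_le {w : F → ℝ} (hw : ∀ g, 0 ≤ w g) (hw0 : ∀ g, w 0 ≤ w g) (y : ι → F)
    (i : ι) :
    ∑ x ∈ Finset.univ.erase (0 : F), crossSum w (Function.update y i x)
      ≤ 2 * (∑ g, w g) ^ Fintype.card ι := by
  have hprod : ∀ g : ι → F, 0 ≤ ∏ j, w (g j) := fun g => Finset.prod_nonneg fun j _ => hw _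
  have hcount : ∀ g : ι → F, ((Finset.univ.erase (0 : F)).filter fun x =>
      ∑ j, g j * Function.update y i x j = 0).card
        ≤ 1 + if g i = 0 then Fintype.card F else 0 := by
    intro g
    split_ifs with hg
    · exact (Finset.card_le_univ _).trans (by omega)
    · rw [add_zero]
      refine Finset.card_le_one.2 fun x hx x' hx' => ?_
      have hx := (Finset.mem_filter.1 hx).2
      have hx' := (Finset.mem_filter.1 hx').2
      rw [← Finset.add_sum_erase _ _ (Finset.mem_univ i)] at hx hx'
      have he : ∀ x, ∑ j ∈ Finset.univ.erase i, g j * Function.update y i x j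
          = ∑ j ∈ Finset.univ.erase i, g j * y j := fun x =>
        Finset.sum_congr rfl fun j hj => by rw [Function.update_of_ne (Finset.ne_of_mem_erase hj)]
      rw [he, Function.update_self] at hx hx'
      exact mul_left_cancel₀ hg (add_right_cancel (hx.trans hx'.symm))
  have hprodsum : ∀ f : ι → F → ℝ, ∑ g : ι → F, ∏ j, f j (g j) = ∏ j, ∑ x, f j x := fun f => by
    rw [Finset.prod_univ_sum, Fintype.piFinset_univ]
  calc ∑ x ∈ Finset.univ.erase (0 : F), crossSum w (Function.update y i x)
      = ∑ g : ι → F, (((Finset.univ.erase (0 : F)).filter fun x =>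
          ∑ j, g j * Function.update y i x j = 0).card : ℝ) * ∏ j, w (g j) := by
        simp only [crossSum]
        rw [Finset.sum_comm]
        refine Finset.sum_congr rfl fun g _ => ?_
        rw [← Finset.sum_filter, Finset.sum_const, nsmul_eq_mul]
    -- The second product vanishes unless `g i = 0` and carries the count `card F` in its `i`-th
    -- factor, so that both sums over `g` factor.
    _ ≤ ∑ g : ι → F, (∏ j, w (g j) + ∏ j, if j = i then
          (if g j = 0 then Fintype.card F * w 0 else 0) else w (g j)) := by
        refine Finset.sum_le_sum fun g _ => ?_
        have h1 := mul_le_mul_of_nonneg_right (Nat.cast_le (α := ℝ).2 (hcount g)) (hprod g)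
        refine h1.trans (le_of_eq ?_)
        push_cast
        rw [add_mul, one_mul]
        congr 1
        rw [← Finset.mul_prod_erase _ _ (Finset.mem_univ i), ← Finset.mul_prod_erase _ _
          (Finset.mem_univ i), if_pos rfl, Finset.prod_congr rfl fun j hj =>
            if_neg (Finset.ne_of_mem_erase hj)]
        split_ifs with hg
        · rw [hg]; ring
        · simp
    _ ≤ _ := by
        rw [Finset.sum_add_distrib, hprodsum, hprodsum fun j x => if j = i then
          (if x = 0 then Fintype.card F * w 0 else 0) else w x, two_mul]
        refine add_le_add (by simp) ?_
        refine (Finset.prod_le_prod (g := fun _ => ∑ g, w g) (fun j _ => ?_) fun j _ => ?_).trans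
          (by simp)
        · refine Finset.sum_nonneg fun x _ => ?_
          split_ifs
          exacts [mul_nonneg (Nat.cast_nonneg _) (hw 0), le_rfl, hw x]
        · split_ifs with hj
          · simp only [Finset.sum_ite_eq', Finset.mem_univ, if_true]
            refine le_trans (le_of_eq ?_) (Finset.sum_le_sum fun g _ => hw0 g)
            simp
          · exact le_rfl

end crossSum

theorem sum_filter_lt_succ {D : ℕ} (d : Fin D) (f : Finset (Fin D) → ℝ) :
    ∑ v : Finset (Fin D) with v.Nonempty ∧ ∀ j : Fin D, j ∈ v → (j : ℕ) < d + 1, f v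
      = ∑ v : Finset (Fin D) with v.Nonempty ∧ ∀ j : Fin D, j ∈ v → (j : ℕ) < d, f v
        + ∑ v : Finset (Fin D) with d ∈ v ∧ ∀ j : Fin D, j ∈ v → (j : ℕ) < d + 1, f v := by
  rw [← Finset.sum_union]
  · refine Finset.sum_congr ?_ fun _ _ => rfl
    ext v
    simp only [Finset.mem_filter, Finset.mem_univ, true_and, Finset.mem_union]
    constructor
    · rintro ⟨hv, hlt⟩
      by_cases hd : d ∈ v
      · exact Or.inr ⟨hd, hlt⟩
      · refine Or.inl ⟨hv, fun j hj => lt_of_le_of_ne (Nat.lt_succ_iff.1 (hlt j hj)) fun he => ?_⟩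
        exact hd (Fin.ext he ▸ hj)
    · rintro (⟨hv, hlt⟩ | ⟨hd, hlt⟩)
      · exact ⟨hv, fun j hj => (hlt j hj).trans (Nat.lt_succ_self _)⟩
      · exact ⟨⟨d, hd⟩, hlt⟩
  · rw [Finset.disjoint_left]
    intro v hv hv'
    simp only [Finset.mem_filter, Finset.mem_univ, true_and] at hv hv'
    exact lt_irrefl _ (hv.2 d hv'.1)

theorem sin_pi_div_pos {b : ℕ} (hb : 1 < b) : 0 < Real.sin (Real.pi / b) := by
  have hb' : (1 : ℝ) < b := by exact_mod_cast hb
  exact Real.sin_pos_of_pos_of_lt_pi (by positivity) (div_lt_self Real.pi_pos hb')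

theorem le_walshConst {b : ℕ} (hb : 1 < b) (α : ℕ) {r : ℕ} (hr : 1 ≤ r) (hrα : r ≤ α) :
    (if r = α then 2 else 1) * (1 / (2 * Real.sin (Real.pi / b)) ^ r)
      * (1 + 1 / (b : ℝ) + 1 / ((b : ℝ) * (b + 1))) ^ (α - 2)
      * (3 + 2 / (b : ℝ) + (2 * (b : ℝ) + 1) / ((b : ℝ) - 1)) ≤ walshConst α b := by
  have hb' : (1 : ℝ) < b := by exact_mod_cast hb
  have h3 : (0 : ℝ) ≤ 3 + 2 / (b : ℝ) + (2 * (b : ℝ) + 1) / ((b : ℝ) - 1) := by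
    have : 0 < (b : ℝ) - 1 := by linarith
    positivity
  rw [walshConst]
  refine mul_le_mul_of_nonneg_right (mul_le_mul_of_nonneg_right ?_ (by positivity)) h3
  split_ifs with h
  · subst h
    rw [mul_one_div, Finset.le_fold_max]
    exact Or.inl le_rfl
  · rw [one_mul, Finset.le_fold_max]
    exact Or.inr ⟨r, Finset.mem_Icc.2 ⟨hr, by omega⟩, le_rfl⟩

theorem walshConst_pos {b : ℕ} (hb : 1 < b) {α : ℕ} (hα : 1 ≤ α) : 0 < walshConst α b := by
  have hb' : (1 : ℝ) < b := by exact_mod_cast hb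
  have := sin_pi_div_pos hb
  have h0 : 0 < (b : ℝ) - 1 := by linarith
  exact lt_of_lt_of_le (by positivity) (le_walshConst hb α hα le_rfl)

theorem blockConst_pos {b : ℕ} (hb : 1 < b) {α : ℕ} (hα : 1 ≤ α) : 0 < blockConst b α :=
  mul_pos (walshConst_pos hb hα) (by positivity)

theorem rowWeight_nonneg {B x : ℝ} (hB : 0 ≤ B) (hx : 0 ≤ x) (α ν : ℕ) : 0 ≤ rowWeight B α x ν := by
  unfold rowWeight
  split_ifs <;> positivity

theorem cbcWeight_nonneg {b : ℕ} (hb : 1 < b) {α : ℕ} (hα : 1 ≤ α) {β : ℕ → ℝ} (hβ : ∀ j, 0 ≤ β j)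
    {D : ℕ} (v : Finset (Fin D)) : 0 ≤ cbcWeight b α β v := by
  rw [cbcWeight_eq, ← sum_piFinset_eq_coeffFunctional]
  exact Finset.sum_nonneg fun ν _ => mul_nonneg (Nat.cast_nonneg _)
    (Finset.prod_nonneg fun j _ => rowWeight_nonneg (blockConst_pos hb hα).le (hβ _) _ _)

theorem cbcWeight_rpow_le {b : ℕ} (hb : 1 < b) {α : ℕ} (hα : 1 ≤ α) {β : ℕ → ℝ}
    (hβ : ∀ j, 0 ≤ β j) {r : ℝ} (h0 : 0 < r) (h1 : r ≤ 1) {D : ℕ} (v : Finset (Fin D)) :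
    cbcWeight b α β v ^ r ≤ coeffFunctional (fun k => (k.factorial : ℝ) ^ r)
      (∏ J ∈ blocks α v, rowPoly α fun ν => rowWeight (blockConst b α) α (β J) ν ^ r) := by
  have hrow : ∀ j ν, 0 ≤ rowWeight (blockConst b α) α (β j) ν := fun j ν =>
    rowWeight_nonneg (blockConst_pos hb hα).le (hβ _) _ _
  rw [cbcWeight_eq, ← sum_piFinset_eq_coeffFunctional, ← sum_piFinset_eq_coeffFunctional]
  refine (rpow_sum_le_sum_rpow _ _ (fun ν _ => mul_nonneg (Nat.cast_nonneg _)
    (Finset.prod_nonneg fun j _ => hrow _ _)) h0 h1).trans (le_of_eq ?_)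
  refine Finset.sum_congr rfl fun ν _ => ?_
  rw [Real.mul_rpow (Nat.cast_nonneg _) (Finset.prod_nonneg fun j _ => hrow _ _),
    Real.finsetProd_rpow _ _ fun j _ => hrow _ _]

section bound

variable {b m : ℕ} [Fact b.Prime] {P : (ZMod b)[X]} {F : Type} [Field F] [Fintype F]
  [DecidableEq F] {π : (ZMod b)[X] →+* F} (h : IsResidueMap P m π)

include h

/-- Each increment of the criterion is minimal over the `card F - 1` candidates, so its r-th power
is at most the mean of theirs. The mean is controlled by `sum_crossSum_update_le`. -/
theorem searchCriterion_rpow_le_sum {α : ℕ} (hα : 2 ≤ α) {β : ℕ → ℝ} (hβ : ∀ j, 0 ≤ β j) {r τ : ℝ}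
    (h0 : 0 < r) (h1 : r ≤ 1) (hτ : ∑ g, classSum m (((b : ℝ)⁻¹) ^ α) π g ^ r ≤ τ) {D : ℕ}
    {q : Fin D → (ZMod b)[X]} (hq : IsCBCVector m α P β q) (e : ℕ) (he : e ≤ D) :
    searchCriterion m α P β q e ^ r ≤ 2 / (Fintype.card F - 1) *
      ∑ v : Finset (Fin D) with v.Nonempty ∧ ∀ j : Fin D, j ∈ v → (j : ℕ) < e,
        cbcWeight b α β v ^ r * τ ^ v.card := by
  have hb := (Fact.out : b.Prime).one_lt
  have hρ : (0 : ℝ) ≤ ((b : ℝ)⁻¹) ^ α := by positivity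
  have hρ1 := mul_inv_pow_lt_one hb hα
  have hW : ∀ v : Finset (Fin D), 0 ≤ cbcWeight b α β v := cbcWeight_nonneg hb (by omega) hβ
  set w := classSum m (((b : ℝ)⁻¹) ^ α) π with hw
  have hw0 : ∀ g, 0 ≤ w g := classSum_nonneg h hρ hρ1
  have hwmin : ∀ g, w 0 ≤ w g := classSum_zero_le h hρ hρ1
  have hcard : (0 : ℝ) < Fintype.card F - 1 := by
    have : (1 : ℝ) < Fintype.card F := by exact_mod_cast Fintype.one_lt_card (α := F)
    linarith
  induction e with
  | zero =>
    have hempty : ∀ v : Finset (Fin D), ¬(v.Nonempty ∧ ∀ j : Fin D, j ∈ v → (j : ℕ) < 0) := by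
      rintro v ⟨⟨j, hj⟩, hlt⟩
      exact absurd (hlt j hj) (Nat.not_lt_zero _)
    rw [searchCriterion, Finset.filter_false_of_mem fun v _ => hempty v]
    simp [Real.zero_rpow h0.ne']
  | succ e ih =>
    set d : Fin D := ⟨e, he⟩ with hd
    set T : Finset (Finset (Fin D)) := Finset.univ.filter fun v =>
      d ∈ v ∧ ∀ j : Fin D, j ∈ v → (j : ℕ) < d + 1 with hT
    set θ : (Fin D → (ZMod b)[X]) → ℝ := fun q =>
      ∑ v ∈ T, cbcWeight b α β v * crossSum w fun j : {j // j ∈ v} => π (q j) with hθ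
    have hsplit : ∀ q : Fin D → (ZMod b)[X], searchCriterion m α P β q (d + 1)
        = searchCriterion m α P β q d + θ q := fun q => by
      rw [searchCriterion_eq h hα, searchCriterion_eq h hα, sum_filter_lt_succ]
    have hterm : ∀ (q : Fin D → (ZMod b)[X]) (v : Finset (Fin D)),
        0 ≤ cbcWeight b α β v * crossSum w fun j : {j // j ∈ v} => π (q j) := fun q v =>
      mul_nonneg (hW v) (crossSum_nonneg hw0 _)
    have hθ0 : ∀ q, 0 ≤ θ q := fun q => Finset.sum_nonneg fun v _ => hterm q v
    -- The criterion for the preceding components does not involve component `d`, so minimality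
    -- passes to the increment.
    have hmin : ∀ g ∈ genSet b m, θ q ≤ θ (Function.update q d g) := by
      intro g hg
      have h2 := hq.2.2 d g hg
      rw [hsplit, hsplit, searchCriterion_congr h hα β d.2.le (q := Function.update q d g) (q' := q)
        fun j hj => Function.update_of_ne (fun he => by rw [he] at hj; exact lt_irrefl _ hj) _ _] at h2
      linarith
    have hcand : ∀ x : F, ∃ g, x ≠ 0 → g ∈ genSet b m ∧ π g = x := fun x => by
      by_cases hx : x = 0
      · exact ⟨0, fun h => absurd hx h⟩
      · obtain ⟨g, hg, hgx⟩ := h.exists_mem_genSet hx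
        exact ⟨g, fun _ => ⟨hg, hgx⟩⟩
    choose g hg using hcand
    have hsum : (Fintype.card F - 1) * θ q ^ r ≤ ∑ v ∈ T, cbcWeight b α β v ^ r * (2 * τ ^ v.card) := by
      calc (Fintype.card F - 1) * θ q ^ r
          = ∑ x ∈ Finset.univ.erase (0 : F), θ q ^ r := by
            rw [Finset.sum_const, Finset.card_erase_of_mem (Finset.mem_univ _), nsmul_eq_mul,
              Finset.card_univ, Nat.cast_sub Fintype.card_pos, Nat.cast_one]
        _ ≤ ∑ x ∈ Finset.univ.erase (0 : F), ∑ v ∈ T, cbcWeight b α β v ^ r *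
              crossSum (fun g => w g ^ r)
                fun j : {j // j ∈ v} => π (Function.update q d (g x) j) := by
            refine Finset.sum_le_sum fun x hx => ?_
            have hgx := hg x (Finset.ne_of_mem_erase hx)
            refine (Real.rpow_le_rpow (hθ0 q) (hmin _ hgx.1) h0.le).trans ?_
            refine (rpow_sum_le_sum_rpow _ _ (fun v _ => hterm _ v) h0 h1).trans
              (Finset.sum_le_sum fun v _ => ?_)
            rw [Real.mul_rpow (hW v) (crossSum_nonneg hw0 _)]
            exact mul_le_mul_of_nonneg_left (crossSum_rpow_le hw0 _ h0 h1)
              (Real.rpow_nonneg (hW v) _)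
        _ = ∑ v ∈ T, cbcWeight b α β v ^ r * ∑ x ∈ Finset.univ.erase (0 : F),
              crossSum (fun g => w g ^ r)
                fun j : {j // j ∈ v} => π (Function.update q d (g x) j) := by
            rw [Finset.sum_comm]
            simp only [Finset.mul_sum]
        _ ≤ _ := by
            refine Finset.sum_le_sum fun v hv => mul_le_mul_of_nonneg_left ?_
              (Real.rpow_nonneg (hW v) _)
            have hdv : d ∈ v := (Finset.mem_filter.1 hv).2.1
            have h3 := sum_crossSum_update_le (w := fun g => w g ^ r)
              (fun g => Real.rpow_nonneg (hw0 g) _)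
              (fun g => Real.rpow_le_rpow (hw0 0) (hwmin g) h0.le)
              (fun j : {j // j ∈ v} => π (q j)) ⟨d, hdv⟩
            rw [Fintype.card_coe] at h3
            refine le_trans (le_of_eq ?_) (h3.trans (mul_le_mul_of_nonneg_left (pow_le_pow_left₀
              (Finset.sum_nonneg fun g _ => Real.rpow_nonneg (hw0 g) _) hτ _) zero_le_two))
            refine Finset.sum_congr rfl fun x hx => ?_
            congr 1
            ext j
            by_cases hj : j = ⟨d, hdv⟩
            · rw [hj, Function.update_self, Function.update_self,
                (hg x (Finset.ne_of_mem_erase hx)).2]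
            · rw [Function.update_of_ne hj, Function.update_of_ne fun hj' => hj (Subtype.ext hj')]
    have hE0 : ∀ k, 0 ≤ searchCriterion m α P β q k := fun k => by
      rw [searchCriterion_eq h hα]
      exact Finset.sum_nonneg fun v _ => hterm q v
    have e1 : searchCriterion m α P β q (e + 1) = searchCriterion m α P β q e + θ q := hsplit q
    have e2 := sum_filter_lt_succ d fun v => cbcWeight b α β v ^ r * τ ^ v.card
    rw [e1]
    refine (Real.rpow_add_le_add_rpow (hE0 e) (hθ0 q) h0.le h1).trans ?_
    have hθr : θ q ^ r ≤ 2 / (Fintype.card F - 1) *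
        ∑ v ∈ T, cbcWeight b α β v ^ r * τ ^ v.card := by
      rw [div_mul_eq_mul_div, le_div_iff₀ hcard, mul_comm, Finset.mul_sum]
      exact hsum.trans (le_of_eq (Finset.sum_congr rfl fun v _ => by ring))
    refine (add_le_add (ih (by omega)) hθr).trans (le_of_eq ?_)
    rw [← mul_add]
    exact congrArg _ e2.symm

/-- With `θ = (b ρ^r)^m` in `[0, 1]` the sum is at most `(1 - θ) posSum (ρ^r) + θ (posSum ρ)^r`. The
bound is therefore uniform in `m`; the condition `b ρ^r < 1` amounts to `α r > 1`. -/
theorem sum_classSum_rpow_le {ρ : ℝ} (hρ : 0 ≤ ρ) (h1 : b * ρ < 1) {r : ℝ} (hr0 : 0 < r)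
    (hr1 : r ≤ 1) (h2 : b * ρ ^ r < 1) :
    ∑ g, classSum m ρ π g ^ r ≤ posSum b (ρ ^ r) + posSum b ρ ^ r := by
  have hb := (Fact.out : b.Prime).one_lt
  have hS := posSum_nonneg (by omega) hρ h1
  have hS' := posSum_nonneg (b := b) (by omega) (Real.rpow_nonneg hρ r) h2
  have h3 : (0 : ℝ) ≤ b * ρ ^ r := mul_nonneg (Nat.cast_nonneg b) (Real.rpow_nonneg hρ r)
  have hpos : ∀ k, posPow b ρ k ^ r = posPow b (ρ ^ r) k := fun k => by
    unfold posPow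
    split_ifs
    · exact Real.zero_rpow hr0.ne'
    · rw [← Real.rpow_natCast, ← Real.rpow_natCast, ← Real.rpow_mul hρ, ← Real.rpow_mul hρ, mul_comm]
  rw [← h.sum_range_digitPoly fun g => classSum m ρ π g ^ r]
  calc _ ≤ ∑ k ∈ Finset.range (b ^ m), (posPow b (ρ ^ r) k + (ρ ^ r) ^ m * posSum b ρ ^ r) := by
        refine Finset.sum_le_sum fun k hk => ?_
        rw [classSum_digitPoly h hρ h1 (Finset.mem_range.1 hk), ← hpos]
        refine (Real.rpow_add_le_add_rpow (posPow_nonneg hρ k) (by positivity) hr0.le hr1).trans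
          (le_of_eq ?_)
        rw [Real.mul_rpow (by positivity) hS, ← Real.rpow_natCast, ← Real.rpow_natCast,
          ← Real.rpow_mul hρ, ← Real.rpow_mul hρ, mul_comm r]
    _ = posSum b (ρ ^ r) * (1 - (b * ρ ^ r) ^ m) + (b * ρ ^ r) ^ m * posSum b ρ ^ r := by
        rw [Finset.sum_add_distrib, sum_range_pow_posPow' (by omega) h2, Finset.sum_const,
          Finset.card_range, nsmul_eq_mul, mul_pow]
        push_cast
        ring
    _ ≤ _ := by
        have h4 := pow_nonneg h3 m
        have h5 := pow_le_one₀ (n := m) h3 h2.le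
        have h6 : 0 ≤ posSum b ρ ^ r := Real.rpow_nonneg hS r
        nlinarith

theorem sum_classSum {ρ : ℝ} (hρ : 0 ≤ ρ) (h1 : b * ρ < 1) :
    ∑ g, classSum m ρ π g = posSum b ρ := by
  have hb := (Fact.out : b.Prime).one_lt
  rw [← h.sum_range_digitPoly fun g => classSum m ρ π g, Finset.sum_congr rfl fun k hk =>
    classSum_digitPoly h hρ h1 (Finset.mem_range.1 hk), Finset.sum_add_distrib,
    sum_range_pow_posPow' (by omega) h1, Finset.sum_const, Finset.card_range, nsmul_eq_mul, mul_pow]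
  push_cast
  ring

omit h [Fintype F] [DecidableEq F] [Field F] [Fact b.Prime] in
-- One block multiplies the sum by `1 + ((1 + τ) ^ α - 1) ∑ t_ν z^ν`, where the constant counts the
-- nonempty subsets of the block. By `htx` this is majorized coefficientwise by `exp (x_j z)`, and
-- exponentials multiply.
theorem coeff_blockSum_bound (α s : ℕ) {τ : ℝ} (hτ : 0 ≤ τ) (t : ℕ → ℕ → ℝ) (x : ℕ → ℝ)
    (ht : ∀ j ν, 0 ≤ t j ν) (hx : ∀ j, 0 ≤ x j)
    (htx : ∀ j ν, 1 ≤ ν → ν ≤ α → ((1 + τ) ^ α - 1) * t j ν ≤ x j ^ ν / ν.factorial) :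
    (blockSum α (fun j => rowPoly α (t j)) (fun _ => Polynomial.C τ) (s * α)).natDegree ≤ s * α ∧
    ∀ k, 0 ≤ (blockSum α (fun j => rowPoly α (t j)) (fun _ => Polynomial.C τ) (s * α)).coeff k ∧
      (blockSum α (fun j => rowPoly α (t j)) (fun _ => Polynomial.C τ) (s * α)).coeff k
        ≤ (∑ j ∈ Finset.range s, x j) ^ k / k.factorial := by
  have hA : 0 ≤ (1 + τ) ^ α - 1 := by
    have := one_le_pow₀ (n := α) (by linarith : 1 ≤ 1 + τ)
    linarith
  induction s with
  | zero =>
    rw [zero_mul, blockSum_zero]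
    refine ⟨by simp, fun k => ?_⟩
    rw [Polynomial.coeff_one]
    split_ifs with hk
    · subst hk; simp
    · simp [zero_pow hk]
  | succ s ih =>
    set G := blockSum α (fun j => rowPoly α (t j)) (fun _ => Polynomial.C τ) (s * α) with hG
    have hstep : blockSum α (fun j => rowPoly α (t j)) (fun _ => Polynomial.C τ) ((s + 1) * α)
        = G + Polynomial.C ((1 + τ) ^ α - 1) * (rowPoly α (t s) * G) := by
      rw [blockSum_succ_mul, ← hG, Finset.prod_const, Finset.card_range]
      simp
    rw [hstep]
    constructor
    · refine (Polynomial.natDegree_add_le _ _).trans (max_le (ih.1.trans (by rw [Nat.succ_mul]; omega)) ?_)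
      refine (Polynomial.natDegree_C_mul_le _ _).trans (Polynomial.natDegree_mul_le.trans ?_)
      have := natDegree_rowPoly_le α (t s)
      have := ih.1
      rw [Nat.succ_mul]
      omega
    · intro k
      rw [Polynomial.coeff_add, Polynomial.coeff_C_mul, coeff_rowPoly_mul]
      set X := ∑ j ∈ Finset.range s, x j with hX
      have hX0 : 0 ≤ X := Finset.sum_nonneg fun j _ => hx j
      have hterm : ∀ i, 0 ≤ if i + 1 ≤ k then t s (i + 1) * G.coeff (k - (i + 1)) else 0 := fun i => by
        split_ifs
        exacts [mul_nonneg (ht _ _) (ih.2 _).1, le_rfl]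
      constructor
      · exact add_nonneg (ih.2 k).1 (mul_nonneg hA (Finset.sum_nonneg fun i _ => hterm i))
      -- The binomial theorem, written as the Cauchy product of two exponential series.
      · have hbin : (∑ j ∈ Finset.range (s + 1), x j) ^ k / k.factorial
            = ∑ i ∈ Finset.range (k + 1), x s ^ i / i.factorial * (X ^ (k - i) / (k - i).factorial) := by
          rw [Finset.sum_range_succ, ← hX, add_comm, add_pow, Finset.sum_div]
          refine Finset.sum_congr rfl fun i hi => ?_
          have hi : i ≤ k := Nat.lt_succ_iff.1 (Finset.mem_range.1 hi)
          rw [Nat.cast_choose ℝ hi]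
          have := Nat.factorial_ne_zero k
          field_simp
        rw [hbin, Finset.sum_range_succ']
        have h0 : G.coeff k ≤ x s ^ 0 / (0 : ℕ).factorial * (X ^ (k - 0) / (k - 0).factorial) := by
          simpa using (ih.2 k).2
        rw [add_comm]
        refine add_le_add ?_ h0
        rw [Finset.mul_sum]
        have h1 : ∀ i ∈ Finset.range α, ((1 + τ) ^ α - 1) *
            (if i + 1 ≤ k then t s (i + 1) * G.coeff (k - (i + 1)) else 0)
            ≤ if i ∈ Finset.range k then x s ^ (i + 1) / (i + 1).factorial *
              (X ^ (k - (i + 1)) / (k - (i + 1)).factorial) else 0 := by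
          intro i hi
          simp only [Finset.mem_range] at hi ⊢
          by_cases hik : i < k
          · rw [if_pos hik, if_pos (by omega), ← mul_assoc]
            have h2 := htx s (i + 1) (by omega) (by omega)
            exact mul_le_mul h2 (ih.2 _).2 (ih.2 _).1 (div_nonneg (pow_nonneg (hx s) _) (by positivity))
          · rw [if_neg hik, if_neg (by omega), mul_zero]
        refine (Finset.sum_le_sum h1).trans ?_
        rw [← Finset.sum_filter]
        refine Finset.sum_le_sum_of_subset_of_nonneg (fun i hi => (Finset.mem_filter.1 hi).2)
          fun i _ _ => mul_nonneg (div_nonneg (pow_nonneg (hx s) _) (by positivity)) (by positivity)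

theorem searchCriterion_rpow_le {α s : ℕ} (hα : 2 ≤ α) {β : ℕ → ℝ} (hβ : ∀ j, 0 ≤ β j) {r τ : ℝ}
    (h0 : 0 < r) (h1 : r ≤ 1) (hτ : ∑ g, classSum m (((b : ℝ)⁻¹) ^ α) π g ^ r ≤ τ) (x : ℕ → ℝ)
    (hx : ∀ j, 0 ≤ x j) (hβx : ∀ j ν, 1 ≤ ν → ν ≤ α →
      ((1 + τ) ^ α - 1) * rowWeight (blockConst b α) α (β j) ν ^ r ≤ x j ^ ν / ν.factorial)
    {q : Fin (s * α) → (ZMod b)[X]} (hq : IsCBCVector m α P β q) :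
    searchCriterion m α P β q (s * α) ^ r ≤ 2 / (Fintype.card F - 1) *
      ∑ k ∈ Finset.range (s * α + 1), (k.factorial : ℝ) ^ r *
        ((∑ j ∈ Finset.range s, x j) ^ k / k.factorial) := by
  have hb := (Fact.out : b.Prime).one_lt
  have hcard : (0 : ℝ) < Fintype.card F - 1 := by
    have : (1 : ℝ) < Fintype.card F := by exact_mod_cast Fintype.one_lt_card (α := F)
    linarith
  have hτ0 : 0 ≤ τ := (Finset.sum_nonneg fun g _ => Real.rpow_nonneg (classSum_nonneg h
    (by positivity) (mul_inv_pow_lt_one hb hα) g) r).trans hτ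
  refine (searchCriterion_rpow_le_sum h hα hβ h0 h1 hτ hq _ le_rfl).trans
    (mul_le_mul_of_nonneg_left ?_ (by positivity))
  set t : ℕ → ℕ → ℝ := fun j ν => rowWeight (blockConst b α) α (β j) ν ^ r with ht
  obtain ⟨hdeg, hcoeff⟩ := coeff_blockSum_bound α s hτ0 t x (fun j ν => Real.rpow_nonneg
    (rowWeight_nonneg (blockConst_pos hb (by omega)).le (hβ j) _ _) _) hx hβx
  calc _ ≤ ∑ v : Finset (Fin (s * α)) with v.Nonempty ∧
          ∀ j : Fin (s * α), j ∈ v → (j : ℕ) < s * α,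
        coeffFunctional (fun k => (k.factorial : ℝ) ^ r)
          ((∏ J ∈ blocks α v, rowPoly α (t J)) * ∏ _j ∈ v, Polynomial.C τ) := by
        refine Finset.sum_le_sum fun v _ => ?_
        rw [Finset.prod_const, ← Polynomial.C_pow, mul_comm _ (Polynomial.C _),
          coeffFunctional_C_mul, mul_comm _ (τ ^ _)]
        exact mul_le_mul_of_nonneg_left (cbcWeight_rpow_le hb (by omega) hβ h0 h1 v)
          (pow_nonneg hτ0 _)
    _ = coeffFunctional (fun k => (k.factorial : ℝ) ^ r)
          (blockSum α (fun j => rowPoly α (t j)) (fun _ => Polynomial.C τ) (s * α)) - 1 := by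
        rw [← map_sum, sum_blocks_eq α (fun j => rowPoly α (t j)) (fun _ => Polynomial.C τ) le_rfl,
          map_sub, coeffFunctional_one]
        simp
    _ ≤ _ := by
        rw [coeffFunctional_eq_sum _ _ (Nat.lt_succ_of_le hdeg)]
        have : ∑ k ∈ Finset.range (s * α).succ, (k.factorial : ℝ) ^ r *
            (blockSum α (fun j => rowPoly α (t j)) (fun _ => Polynomial.C τ) (s * α)).coeff k
            ≤ ∑ k ∈ Finset.range (s * α + 1), (k.factorial : ℝ) ^ r *
              ((∑ j ∈ Finset.range s, x j) ^ k / k.factorial) :=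
          Finset.sum_le_sum fun k _ => mul_le_mul_of_nonneg_left (hcoeff k).2 (by positivity)
        linarith

end bound


/-! ### Uniform error bounds for component-by-component vectors -/

theorem summable_factorial_rpow {r X : ℝ} (hr : r < 1) (hX : 0 ≤ X) :
    Summable fun k : ℕ => (k.factorial : ℝ) ^ r * (X ^ k / k.factorial) := by
  rcases hX.eq_or_lt with rfl | hX
  · refine summable_of_ne_finset_zero (s := {0}) fun k hk => ?_
    rw [Finset.mem_singleton] at hk
    simp [zero_pow hk]
  refine summable_of_ratio_test_tendsto_lt_one (l := 0) one_pos
    (Filter.Eventually.of_forall fun k => by positivity) ?_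
  have h1 : ∀ k : ℕ, ‖((k + 1).factorial : ℝ) ^ r * (X ^ (k + 1) / (k + 1).factorial)‖
      / ‖(k.factorial : ℝ) ^ r * (X ^ k / k.factorial)‖ = X * (((k + 1 : ℕ) : ℝ) ^ (-(1 - r))) := by
    intro k
    have hk : (0 : ℝ) < k.factorial := by exact_mod_cast Nat.factorial_pos k
    have hk1 : (0 : ℝ) < ((k + 1 : ℕ) : ℝ) := by positivity
    rw [Real.norm_of_nonneg (by positivity), Real.norm_of_nonneg (by positivity),
      Nat.factorial_succ, Nat.cast_mul, Real.mul_rpow hk1.le hk.le, neg_sub,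
      Real.rpow_sub_one hk1.ne']
    have : (k.factorial : ℝ) ^ r ≠ 0 := (Real.rpow_pos_of_pos hk r).ne'
    field_simp
    ring
  simp only [h1]
  rw [← mul_zero X]
  exact ((tendsto_rpow_neg_atTop (by linarith : 0 < 1 - r)).comp
    (tendsto_natCast_atTop_atTop.comp (Filter.tendsto_add_atTop_nat 1))).const_mul X

/-- The conclusion of the bound: a constant that works for all `s`, `m` and `P`. -/
def HasCBCBound (b α : ℕ) (β : ℕ → ℝ) (p : ℝ) : Prop :=
  ∃ C : ℝ, 0 < C ∧ ∀ (s m : ℕ) (P : (ZMod b)[X]) (q : Fin (s * α) → (ZMod b)[X]), 1 ≤ m →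
    Irreducible P → P.natDegree = m → IsCBCVector m α P β q →
      searchCriterion m α P β q (s * α) ≤ C * ((b : ℝ) ^ m) ^ (-(1 / p))

theorem isResidueMap_mk {b m : ℕ} [Fact b.Prime] {P : (ZMod b)[X]} [Fact (Irreducible P)]
    (hP : P.natDegree = m) : IsResidueMap P m (AdjoinRoot.mk P) :=
  ⟨fun _ => AdjoinRoot.mk_eq_zero, AdjoinRoot.mk_surjective, hP, (Fact.out : Irreducible P).ne_zero⟩

theorem finite_adjoinRoot {b : ℕ} [Fact b.Prime] {P : (ZMod b)[X]} [Fact (Irreducible P)] :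
    Finite (AdjoinRoot P) := by
  have h := isResidueMap_mk (P := P) rfl
  refine Finite.of_surjective (fun k : Fin (b ^ P.natDegree) =>
    AdjoinRoot.mk P (digitPoly b P.natDegree k)) fun y => ?_
  obtain ⟨k, hk, hy⟩ := h.exists_digitPoly y
  exact ⟨⟨k, hk⟩, hy⟩

/-- Takes r-th roots of `searchCriterion_rpow_le`, with `2 / (N - 1) ≤ 4 / N` for `N ≥ 2`. The
constants `τ` and `M` must not depend on `s`, `m` and `P`. -/
theorem hasCBCBound_of_le {b α : ℕ} [Fact b.Prime] (hα : 2 ≤ α) {β : ℕ → ℝ} (hβ : ∀ j, 0 ≤ β j)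
    {p r τ M : ℝ} (h0 : 0 < r) (h1 : r ≤ 1) (hrp : r ≤ p) (hM : 0 ≤ M)
    (hτ : ∀ (m : ℕ) (P : (ZMod b)[X]) (F : Type) [Field F] [Fintype F] [DecidableEq F]
      (π : (ZMod b)[X] →+* F), IsResidueMap P m π →
        ∑ g, classSum m (((b : ℝ)⁻¹) ^ α) π g ^ r ≤ τ) (x : ℕ → ℝ)
    (hx : ∀ j, 0 ≤ x j) (hβx : ∀ j ν, 1 ≤ ν → ν ≤ α →
      ((1 + τ) ^ α - 1) * rowWeight (blockConst b α) α (β j) ν ^ r ≤ x j ^ ν / ν.factorial)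
    (hxM : ∀ s n, ∑ k ∈ Finset.range n, (k.factorial : ℝ) ^ r *
        ((∑ j ∈ Finset.range s, x j) ^ k / k.factorial) ≤ M) :
    HasCBCBound b α β p := by
  -- The summand 1 only makes the constant positive when `M = 0`.
  refine ⟨(4 * M) ^ (1 / r) + 1, by positivity, fun s m P q hm hP hPm hq => ?_⟩
  have hb := (Fact.out : b.Prime).one_lt
  have : Fact (Irreducible P) := ⟨hP⟩
  have := finite_adjoinRoot (P := P)
  let := Fintype.ofFinite (AdjoinRoot P)
  let := Classical.decEq (AdjoinRoot P)
  have h := isResidueMap_mk hPm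
  have hE := searchCriterion_rpow_le h hα hβ h0 h1 (hτ m P _ _ h) x hx hβx hq
  have hE0 : 0 ≤ searchCriterion m α P β q (s * α) := by
    rw [searchCriterion_eq h hα]
    exact Finset.sum_nonneg fun v _ => mul_nonneg (cbcWeight_nonneg hb (by omega) hβ v)
      (crossSum_nonneg (classSum_nonneg h (by positivity) (mul_inv_pow_lt_one hb hα)) _)
  rw [h.card_eq] at hE
  have hN2 : 2 ≤ b ^ m := hb.trans_le (Nat.le_self_pow (by omega) b)
  have hN : (2 : ℝ) ≤ (b : ℝ) ^ m := by exact_mod_cast hN2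
  set N : ℝ := (b : ℝ) ^ m with hNdef
  rw [Nat.cast_pow, ← hNdef] at hE
  have hE2 : searchCriterion m α P β q (s * α) ^ r ≤ 4 * M * N⁻¹ := by
    refine hE.trans ((mul_le_mul_of_nonneg_left (hxM s _) (div_nonneg zero_le_two (by linarith))).trans ?_)
    have : 2 / (N - 1) ≤ 4 * N⁻¹ := by
      rw [← div_eq_mul_inv, div_le_div_iff₀ (by linarith) (by linarith)]
      linarith
    calc 2 / (N - 1) * M ≤ 4 * N⁻¹ * M := mul_le_mul_of_nonneg_right this hM
      _ = _ := by ring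
  have hE3 : searchCriterion m α P β q (s * α) ≤ (4 * M) ^ (1 / r) * N ^ (-(1 / r)) := by
    have h2 := Real.rpow_le_rpow (Real.rpow_nonneg hE0 r) hE2 (one_div_nonneg.2 h0.le)
    rw [← Real.rpow_mul hE0, mul_one_div_cancel h0.ne', Real.rpow_one,
      Real.mul_rpow (by positivity) (by positivity), Real.inv_rpow (by linarith),
      ← Real.rpow_neg (by linarith)] at h2
    exact h2
  have hpow : N ^ (-(1 / r)) ≤ N ^ (-(1 / p)) := by
    refine Real.rpow_le_rpow_of_exponent_le (by linarith) ?_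
    exact neg_le_neg (one_div_le_one_div_of_le h0 hrp)
  refine hE3.trans ?_
  have hn : 0 ≤ N ^ (-(1 / p)) := Real.rpow_nonneg (by linarith) _
  calc (4 * M) ^ (1 / r) * N ^ (-(1 / r)) ≤ (4 * M) ^ (1 / r) * N ^ (-(1 / p)) :=
        mul_le_mul_of_nonneg_left hpow (by positivity)
    _ ≤ _ := by rw [add_mul, one_mul]; linarith

theorem mul_inv_pow_rpow_lt_one {b α : ℕ} (hb : 1 < b) {r : ℝ} (hr : 1 < α * r) :
    (b : ℝ) * (((b : ℝ)⁻¹) ^ α) ^ r < 1 := by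
  have hb' : (1 : ℝ) < b := by exact_mod_cast hb
  have e : (b : ℝ) * (((b : ℝ)⁻¹) ^ α) ^ r = (b : ℝ) ^ (1 - α * r) := by
    rw [inv_pow, Real.inv_rpow (by positivity), ← Real.rpow_natCast, ← Real.rpow_mul (by positivity),
      Real.rpow_sub (by positivity), Real.rpow_one, div_eq_mul_inv]
  rw [e]
  exact Real.rpow_lt_one_of_one_lt_of_neg hb' (by linarith)

theorem hasCBCBound_of_lt_one {b α : ℕ} [Fact b.Prime] (hα : 2 ≤ α) {β : ℕ → ℝ}
    (hβ : ∀ j, 0 ≤ β j) {p r : ℝ} (h0 : 0 < r) (h1 : r < 1) (hrp : r ≤ p) (hαr : 1 < α * r)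
    (hs : Summable fun j => β j ^ r) : HasCBCBound b α β p := by
  have hb := (Fact.out : b.Prime).one_lt
  have hρ1 := mul_inv_pow_lt_one hb hα
  have hρr := mul_inv_pow_rpow_lt_one hb hαr
  set ρ : ℝ := ((b : ℝ)⁻¹) ^ α with hρ
  have hρ0 : 0 ≤ ρ := by positivity
  set τ : ℝ := posSum b (ρ ^ r) + posSum b ρ ^ r with hτ
  have hτ0 : 0 ≤ τ := add_nonneg (posSum_nonneg (by omega) (Real.rpow_nonneg hρ0 r) hρr)
    (Real.rpow_nonneg (posSum_nonneg (by omega) hρ0 hρ1) r)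
  have hA : 0 ≤ (1 + τ) ^ α - 1 := by
    have := one_le_pow₀ (n := α) (by linarith : 1 ≤ 1 + τ)
    linarith
  set A : ℝ := (1 + τ) ^ α - 1 with hAdef
  have hB := (blockConst_pos hb (show 1 ≤ α by omega)).le
  set B : ℝ := blockConst b α with hBdef
  -- Large enough for every order `ν ≤ α`; the added 1 gives `c ≥ 1`, so that `c ≤ c ^ ν`.
  set c : ℝ := A * (B * 2) ^ r * α.factorial + 1 with hc
  have hc0 : 0 ≤ A * (B * 2) ^ r * α.factorial := by positivity
  have hx0 : ∀ j, 0 ≤ c * β j ^ r := fun j =>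
    mul_nonneg (by linarith) (Real.rpow_nonneg (hβ j) r)
  have hsx : Summable fun j => c * β j ^ r := hs.mul_left c
  set X : ℝ := ∑' j, c * β j ^ r with hX
  have hX0 : 0 ≤ X := tsum_nonneg hx0
  refine hasCBCBound_of_le hα hβ h0 h1.le hrp (τ := τ)
    (M := ∑' k : ℕ, (k.factorial : ℝ) ^ r * (X ^ k / k.factorial))
    (tsum_nonneg fun k => by positivity)
    (fun m P F _ _ _ π h => sum_classSum_rpow_le h hρ0 hρ1 h0 h1.le hρr) (fun j => c * β j ^ r) hx0
    (fun j ν hν hνα => ?_) fun s n => ?_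
  · have hw : rowWeight B α (β j) ν ≤ B * 2 * β j ^ ν := by
      rw [rowWeight, ← mul_assoc]
      refine mul_le_mul_of_nonneg_right (mul_le_mul_of_nonneg_left ?_ hB) (pow_nonneg (hβ j) ν)
      split_ifs <;> norm_num
    have hf : (ν.factorial : ℝ) ≤ α.factorial := by exact_mod_cast Nat.factorial_le hνα
    have hc1 : A * (B * 2) ^ r * ν.factorial ≤ c ^ ν := by
      calc A * (B * 2) ^ r * ν.factorial ≤ A * (B * 2) ^ r * α.factorial := by gcongr
        _ ≤ c := by linarith
        _ ≤ c ^ ν := le_self_pow₀ (by linarith) (by omega)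
    have hpow : (β j ^ ν) ^ r = (β j ^ r) ^ ν := by
      rw [← Real.rpow_natCast, ← Real.rpow_natCast, ← Real.rpow_mul (hβ j), ← Real.rpow_mul (hβ j),
        mul_comm]
    have hf0 : (0 : ℝ) < ν.factorial := by exact_mod_cast Nat.factorial_pos ν
    rw [le_div_iff₀ hf0]
    calc A * rowWeight B α (β j) ν ^ r * ν.factorial
        ≤ A * (B * 2 * β j ^ ν) ^ r * ν.factorial := by
          gcongr
          exact rowWeight_nonneg hB (hβ j) _ _
      _ = A * (B * 2) ^ r * ν.factorial * (β j ^ r) ^ ν := by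
          rw [Real.mul_rpow (by positivity) (pow_nonneg (hβ j) ν), hpow]; ring
      _ ≤ c ^ ν * (β j ^ r) ^ ν :=
          mul_le_mul_of_nonneg_right hc1 (pow_nonneg (Real.rpow_nonneg (hβ j) r) ν)
      _ = _ := by rw [mul_pow]
  · have hle : ∑ j ∈ Finset.range s, c * β j ^ r ≤ X :=
      hsx.sum_le_tsum _ fun j _ => hx0 j
    refine (Finset.sum_le_sum fun k _ => ?_).trans
      ((summable_factorial_rpow h1 hX0).sum_le_tsum (Finset.range n) fun k _ => by positivity)
    have := Finset.sum_nonneg fun j (_ : j ∈ Finset.range s) => hx0 j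
    gcongr

/-- With `r = 1` the factorials cancel and a geometric series in `X` remains, so constants matter.
The sum of `classSum` is exactly `1 / b`, and `((1 + 1/b)^2 - 1) * blockConst b 2 = B`. The choice
`x_j = 4 B β_j` makes `X < 1` the smallness condition, as `smallBound b = (4 B)⁻¹`. -/
theorem hasCBCBound_one {b : ℕ} [Fact b.Prime] {β : ℕ → ℝ} (hβ : ∀ j, 0 ≤ β j)
    (hs : Summable β) (hsmall : ∑' j, β j < smallBound b) : HasCBCBound b 2 β 1 := by
  have hb := (Fact.out : b.Prime).one_lt
  have hb' : (1 : ℝ) < b := by exact_mod_cast hb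
  have hρ1 := mul_inv_pow_lt_one hb le_rfl
  have hρ0 : (0 : ℝ) ≤ ((b : ℝ)⁻¹) ^ 2 := by positivity
  have hτ : posSum b (((b : ℝ)⁻¹) ^ 2) = 1 / b := by
    rw [posSum]
    have : (b : ℝ) - 1 ≠ 0 := by linarith
    field_simp
  have hsin := sin_pi_div_pos hb
  have hsin1 := Real.sin_le_one (Real.pi / b)
  set y : ℝ := 2 * Real.sin (Real.pi / b) with hy
  have hy0 : 0 < y := by linarith
  set Θ : ℝ := 3 + 2 / (b : ℝ) + (2 * (b : ℝ) + 1) / ((b : ℝ) - 1) with hΘ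
  have hΘ1 : 3 ≤ Θ := by
    have : 0 < (b : ℝ) - 1 := by linarith
    have h1 : 0 ≤ 2 / (b : ℝ) := by positivity
    have h2 : 0 ≤ (2 * (b : ℝ) + 1) / ((b : ℝ) - 1) := by positivity
    linarith
  set Mx : ℝ := max (2 / y ^ 2) (1 / y) with hMx
  have hMx1 : 1 / 2 ≤ Mx := by
    refine le_trans ?_ (le_max_right _ _)
    exact one_div_le_one_div_of_le hy0 (by linarith)
  have hwc : walshConst 2 b = Mx * Θ := by
    rw [walshConst, hMx, hΘ]
    simp [max_comm, hy]
  set B : ℝ := Mx * Θ * (2 + 1 / b) with hB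
  have hB1 : 1 ≤ B := by
    have h1 : 0 < 1 / (b : ℝ) := by positivity
    have h2 : 3 / 2 ≤ Mx * Θ := by nlinarith
    nlinarith
  have hbound : smallBound b = (4 * B)⁻¹ := by
    rw [smallBound, hB]
    congr 1
    ring
  have hx0 : ∀ j, 0 ≤ 4 * B * β j := fun j => mul_nonneg (by linarith) (hβ j)
  set X : ℝ := ∑' j, 4 * B * β j with hX
  have hX0 : 0 ≤ X := tsum_nonneg hx0
  have hX1 : X < 1 := by
    rw [hX, tsum_mul_left]
    rw [hbound] at hsmall
    calc 4 * B * ∑' j, β j < 4 * B * (4 * B)⁻¹ := by gcongr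
      _ = 1 := mul_inv_cancel₀ (by positivity)
  refine hasCBCBound_of_le le_rfl hβ one_pos le_rfl le_rfl (τ := 1 / b)
    (M := ∑' k : ℕ, X ^ k) (tsum_nonneg fun k => by positivity)
    (fun m P F _ _ _ π h => ?_) (fun j => 4 * B * β j) hx0 (fun j ν hν hνα => ?_) fun s n => ?_
  · simp only [Real.rpow_one]
    rw [sum_classSum h hρ0 hρ1, hτ]
  · have hA : ((1 + 1 / (b : ℝ)) ^ 2 - 1) * blockConst b 2 = B := by
      rw [blockConst, hwc, hB]
      simp only [Nat.reduceSub, Nat.reduceMul, Nat.reduceDiv, pow_one]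
      field_simp
      ring
    rw [Real.rpow_one, rowWeight, ← mul_assoc, hA]
    have hβj := hβ j
    -- The two requirements are `B β ≤ 4 B β` and, with the factor 2 at `ν = α`, `2 B β² ≤ 8 B² β²`;
    -- the latter uses `B ≥ 1`.
    have : ν = 1 ∨ ν = 2 := by omega
    rcases this with rfl | rfl
    · norm_num
      nlinarith [mul_nonneg (by linarith : 0 ≤ B) hβj]
    · norm_num [Nat.factorial]
      have h1 : B ≤ B * B := by nlinarith
      have h2 := mul_nonneg (by linarith : 0 ≤ B * B - B) (sq_nonneg (β j))
      nlinarith [sq_nonneg (B * β j)]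
  · have hsx : Summable fun j => 4 * B * β j := hs.mul_left _
    have hle : ∑ j ∈ Finset.range s, 4 * B * β j ≤ X := hsx.sum_le_tsum _ fun j _ => hx0 j
    refine (Finset.sum_le_sum fun k _ => ?_).trans
      ((summable_geometric_of_lt_one hX0 hX1).sum_le_tsum (Finset.range n) fun k _ => by positivity)
    have hk : (k.factorial : ℝ) ≠ 0 := by exact_mod_cast Nat.factorial_ne_zero k
    rw [Real.rpow_one, mul_div_cancel₀ _ hk]
    exact pow_le_pow_left₀ (Finset.sum_nonneg fun j _ => hx0 j) hle k

theorem hasCBCBound {b : ℕ} [Fact b.Prime] {p : ℝ} {β : ℕ → ℝ} {α : ℕ} (hp : 0 < p) (hp1 : p ≤ 1)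
    (hβ : ∀ j, 0 < β j) (hs : Summable fun j => β j ^ p)
    (hsmall : (∀ p' : ℝ, 0 < p' → p' < 1 → ¬ Summable fun j => β j ^ p') →
      ∑' j, β j < smallBound b) (hα : α = ⌊1 / p⌋₊ + 1) : HasCBCBound b α β p := by
  have hinv : 1 ≤ 1 / p := by rwa [le_div_iff₀ hp, one_mul]
  have hα2 : 2 ≤ α := by
    have : 1 ≤ ⌊1 / p⌋₊ := Nat.one_le_floor_iff _ |>.2 hinv
    omega
  have hβ0 := fun j => (hβ j).le
  rcases hp1.lt_or_eq with hlt | rfl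
  -- For `p < 1` take `r = p`; then `α p > 1` because `α` exceeds `1 / p`.
  · refine hasCBCBound_of_lt_one hα2 hβ0 hp hlt le_rfl ?_ hs
    have := Nat.lt_floor_add_one (1 / p)
    rw [div_lt_iff₀ hp] at this
    rw [hα]
    exact_mod_cast this
  · obtain rfl : α = 2 := by rw [hα]; norm_num
    simp only [Real.rpow_one] at hs
    by_cases hdiv : ∀ p' : ℝ, 0 < p' → p' < 1 → ¬ Summable fun j => β j ^ p'
    · exact hasCBCBound_one hβ0 hs (hsmall hdiv)
    · push Not at hdiv
      obtain ⟨p', hp0', hp1', hs'⟩ := hdiv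
      -- Any bound strictly between 1/2 and 1 would serve: `2 r > 1` is needed. Summability passes
      -- from `p'` to the larger `r` since `β j` tends to zero.
      set r : ℝ := max p' (3 / 4) with hr
      have hr1 : r < 1 := max_lt hp1' (by norm_num)
      have hr2 : 3 / 4 ≤ r := le_max_right _ _
      refine hasCBCBound_of_lt_one hα2 hβ0 (by linarith) hr1 hr1.le (by push_cast; linarith) ?_
      refine Summable.of_norm_bounded_eventually_nat hs' ?_
      have h0 := hs.tendsto_atTop_zero
      filter_upwards [h0.eventually (gt_mem_nhds one_pos)] with j hj
      rw [Real.norm_of_nonneg (Real.rpow_nonneg (hβ0 j) r)]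
      exact Real.rpow_le_rpow_of_exponent_ge (hβ j) hj.le (le_max_left _ _)


/-! ### One-dimensional discrete Walsh coefficients of smooth functions -/

/-- The primitive that appears in one summation by parts against `ζ ^ (y / h)`. -/
noncomputable def walshPrimitive (h : ℕ) (ζ : ℂ) (Φ : ℕ → ℂ) (x : ℕ) : ℂ :=
  ∑ y ∈ Finset.range x, ζ ^ (y / h) * Φ y

theorem walshPrimitive_mul_add {h : ℕ} {Φ : ℕ → ℂ} (hΦ : Function.Periodic Φ h) (ζ : ℂ) (k : ℕ) {t : ℕ}
    (ht : t ≤ h) : walshPrimitive h ζ Φ (h * k + t) =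
      (∑ i ∈ Finset.range k, ζ ^ i) * ∑ y ∈ Finset.range h, Φ y
        + ζ ^ k * ∑ y ∈ Finset.range t, Φ y := by
  have key : ∀ k t : ℕ, t ≤ h → walshPrimitive h ζ Φ (h * k + t) =
      walshPrimitive h ζ Φ (h * k) + ζ ^ k * ∑ y ∈ Finset.range t, Φ y := by
    intro k t ht
    rw [walshPrimitive, Finset.sum_range_add, walshPrimitive, Finset.mul_sum]
    congr 1
    refine Finset.sum_congr rfl fun y hy => ?_
    have hy : y < h := (Finset.mem_range.1 hy).trans_le ht
    rw [Nat.mul_add_div (by omega), Nat.div_eq_of_lt hy, add_zero, add_comm, mul_comm h,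
      ← smul_eq_mul k h, hΦ.nsmul k y]
  rw [key k t ht]
  congr 1
  clear ht
  induction k with
  | zero => simp [walshPrimitive]
  | succ k ih => rw [mul_add, mul_one, key k h le_rfl, ih, Finset.sum_range_succ, add_mul]

theorem sum_pow_eq_zero_of_pow_eq_one {b : ℕ} {ζ : ℂ} (hζ : ζ ^ b = 1) (h1 : ζ ≠ 1) :
    ∑ i ∈ Finset.range b, ζ ^ i = 0 := by
  rw [geom_sum_eq h1, hζ, sub_self, zero_div]

/-- Over `b` consecutive periods of `Φ` the weights `ζ ^ i` run through a full cycle and cancel. The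
same cancellation makes the primitive vanish at multiples of `h * b`, so summation by parts leaves
no boundary terms. -/
theorem walshPrimitive_periodic {b h : ℕ} {ζ : ℂ} {Φ : ℕ → ℂ} (hΦ : Function.Periodic Φ h)
    (hζ : ζ ^ b = 1) (h1 : ζ ≠ 1) (hh : 0 < h) :
    Function.Periodic (walshPrimitive h ζ Φ) (h * b) := by
  intro x
  have hx := (Nat.div_add_mod x h).symm
  have ht : x % h ≤ h := (Nat.mod_lt _ hh).le
  have hx' : x + h * b = h * (b + x / h) + x % h := by rw [mul_add]; omega
  rw [hx', walshPrimitive_mul_add hΦ ζ _ ht, pow_add, hζ, one_mul, Finset.sum_range_add,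
    sum_pow_eq_zero_of_pow_eq_one hζ h1, zero_add]
  conv_rhs => rw [hx, walshPrimitive_mul_add hΦ ζ _ ht]
  simp only [pow_add, hζ, one_mul]

theorem walshPrimitive_eq_zero_of_dvd {b h : ℕ} {ζ : ℂ} {Φ : ℕ → ℂ} (hΦ : Function.Periodic Φ h)
    (hζ : ζ ^ b = 1) (h1 : ζ ≠ 1) (hh : 0 < h) {x : ℕ} (hx : h * b ∣ x) :
    walshPrimitive h ζ Φ x = 0 := by
  obtain ⟨k, rfl⟩ := hx
  have h := (walshPrimitive_periodic hΦ hζ h1 hh).nsmul k 0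
  rw [zero_add, smul_eq_mul, mul_comm] at h
  rw [h, walshPrimitive, Finset.sum_range_zero]

theorem sum_range_mul {M : Type*} [AddCommMonoid M] (f : ℕ → M) (h b : ℕ) :
    ∑ x ∈ Finset.range (h * b), f x
      = ∑ k ∈ Finset.range b, ∑ t ∈ Finset.range h, f (h * k + t) := by
  induction b with
  | zero => simp
  | succ b ih => rw [mul_add, mul_one, Finset.sum_range_add, ih, Finset.sum_range_succ]

theorem sum_walshPrimitive {b h : ℕ} {ζ : ℂ} {Φ : ℕ → ℂ} (hΦ : Function.Periodic Φ h)
    (hζ : ζ ^ b = 1) (h1 : ζ ≠ 1) :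
    ∑ x ∈ Finset.range (h * b), walshPrimitive h ζ Φ x
      = (h * b : ℕ) * ((∑ y ∈ Finset.range h, Φ y) / (1 - ζ)) := by
  have h1' : 1 - ζ ≠ 0 := sub_ne_zero.2 (Ne.symm h1)
  have h0 : ζ - 1 ≠ 0 := sub_ne_zero.2 h1
  rw [sum_range_mul, Finset.sum_congr rfl fun k _ => Finset.sum_congr rfl fun t ht =>
    walshPrimitive_mul_add hΦ ζ k (Finset.mem_range.1 ht).le]
  simp only [Finset.sum_add_distrib, Finset.sum_const, Finset.card_range, nsmul_eq_mul,
    ← Finset.mul_sum, ← Finset.sum_mul, sum_pow_eq_zero_of_pow_eq_one hζ h1, geom_sum_eq h1,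
    ← Finset.sum_div, Finset.sum_sub_distrib]
  push_cast
  field_simp
  ring

/-- The deviation of a partial sum from linear interpolation does not see the constant `c`. It is at
most `2 t (h - t) σ / h`, hence `h σ / 2`. -/
theorem norm_partialSum_sub_le {h : ℕ} {Φ : ℕ → ℂ} {c : ℂ} {σ : ℝ} (hh : 0 < h)
    (hσ : ∀ x, ‖Φ x - c‖ ≤ σ) {t : ℕ} (ht : t ≤ h) :
    ‖∑ y ∈ Finset.range t, Φ y - (t / h : ℝ) * ∑ y ∈ Finset.range h, Φ y‖ ≤ h * σ / 2 := by
  obtain ⟨u, rfl⟩ := Nat.exists_eq_add_of_le ht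
  have hh' : (0 : ℝ) < ((t + u : ℕ) : ℝ) := by exact_mod_cast hh
  have hhC : ((t : ℂ) + u) ≠ 0 := by exact_mod_cast hh.ne'
  have hhR : ((t : ℝ) + u) ≠ 0 := by exact_mod_cast hh.ne'
  set a : ℂ := ∑ y ∈ Finset.range t, (Φ y - c) with ha
  set d : ℂ := ∑ y ∈ Finset.range u, (Φ (t + y) - c) with hd
  have han : ‖a‖ ≤ t * σ := by
    simpa only [Finset.sum_const, Finset.card_range, nsmul_eq_mul] using
      norm_sum_le_of_le (Finset.range t) fun y _ => hσ y
  have hdn : ‖d‖ ≤ u * σ := by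
    simpa only [Finset.sum_const, Finset.card_range, nsmul_eq_mul] using
      norm_sum_le_of_le (Finset.range u) fun y _ => hσ (t + y)
  have hσ0 : 0 ≤ σ := (norm_nonneg _).trans (hσ 0)
  have e : ∑ y ∈ Finset.range t, Φ y - (t / (t + u : ℕ) : ℝ) * ∑ y ∈ Finset.range (t + u), Φ y
      = ((u / (t + u : ℕ) : ℝ) : ℂ) * a - ((t / (t + u : ℕ) : ℝ) : ℂ) * d := by
    rw [Finset.sum_range_add, ha, hd, Finset.sum_sub_distrib, Finset.sum_sub_distrib]
    simp only [Finset.sum_const, Finset.card_range, nsmul_eq_mul]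
    push_cast
    field_simp
    ring
  have e' : ‖((u / (t + u : ℕ) : ℝ) : ℂ) * a - ((t / (t + u : ℕ) : ℝ) : ℂ) * d‖
      ≤ u / (t + u : ℕ) * (t * σ) + t / (t + u : ℕ) * (u * σ) := by
    refine (norm_sub_le _ _).trans ?_
    rw [norm_mul, norm_mul, Complex.norm_real, Complex.norm_real,
      Real.norm_of_nonneg (by positivity), Real.norm_of_nonneg (by positivity)]
    gcongr
  rw [e]
  refine e'.trans ?_
  have : (u : ℝ) / (t + u : ℕ) * (t * σ) + t / (t + u : ℕ) * (u * σ)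
      = 2 * (t * u) / (t + u) * σ := by push_cast; field_simp; ring
  rw [this]
  have : 2 * ((t : ℝ) * u) / (t + u) ≤ (t + u) / 2 := by
    rw [div_le_div_iff₀ (by positivity) two_pos]
    nlinarith [sq_nonneg ((t : ℝ) - u)]
  push_cast
  nlinarith

/-- The mean of `Φ` multiplies a convex combination of two geometric sums, each at most `2 / m`; the
oscillation enters only through `norm_partialSum_sub_le`. Keeping the two apart is what yields good
constants. -/
theorem norm_walshPrimitive_le {b h : ℕ} {ζ c : ℂ} {Φ : ℕ → ℂ} {σ μ m : ℝ}
    (hΦ : Function.Periodic Φ h) (hζ : ζ ^ b = 1) (hb : b ≠ 0) (hm : 0 < m) (hζm : m ≤ ‖1 - ζ‖)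
    (hh : 0 < h) (hμ : ‖∑ y ∈ Finset.range h, Φ y‖ ≤ h * μ) (hσ : ∀ x, ‖Φ x - c‖ ≤ σ) (x : ℕ) :
    ‖walshPrimitive h ζ Φ x‖ ≤ h * (2 * μ / m + σ / 2) := by
  have hh' : (0 : ℝ) < h := by exact_mod_cast hh
  have hn : ‖ζ‖ = 1 := Complex.norm_eq_one_of_pow_eq_one hζ hb
  have h1 : ζ ≠ 1 := by
    rintro rfl
    rw [sub_self, norm_zero] at hζm
    linarith
  have ht : x % h < h := Nat.mod_lt _ hh
  have hg : ∀ k : ℕ, ‖∑ i ∈ Finset.range k, ζ ^ i‖ ≤ 2 / m := by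
    intro k
    rw [geom_sum_eq h1, norm_div, norm_sub_rev ζ 1]
    refine div_le_div₀ zero_le_two ?_ hm hζm
    refine (norm_sub_le _ _).trans ?_
    rw [norm_pow, hn, one_pow, norm_one]
    norm_num
  have hθ0 : (0 : ℝ) ≤ (x % h : ℕ) / h := by positivity
  have hθ1 : ((x % h : ℕ) : ℝ) / h ≤ 1 := by
    rw [div_le_one hh']
    exact_mod_cast ht.le
  set θ : ℝ := ((x % h : ℕ) : ℝ) / h with hθ
  set T := ∑ y ∈ Finset.range h, Φ y with hT
  set k := x / h with hk
  have e : walshPrimitive h ζ Φ x = T * ((1 - θ : ℝ) * (∑ i ∈ Finset.range k, ζ ^ i)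
      + (θ : ℝ) * ∑ i ∈ Finset.range (k + 1), ζ ^ i)
      + ζ ^ k * (∑ y ∈ Finset.range (x % h), Φ y - (θ : ℝ) * T) := by
    conv_lhs => rw [← Nat.div_add_mod x h, walshPrimitive_mul_add hΦ ζ _ ht.le]
    rw [Finset.sum_range_succ]
    push_cast
    ring
  have h2 : ‖((1 - θ : ℝ) : ℂ) * (∑ i ∈ Finset.range k, ζ ^ i)
      + (θ : ℝ) * ∑ i ∈ Finset.range (k + 1), ζ ^ i‖ ≤ 2 / m := by
    refine (norm_add_le _ _).trans ?_
    rw [norm_mul, norm_mul, Complex.norm_real, Complex.norm_real, Real.norm_of_nonneg hθ0,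
      Real.norm_of_nonneg (sub_nonneg.2 hθ1)]
    have := mul_le_mul_of_nonneg_left (hg k) (sub_nonneg.2 hθ1)
    have := mul_le_mul_of_nonneg_left (hg (k + 1)) hθ0
    linarith
  rw [e]
  refine (norm_add_le _ _).trans ?_
  rw [norm_mul, norm_mul, norm_pow, hn, one_pow, one_mul]
  have h3 := norm_partialSum_sub_le hh hσ ht.le
  have h4 := mul_le_mul hμ h2 (norm_nonneg _) ((norm_nonneg _).trans hμ)
  have : (h : ℝ) * (2 * μ / m + σ / 2) = h * μ * (2 / m) + h * σ / 2 := by ring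
  rw [this]
  exact add_le_add h4 h3

/-- One summation by parts. -/
theorem sum_mul_eq_neg_sum_sub {L H : ℕ} {f g Ψ : ℕ → ℂ} (hL : H ∣ L)
    (hg : ∀ x, ¬ H ∣ x + 1 → g (x + 1) = g x) (hΨ : ∀ x, H ∣ x → Ψ x = 0) :
    ∑ x ∈ Finset.range L, f x * g x * (Ψ (x + 1) - Ψ x)
      = - ∑ x ∈ Finset.range L, (f x - f (x - 1)) * g x * Ψ x := by
  -- At `x = 0` the truncated `x - 1` is 0, which is harmless because `Ψ 0 = 0`.
  have h1 : ∑ x ∈ Finset.range L, f x * g x * Ψ (x + 1)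
      = ∑ x ∈ Finset.range L, f (x - 1) * g x * Ψ x := by
    have h2 := Finset.sum_range_succ' (fun x => f (x - 1) * g x * Ψ x) L
    rw [Finset.sum_range_succ, hΨ L hL, hΨ 0 (dvd_zero H), mul_zero, mul_zero, add_zero,
      add_zero] at h2
    rw [h2]
    refine Finset.sum_congr rfl fun x _ => ?_
    by_cases hx : H ∣ x + 1
    · rw [hΨ _ hx, mul_zero, mul_zero]
    · rw [hg x hx, Nat.add_sub_cancel]
  simp only [mul_sub, sub_mul, Finset.sum_sub_distrib, h1]
  ring

/-- The constants that arise from iterated summation by parts. -/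
noncomputable def partsConst (m : ℝ) : ℕ → ℝ → ℝ
  | 0, X => X
  | r + 1, X => partsConst m r (2 + m / 2 * X)

/-- The product of the powers `ζ_e` to the integer parts of `x / b ^ e`. -/
noncomputable def walshProd (b : ℕ) (ζ : ℕ → ℂ) (S : Finset ℕ) (x : ℕ) : ℂ := ∏ e ∈ S, ζ e ^ (x / b ^ e)

theorem norm_walshProd {b : ℕ} {ζ : ℕ → ℂ} {S : Finset ℕ} (hb : b ≠ 0) (hS : ∀ e ∈ S, ζ e ^ b = 1)
    (x : ℕ) : ‖walshProd b ζ S x‖ = 1 := by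
  rw [walshProd, norm_prod]
  refine Finset.prod_eq_one fun e he => ?_
  rw [norm_pow, Complex.norm_eq_one_of_pow_eq_one (hS e he) hb, one_pow]

theorem walshProd_succ {b : ℕ} {ζ : ℕ → ℂ} {S : Finset ℕ} {e x : ℕ} (hS : ∀ i ∈ S, e ≤ i)
    (hx : ¬ b ^ e ∣ x + 1) : walshProd b ζ S (x + 1) = walshProd b ζ S x := by
  refine Finset.prod_congr rfl fun i hi => ?_
  rw [Nat.succ_div, if_neg fun h => hx ((pow_dvd_pow b (hS i hi)).trans h), add_zero]

theorem hasDerivWithinAt_sub_shift {f f' : ℝ → ℂ} {a h : ℝ} (hh : 0 ≤ h)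
    (hf : ∀ t ∈ Set.Icc a 1, HasDerivWithinAt f (f' t) (Set.Icc a 1) t) {t : ℝ}
    (ht : t ∈ Set.Icc (a + h) 1) :
    HasDerivWithinAt (fun t => f t - f (t - h)) (f' t - f' (t - h)) (Set.Icc (a + h) 1) t := by
  have h1 : HasDerivWithinAt f (f' t) (Set.Icc (a + h) 1) t :=
    (hf t ⟨by linarith [ht.1], ht.2⟩).mono (Set.Icc_subset_Icc_left (by linarith))
  have hmaps : Set.MapsTo (fun u => u - h) (Set.Icc (a + h) 1) (Set.Icc a 1) :=
    fun u hu => ⟨by linarith [hu.1], by linarith [hu.2]⟩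
  have h2 := (hf (t - h) (hmaps ht)).scomp t ((hasDerivWithinAt_id t _).sub_const h) hmaps
  rw [one_smul] at h2
  exact h1.sub h2

theorem norm_sub_shift_le {f f' : ℝ → ℂ} {a h B : ℝ} (hh : 0 ≤ h)
    (hf : ∀ t ∈ Set.Icc a 1, HasDerivWithinAt f (f' t) (Set.Icc a 1) t)
    (hB : ∀ t ∈ Set.Icc a 1, ‖f' t‖ ≤ B) {t : ℝ} (ht : t ∈ Set.Icc (a + h) 1) :
    ‖f t - f (t - h)‖ ≤ h * B := by
  have h1 := (convex_Icc a 1).norm_image_sub_le_of_norm_hasDerivWithin_le hf hB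
    (x := t - h) (y := t) ⟨by linarith [ht.1], by linarith [ht.2]⟩ ⟨by linarith [ht.1], ht.2⟩
  rw [sub_sub_cancel, Real.norm_of_nonneg hh] at h1
  linarith

/-- Iterated summation by parts. -/
theorem norm_sum_walshProd_le {b M : ℕ} (hb : 0 < b) (ζ : ℕ → ℂ) {m : ℝ} (hm : 0 < m) (r : ℕ) :
    ∀ (S T : Finset ℕ) (D : ℕ → ℝ → ℂ) (Φ : ℕ → ℂ) (a e₀ : ℕ) (μ X B : ℝ) (c : ℂ),
      (∀ e ∈ S, e < M ∧ ζ e ^ b = 1 ∧ m ≤ ‖1 - ζ e‖) → T ⊆ S → T.card = r → (∀ e ∈ S, e₀ ≤ e) →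
      Function.Periodic Φ (b ^ e₀) → ‖∑ y ∈ Finset.range (b ^ e₀), Φ y‖ ≤ (b ^ e₀ : ℕ) * μ →
      (∀ x, ‖Φ x - c‖ ≤ μ * X) → (r = 0 → ∀ x, ‖Φ x‖ ≤ μ * X) → (∀ x < a, Φ x = 0) →
      (∀ i < r, ∀ t ∈ Set.Icc ((a : ℝ) / b ^ M) 1,
        HasDerivWithinAt (D i) (D (i + 1) t) (Set.Icc ((a : ℝ) / b ^ M) 1) t) →
      (∀ t ∈ Set.Icc ((a : ℝ) / b ^ M) 1, ‖D r t‖ ≤ B) → 0 ≤ B → 0 ≤ μ → 0 ≤ X →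
      ‖∑ x ∈ Finset.range (b ^ M), D 0 (x / b ^ M) * walshProd b ζ S x * Φ x‖
        ≤ b ^ M * (B * (∏ e ∈ T, ((b : ℝ) ^ e / b ^ M)) * (μ / m ^ r * partsConst m r X)) := by
  have hL : (0 : ℝ) < (b : ℝ) ^ M := by positivity
  induction r with
  | zero =>
    intro S T D Φ a e₀ μ X B c hS hTS hT _ _ _ _ hX ha _ hB hB0 hμ0 hX0
    rw [Finset.card_eq_zero] at hT
    subst hT
    have h1 : ∀ x ∈ Finset.range (b ^ M),
        ‖D 0 (x / b ^ M) * walshProd b ζ S x * Φ x‖ ≤ B * (μ * X) := by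
      intro x hx
      rw [norm_mul, norm_mul, norm_walshProd hb.ne' fun e he => (hS e he).2.1, mul_one]
      by_cases hxa : x < a
      · rw [ha x hxa, norm_zero, mul_zero]
        positivity
      · refine mul_le_mul (hB _ ⟨?_, ?_⟩) (hX rfl x) (norm_nonneg _) hB0
        · gcongr
          omega
        · rw [div_le_one hL]
          exact_mod_cast (Finset.mem_range.1 hx).le
    have h2 := norm_sum_le_of_le _ h1
    rw [Finset.sum_const, Finset.card_range, nsmul_eq_mul] at h2
    simpa [partsConst] using h2
  | succ r ih =>
    intro S T D Φ a e₀ μ X B c hS hTS hT he₀ hΦ hμ hX _ ha hD hB hB0 hμ0 hX0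
    have hTne : T.Nonempty := by rw [← Finset.card_pos]; omega
    have hSne : S.Nonempty := hTne.mono hTS
    -- Summation by parts must remove the finest remaining level of `S`, while the gain is claimed
    -- for the levels in `T`. Since `e` is at most the least element `e₁` of `T`, the gain `b ^ e`
    -- is at least as good as `b ^ e₁`.
    set e := S.min' hSne with he
    have heS : e ∈ S := S.min'_mem hSne
    obtain ⟨heM, hζ, hζm⟩ := hS e heS
    have h1 : ζ e ≠ 1 := by
      intro h
      rw [h, sub_self, norm_zero] at hζm
      linarith
    set h := b ^ e with hh
    have hh0 : 0 < h := by positivity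
    have hhb : h * b = b ^ (e + 1) := by rw [pow_succ]
    obtain ⟨n, hn⟩ := pow_dvd_pow b (he₀ e heS)
    have hΦh : Function.Periodic Φ h := by
      rw [hh, hn, mul_comm, ← smul_eq_mul]
      exact hΦ.nsmul n
    have hμh : ‖∑ y ∈ Finset.range h, Φ y‖ ≤ h * μ := by
      rw [hh, hn, sum_range_mul]
      have : ∀ k ∈ Finset.range n, ∑ t ∈ Finset.range (b ^ e₀), Φ (b ^ e₀ * k + t)
          = ∑ t ∈ Finset.range (b ^ e₀), Φ t := by
        refine fun k _ => Finset.sum_congr rfl fun t _ => ?_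
        rw [add_comm, mul_comm, ← smul_eq_mul, hΦ.nsmul k t]
      rw [Finset.sum_congr rfl this, Finset.sum_const, Finset.card_range, nsmul_eq_mul, norm_mul,
        Complex.norm_natCast]
      calc (n : ℝ) * ‖∑ t ∈ Finset.range (b ^ e₀), Φ t‖ ≤ n * ((b ^ e₀ : ℕ) * μ) := by gcongr
        _ = _ := by push_cast; ring
    set Ψ := walshPrimitive h (ζ e) Φ with hΨ
    -- Each summation by parts replaces `D` by a backward difference with the mesh as step, and the
    -- mean value inequality trades it for one derivative.
    set D' : ℕ → ℝ → ℂ := fun i t => D i t - D i (t - 1 / b ^ M) with hD'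
    have hshift : ((a + 1 : ℕ) : ℝ) / b ^ M = a / b ^ M + 1 / b ^ M := by push_cast; ring
    have h0 : (0 : ℝ) ≤ 1 / b ^ M := by positivity
    set e₁ := T.min' hTne with he₁
    have he₁T : e₁ ∈ T := T.min'_mem hTne
    have hee₁ : e ≤ e₁ := S.min'_le _ (hTS he₁T)
    have hSe : ∀ i ∈ S.erase e, e + 1 ≤ i := fun i hi => by
      have := S.min'_le i (Finset.mem_of_mem_erase hi)
      have := Finset.ne_of_mem_erase hi
      omega
    -- The primitive has mean at most `h μ / m` and size at most `h (2 μ / m + μ X / 2)`, which is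
    -- `(h μ / m) (2 + (m / 2) X)`. This is the recursion in `partsConst`.
    have key := ih (S.erase e) (T.erase e₁) D' Ψ (a + 1) (e + 1) (h * μ / m) (2 + m / 2 * X)
      (1 / b ^ M * B) 0 (fun i hi => hS i (Finset.mem_of_mem_erase hi))
      (fun i hi => by
        have hi' := Finset.mem_of_mem_erase hi
        refine Finset.mem_erase.2 ⟨?_, hTS hi'⟩
        rintro rfl
        exact Finset.ne_of_mem_erase hi (le_antisymm hee₁ (T.min'_le _ hi')))
      (by rw [Finset.card_erase_of_mem he₁T, hT, Nat.add_sub_cancel]) hSe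
      (by rw [← hhb]; exact walshPrimitive_periodic hΦh hζ h1 hh0)
      (by
        rw [← hhb, sum_walshPrimitive hΦh hζ h1, norm_mul, Complex.norm_natCast, norm_div]
        gcongr)
      (fun x => by
        rw [sub_zero]
        refine (norm_walshPrimitive_le hΦh hζ hb.ne' hm hζm hh0 hμh hX x).trans_eq ?_
        field_simp)
      (fun _ x => by
        refine (norm_walshPrimitive_le hΦh hζ hb.ne' hm hζm hh0 hμh hX x).trans_eq ?_
        field_simp)
      -- The difference needs `t - 1 / b ^ M` in the domain, so its domain shrinks by one mesh
      -- width; the primitive vanishes at one more grid point in compensation.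
      (fun x hx => Finset.sum_eq_zero fun y hy => by
        rw [ha y (by have := Finset.mem_range.1 hy; omega), mul_zero])
      (fun i hi t ht => by
        rw [hshift] at ht ⊢
        exact hasDerivWithinAt_sub_shift h0 (hD i (by omega)) ht)
      (fun t ht => by
        rw [hshift] at ht
        exact norm_sub_shift_le h0 (hD r (by omega)) hB ht)
      (by positivity) (by positivity) (by positivity)
    have hsum : ∑ x ∈ Finset.range (b ^ M), D 0 (x / b ^ M) * walshProd b ζ S x * Φ x
        = - ∑ x ∈ Finset.range (b ^ M), D' 0 (x / b ^ M) * walshProd b ζ (S.erase e) x * Ψ x := by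
      have h2 := sum_mul_eq_neg_sum_sub (L := b ^ M) (H := h * b)
        (f := fun x => D 0 (x / b ^ M)) (g := walshProd b ζ (S.erase e)) (Ψ := Ψ)
        (by rw [hhb]; exact pow_dvd_pow b heM)
        (fun x hx => walshProd_succ hSe (by rwa [← hhb]))
        (fun x hx => walshPrimitive_eq_zero_of_dvd hΦh hζ h1 hh0 hx)
      calc _ = ∑ x ∈ Finset.range (b ^ M), D 0 (x / b ^ M) * walshProd b ζ (S.erase e) x
              * (Ψ (x + 1) - Ψ x) := by
            refine Finset.sum_congr rfl fun x _ => ?_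
            have h3 : Ψ (x + 1) - Ψ x = ζ e ^ (x / b ^ e) * Φ x := by
              rw [hΨ, walshPrimitive, walshPrimitive, Finset.sum_range_succ, add_sub_cancel_left]
            rw [h3, walshProd, ← Finset.mul_prod_erase S _ heS, walshProd]
            ring
        _ = _ := by
            rw [h2]
            congr 1
            refine Finset.sum_congr rfl fun x _ => ?_
            rcases x with _ | x
            · rw [hΨ, walshPrimitive, Finset.sum_range_zero, mul_zero, mul_zero]
            · simp only [hD', Nat.add_sub_cancel]
              congr 4
              push_cast
              ring
    rw [hsum, norm_neg]
    refine key.trans ?_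
    rw [← Finset.mul_prod_erase T _ he₁T]
    have hpc : 0 ≤ partsConst m r (2 + m / 2 * X) := by
      have : ∀ (r : ℕ) (X : ℝ), 0 ≤ X → 0 ≤ partsConst m r X := by
        intro r
        induction r with
        | zero => exact fun X h => h
        | succ r ih => exact fun X h => ih _ (by positivity)
      exact this _ _ (by positivity)
    have hpow : (b : ℝ) ^ e ≤ (b : ℝ) ^ e₁ := pow_le_pow_right₀ (by exact_mod_cast hb) hee₁
    have hprod : 0 ≤ ∏ i ∈ T.erase e₁, ((b : ℝ) ^ i / b ^ M) := by positivity
    calc _ = (b : ℝ) ^ M * (B * ((b : ℝ) ^ e / b ^ M * ∏ i ∈ T.erase e₁, ((b : ℝ) ^ i / b ^ M))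
          * (μ / m ^ (r + 1) * partsConst m r (2 + m / 2 * X))) := by
            rw [hh, pow_succ m]; push_cast; field_simp
      _ ≤ _ := by
        rw [partsConst]
        gcongr


/-! ### From iterated summation by parts to the constant `walshConst`. -/

theorem two_sin_le_norm_one_sub_stdAddChar {b : ℕ} [NeZero b] {k : ZMod b} (hk : k ≠ 0) :
    2 * Real.sin (Real.pi / b) ≤ ‖1 - ZMod.stdAddChar k‖ := by
  have hb : (0 : ℝ) < b := by exact_mod_cast Nat.pos_of_ne_zero (NeZero.ne b)
  have hk1 : (1 : ℝ) ≤ k.val := by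
    exact_mod_cast Nat.one_le_iff_ne_zero.2 ((ZMod.val_ne_zero k).2 hk)
  have hk2 : (k.val : ℝ) + 1 ≤ b := by exact_mod_cast ZMod.val_lt k
  have hpi := Real.pi_pos
  have e : (ZMod.stdAddChar k : ℂ) = Complex.exp (Complex.I * ((2 * Real.pi * k.val / b : ℝ) : ℂ)) := by
    rw [ZMod.stdAddChar_apply, ZMod.toCircle_apply]
    congr 1
    push_cast
    ring
  rw [norm_sub_rev, e, Complex.norm_exp_I_mul_ofReal_sub_one]
  have h2 : 2 * Real.pi * k.val / b / 2 = Real.pi * k.val / b := by ring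
  rw [h2]
  refine le_trans ?_ (le_abs_self _)
  have h3 : Real.pi / b ≤ Real.pi * k.val / b := by
    gcongr
    nlinarith
  have h4 : Real.pi * k.val / b ≤ Real.pi - Real.pi / b := by
    have : Real.pi - Real.pi / b = Real.pi * (b - 1) / b := by field_simp
    rw [this]
    gcongr
    linarith
  have h5 : 0 < Real.pi / b := by positivity
  refine mul_le_mul_of_nonneg_left ?_ zero_le_two
  rcases le_total (Real.pi * k.val / b) (Real.pi / 2) with h | h
  · exact Real.sin_le_sin_of_le_of_le_pi_div_two (by linarith) h h3
  · rw [← Real.sin_pi_sub (Real.pi * k.val / b)]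
    exact Real.sin_le_sin_of_le_of_le_pi_div_two (by linarith) (by linarith) (by linarith)

theorem partsConst_le_add {m : ℝ} (hm0 : 0 ≤ m) (hm : m ≤ 2) (r : ℕ) :
    ∀ X : ℝ, 0 ≤ X → partsConst m r X ≤ X + 2 * r := by
  induction r with
  | zero => intro X _; simp [partsConst]
  | succ r ih =>
    intro X hX
    have h := ih (2 + m / 2 * X) (by positivity)
    rw [partsConst]
    push_cast
    nlinarith

theorem partsConst_le_of_le {m Y : ℝ} (hm0 : 0 ≤ m) (hY : 2 + m / 2 * Y ≤ Y) (r : ℕ) :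
    ∀ X : ℝ, X ≤ Y → partsConst m r X ≤ Y := by
  induction r with
  | zero => exact fun X h => h
  | succ r ih =>
    intro X hX
    refine ih _ (le_trans ?_ hY)
    gcongr

/-- For `b = 2, 3` each step adds at most 2, while the right side is at least `7 (1 + (α - 2) / 3)`
by Bernoulli. For `b ≥ 5` the map `X ↦ 2 + (m / 2) X` keeps values below `5 + 5 / b`, since `sin (π
/ b) ≤ 3.15 / b`. -/
theorem partsConst_le {b α r : ℕ} (hb : b.Prime) (hα : 2 ≤ α) (hr : r ≤ α) :
    partsConst (2 * Real.sin (Real.pi / b)) r 0 ≤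
      (1 + 1 / (b : ℝ) + 1 / ((b : ℝ) * (b + 1))) ^ (α - 2)
        * (3 + 2 / (b : ℝ) + (2 * (b : ℝ) + 1) / ((b : ℝ) - 1)) := by
  have hs := sin_pi_div_pos hb.one_lt
  have hb' : (1 : ℝ) < b := by exact_mod_cast hb.one_lt
  have hb1 : (0 : ℝ) < (b : ℝ) - 1 := by linarith
  have hbb : 0 ≤ 1 / ((b : ℝ) * (b + 1)) := by positivity
  rcases lt_or_ge b 4 with h4 | h4
  · refine (partsConst_le_add (by positivity) (by linarith [Real.sin_le_one (Real.pi / b)]) r 0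
      le_rfl).trans ?_
    obtain ⟨n, rfl⟩ := Nat.exists_eq_add_of_le hα
    rw [Nat.add_sub_cancel_left]
    have hr' : (r : ℝ) ≤ 2 + n := by exact_mod_cast hr
    have hn : (0 : ℝ) ≤ n := n.cast_nonneg
    have hbern : 1 + (n : ℝ) * (1 / 3) ≤ (1 + 1 / (b : ℝ) + 1 / ((b : ℝ) * (b + 1))) ^ n := by
      refine (one_add_mul_le_pow (by norm_num) n).trans (pow_le_pow_left₀ (by norm_num) ?_ n)
      have h3 : (b : ℝ) ≤ 3 := by exact_mod_cast Nat.lt_succ_iff.1 h4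
      have : 1 / 3 ≤ 1 / (b : ℝ) := by gcongr
      linarith
    have h7 : 7 ≤ 3 + 2 / (b : ℝ) + (2 * (b : ℝ) + 1) / ((b : ℝ) - 1) := by
      have := hb.two_le
      interval_cases b <;> norm_num
    nlinarith [mul_le_mul hbern h7 (by norm_num) (by positivity)]
  · have h5 : 5 ≤ b := by
      rcases h4.eq_or_lt with rfl | h
      · exact absurd hb (by norm_num)
      · exact h
    have h5' : (5 : ℝ) ≤ b := by exact_mod_cast h5
    set u : ℝ := 1 / b with hu
    have hu0 : 0 < u := by positivity
    have hu5 : u ≤ 1 / 5 := by rw [hu]; gcongr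
    have hsin : Real.sin (Real.pi / b) ≤ 3.15 * u := by
      refine (Real.sin_le (by positivity)).trans ?_
      rw [hu, mul_one_div]
      have := Real.pi_lt_d2
      gcongr
    have hY : 2 + 2 * Real.sin (Real.pi / b) / 2 * (5 + 5 * u) ≤ 5 + 5 * u := by
      have := mul_le_mul_of_nonneg_right hsin (by positivity : 0 ≤ 5 + 5 * u)
      nlinarith
    refine (partsConst_le_of_le (by positivity) hY r 0 (by positivity)).trans ?_
    have hΘ : 5 + 5 * u ≤ 3 + 2 / (b : ℝ) + (2 * (b : ℝ) + 1) / ((b : ℝ) - 1) := by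
      have h1 : (2 * (b : ℝ) + 1) / ((b : ℝ) - 1) = 2 + 3 / ((b : ℝ) - 1) := by field_simp; ring
      have h2 : 3 * u ≤ 3 / ((b : ℝ) - 1) := by
        rw [hu, mul_one_div]
        gcongr
        linarith
      have h3 : 2 / (b : ℝ) = 2 * u := by rw [hu, mul_one_div]
      linarith
    refine hΘ.trans (le_mul_of_one_le_left (by linarith) (one_le_pow₀ ?_))
    linarith

/-- The bound for a one-dimensional Walsh coefficient; `T` is a set of at most `α` levels at which
the digits of the wave number do not vanish. -/
theorem norm_sum_walsh_le {b M α : ℕ} [Fact b.Prime] (hα : 2 ≤ α) {k : ℕ → ZMod b}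
    {S T : Finset ℕ} (hS : ∀ e ∈ S, e < M ∧ k e ≠ 0) (hTS : T ⊆ S) (hT : T.card ≤ α)
    (D : ℕ → ℝ → ℂ) {B : ℝ} (hB : 0 ≤ B)
    (hD : ∀ i < T.card, ∀ t ∈ Set.Icc (0 : ℝ) 1,
      HasDerivWithinAt (D i) (D (i + 1) t) (Set.Icc 0 1) t)
    (hDB : ∀ t ∈ Set.Icc (0 : ℝ) 1, ‖D T.card t‖ ≤ B) :
    ‖∑ x ∈ Finset.range (b ^ M),
        D 0 (x / b ^ M) * walshProd b (fun e => ZMod.stdAddChar (k e)) S x‖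
      ≤ b ^ M * (B * ((if T.Nonempty then walshConst α b else 1)
        * ∏ e ∈ T, ((b : ℝ) ^ e / b ^ M))) := by
  have hb : b.Prime := Fact.out
  have hs := sin_pi_div_pos hb.one_lt
  have hS' : ∀ e ∈ S, e < M ∧ (ZMod.stdAddChar (k e) : ℂ) ^ b = 1 ∧
      2 * Real.sin (Real.pi / b) ≤ ‖1 - (ZMod.stdAddChar (k e) : ℂ)‖ := fun e he =>
    ⟨(hS e he).1, by rw [← AddChar.map_nsmul_eq_pow, nsmul_eq_mul, CharP.cast_eq_zero, zero_mul,
      AddChar.map_zero_eq_one], two_sin_le_norm_one_sub_stdAddChar (hS e he).2⟩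
  -- The start is `Φ = c = 1`, whose oscillation is zero: hence `X = 0`, except for empty `T`, where
  -- `X` bounds `Φ` itself.
  have h := norm_sum_walshProd_le hb.pos (fun e => (ZMod.stdAddChar (k e) : ℂ))
    (by positivity : 0 < 2 * Real.sin (Real.pi / b)) T.card S T D (fun _ => 1) 0 0 1
    (if T.card = 0 then 1 else 0) B 1 hS' hTS rfl (fun _ _ => Nat.zero_le _) (fun _ => rfl)
    (by simp) (fun x => by simp; split_ifs <;> norm_num) (fun h0 x => by simp [h0])
    (fun x hx => absurd hx (Nat.not_lt_zero _)) (by simpa using hD) (by simpa using hDB) hB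
    zero_le_one (by split_ifs <;> norm_num)
  simp only [mul_one] at h
  refine h.trans ?_
  rw [mul_assoc B, mul_comm (Finset.prod _ _)]
  have hp : 0 ≤ ∏ e ∈ T, ((b : ℝ) ^ e / b ^ M) := by positivity
  gcongr
  rcases T.eq_empty_or_nonempty with rfl | hTn
  · simp [partsConst]
  · have hc : T.card ≠ 0 := hTn.card_ne_zero
    rw [if_pos hTn, if_neg hc]
    refine le_trans ?_ (le_walshConst hb.one_lt α (Nat.one_le_iff_ne_zero.2 hc) hT)
    have h1 := partsConst_le hb hα hT
    have h2 : (1 : ℝ) ≤ if T.card = α then 2 else 1 := by split_ifs <;> norm_num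
    have hb1 : (0 : ℝ) < (b : ℝ) - 1 := by
      have : (1 : ℝ) < b := by exact_mod_cast hb.one_lt
      linarith
    calc _ ≤ 1 * (1 / (2 * Real.sin (Real.pi / b)) ^ T.card)
          * ((1 + 1 / (b : ℝ) + 1 / ((b : ℝ) * (b + 1))) ^ (α - 2)
            * (3 + 2 / (b : ℝ) + (2 * (b : ℝ) + 1) / ((b : ℝ) - 1))) := by
            rw [one_mul]; gcongr
      _ ≤ (if T.card = α then 2 else 1) * (1 / (2 * Real.sin (Real.pi / b)) ^ T.card)
          * ((1 + 1 / (b : ℝ) + 1 / ((b : ℝ) * (b + 1))) ^ (α - 2)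
            * (3 + 2 / (b : ℝ) + (2 * (b : ℝ) + 1) / ((b : ℝ) - 1))) := by gcongr
      _ = _ := by ring


/-! ### Multi-dimensional discrete Walsh coefficients -/

/-- The coordinates in `J` are summed over the grid `{0, 1 / L, …, (L - 1) / L}` against `φ`, the
others are fixed. -/
noncomputable def gridSum {s : ℕ} (L : ℕ) (φ : Fin s → ℕ → ℂ) (J : Finset (Fin s))
    (G : (Fin s → ℝ) → ℂ) (y : Fin s → ℝ) : ℂ :=
  ∑ x ∈ Fintype.piFinset fun j => if j ∈ J then Finset.range L else {0},
    G (fun j => if j ∈ J then (x j : ℝ) / L else y j) * ∏ j ∈ J, φ j (x j)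

theorem gridSum_empty {s : ℕ} (L : ℕ) (φ : Fin s → ℕ → ℂ) (G : (Fin s → ℝ) → ℂ) (y : Fin s → ℝ) :
    gridSum L φ ∅ G y = G y := by
  simp [gridSum]

theorem gridSum_insert {s : ℕ} (L : ℕ) (φ : Fin s → ℕ → ℂ) {J : Finset (Fin s)} {j : Fin s}
    (hj : j ∉ J) (G : (Fin s → ℝ) → ℂ) (y : Fin s → ℝ) :
    gridSum L φ (insert j J) G y =
      ∑ t ∈ Finset.range L, gridSum L φ J G (Function.update y j (t / L)) * φ j t := by
  simp only [gridSum, Finset.sum_mul]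
  rw [← Finset.sum_product']
  refine Finset.sum_nbij' (fun x => (x j, Function.update x j 0)) (fun z => Function.update z.2 j z.1)
    ?_ ?_ ?_ ?_ ?_
  · intro x hx
    rw [Fintype.mem_piFinset] at hx
    refine Finset.mem_product.2 ⟨by simpa using hx j, Fintype.mem_piFinset.2 fun i => ?_⟩
    rcases eq_or_ne i j with rfl | hi
    · simp [hj]
    · simpa [hi] using hx i
  · intro z hz
    rw [Finset.mem_product, Fintype.mem_piFinset] at hz
    refine Fintype.mem_piFinset.2 fun i => ?_
    rcases eq_or_ne i j with rfl | hi
    · simpa using hz.1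
    · simpa [hi] using hz.2 i
  · intro x _
    simp
  · intro z hz
    rw [Finset.mem_product, Fintype.mem_piFinset] at hz
    have h := hz.2 j
    rw [if_neg hj, Finset.mem_singleton] at h
    ext1
    · simp
    · simp [← h]
  · intro x _
    rw [Finset.prod_insert hj, mul_comm (φ j (x j)), ← mul_assoc]
    congr 2
    · congr 1
      ext i
      rcases eq_or_ne i j with rfl | hi
      · simp [hj]
      · simp [hi]
    · refine Finset.prod_congr rfl fun i hi => ?_
      simp [Function.update_of_ne (ne_of_mem_of_not_mem hi hj)]

theorem gridSum_univ {s : ℕ} (L : ℕ) (φ : Fin s → ℕ → ℂ) (G : (Fin s → ℝ) → ℂ) (y : Fin s → ℝ) :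
    gridSum L φ Finset.univ G y = ∑ x ∈ Fintype.piFinset fun _ => Finset.range L,
      G (fun j => (x j : ℝ) / L) * ∏ j, φ j (x j) := by
  simp [gridSum]

theorem update_mem_Icc {s : ℕ} {y : Fin s → ℝ} (hy : y ∈ Set.Icc (0 : Fin s → ℝ) 1) (j : Fin s)
    {t : ℝ} (ht : t ∈ Set.Icc (0 : ℝ) 1) : Function.update y j t ∈ Set.Icc (0 : Fin s → ℝ) 1 := by
  constructor <;> intro i <;> rcases eq_or_ne i j with rfl | hi
  · simpa using ht.1
  · simpa [hi] using hy.1 i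
  · simpa using ht.2
  · simpa [hi] using hy.2 i

theorem div_mem_Icc {L t : ℕ} (ht : t < L) : (t : ℝ) / L ∈ Set.Icc (0 : ℝ) 1 :=
  ⟨by positivity, div_le_one_of_le₀ (by exact_mod_cast ht.le) (by positivity)⟩

theorem hasDerivWithinAt_gridSum {s α L : ℕ} {F : (Fin s → ℝ) → ℝ}
    {D : (Fin s → ℕ) → (Fin s → ℝ) → ℝ} (hD : HasMixedPartials α F D) (φ : Fin s → ℕ → ℂ)
    {J : Finset (Fin s)} {j : Fin s} (hj : j ∉ J) {ν : Fin s → ℕ} (hν : ∀ i, ν i ≤ α)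
    (hνj : ν j < α) {y : Fin s → ℝ} (hy : y ∈ Set.Icc (0 : Fin s → ℝ) 1) {t : ℝ}
    (ht : t ∈ Set.Icc (0 : ℝ) 1) :
    HasDerivWithinAt (fun t => gridSum L φ J (fun y => (D ν y : ℂ)) (Function.update y j t))
      (gridSum L φ J (fun y => (D (ν + Pi.single j 1) y : ℂ)) (Function.update y j t))
      (Set.Icc 0 1) t := by
  simp only [gridSum]
  refine HasDerivWithinAt.fun_sum fun x hx => HasDerivWithinAt.mul_const ?_ _
  rw [Fintype.mem_piFinset] at hx
  set w : Fin s → ℝ := fun i => if i ∈ J then (x i : ℝ) / L else y i with hw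
  have hwm : w ∈ Set.Icc (0 : Fin s → ℝ) 1 := by
    have : ∀ i, w i ∈ Set.Icc (0 : ℝ) 1 := by
      intro i
      by_cases hi : i ∈ J
      · have := hx i
        rw [if_pos hi, Finset.mem_range] at this
        simp only [hw, if_pos hi]
        exact div_mem_Icc this
      · simp only [hw, if_neg hi]
        exact ⟨hy.1 i, hy.2 i⟩
    exact ⟨fun i => (this i).1, fun i => (this i).2⟩
  have e : ∀ u : ℝ, (fun i => if i ∈ J then (x i : ℝ) / L else Function.update y j u i)
      = Function.update w j u := by
    intro u
    ext i
    rcases eq_or_ne i j with rfl | hi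
    · simp [hj]
    · simp [hi, hw]
  simp only [e]
  have h := hD.2 ν j hν hνj (Function.update w j t) (update_mem_Icc hwm j ht)
  simp only [Function.update_idem, Function.update_self] at h
  exact h.ofReal_comp

/-- Coordinates are summed one at a time. The one-dimensional bound applies to the sum over the
earlier coordinates as a function of `y_j`, whose derivatives are the same sums for `D (ν + i e_j)`.
The factorial bound enters once, with `r j` derivatives in each variable. -/
theorem norm_gridSum_le {s α L : ℕ} {F : (Fin s → ℝ) → ℝ} {D : (Fin s → ℕ) → (Fin s → ℝ) → ℝ}
    (hD : HasMixedPartials α F D) {c : ℝ} (hc : 0 < c) {β : ℕ → ℝ} (hβ : ∀ j, 0 < β j)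
    (hbound : ∀ ν : Fin s → ℕ, (∀ j, ν j ≤ α) → ∀ y ∈ Set.Icc (0 : Fin s → ℝ) 1,
      |D ν y| ≤ c * ((∑ j, ν j).factorial : ℝ) * ∏ j : Fin s, β j ^ ν j)
    (φ : Fin s → ℕ → ℂ) (r : Fin s → ℕ) (hr : ∀ j, r j ≤ α) (A : Fin s → ℝ) (hA : ∀ j, 0 ≤ A j)
    (hφ : ∀ j (f : ℕ → ℝ → ℂ) (B : ℝ), 0 ≤ B →
      (∀ i < r j, ∀ t ∈ Set.Icc (0 : ℝ) 1, HasDerivWithinAt (f i) (f (i + 1) t) (Set.Icc 0 1) t) →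
      (∀ t ∈ Set.Icc (0 : ℝ) 1, ‖f (r j) t‖ ≤ B) →
      ‖∑ x ∈ Finset.range L, f 0 (x / L) * φ j x‖ ≤ L * (B * A j)) (J : Finset (Fin s)) :
    ∀ ν : Fin s → ℕ, (∀ i, ν i ≤ α) → (∀ j ∈ J, ν j = 0) → ∀ y ∈ Set.Icc (0 : Fin s → ℝ) 1,
      ‖gridSum L φ J (fun y => (D ν y : ℂ)) y‖ ≤ (L : ℝ) ^ J.card *
        ((∏ j ∈ J, A j) * (c * ((∑ j, if j ∈ J then r j else ν j).factorial : ℝ)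
          * ∏ j : Fin s, β j ^ (if j ∈ J then r j else ν j))) := by
  induction J using Finset.induction_on with
  | empty =>
    intro ν hν _ y hy
    rw [gridSum_empty, Complex.norm_real, Real.norm_eq_abs]
    simpa using hbound ν hν y hy
  | insert j J hj ih =>
    intro ν hν hνJ y hy
    have hνj : ν j = 0 := hνJ j (Finset.mem_insert_self _ _)
    have hν0 : ∀ i ≤ α, ∀ k, (ν + Pi.single j i : Fin s → ℕ) k ≤ α := by
      intro i hi k
      rcases eq_or_ne k j with rfl | hk
      · simpa [hνj] using hi
      · simpa [hk] using hν k
    rw [gridSum_insert L φ hj]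
    set B : ℝ := (L : ℝ) ^ J.card *
        ((∏ j ∈ J, A j) * (c * ((∑ i, if i ∈ insert j J then r i else ν i).factorial : ℝ)
          * ∏ i : Fin s, β i ^ (if i ∈ insert j J then r i else ν i))) with hB
    have hB0 : 0 ≤ B := by
      have h1 : 0 ≤ ∏ j ∈ J, A j := Finset.prod_nonneg fun j _ => hA j
      have h2 : 0 ≤ ∏ i : Fin s, β i ^ (if i ∈ insert j J then r i else ν i) :=
        Finset.prod_nonneg fun i _ => pow_nonneg (hβ i).le _
      positivity
    have h := hφ j (fun i t => gridSum L φ J (fun y => (D (ν + Pi.single j i) y : ℂ))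
      (Function.update y j t)) B hB0
      (fun i hi t ht => by
        have h1 := hasDerivWithinAt_gridSum (L := L) hD φ hj
          (hν0 i (hi.le.trans (hr j))) (by simpa [hνj] using hi.trans_le (hr j)) hy ht
        rwa [add_assoc, ← Pi.single_add] at h1)
      (fun t ht => by
        refine (ih _ (hν0 _ (hr j)) (fun i hi => ?_) _ (update_mem_Icc hy j ht)).trans_eq ?_
        · have : i ≠ j := ne_of_mem_of_not_mem hi hj
          simp [this, hνJ i (Finset.mem_insert_of_mem hi)]
        · have e : ∀ i, (if i ∈ J then r i else (ν + Pi.single j (r j) : Fin s → ℕ) i)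
              = if i ∈ insert j J then r i else ν i := by
            intro i
            rcases eq_or_ne i j with rfl | hi
            · simp [hj, hνj]
            · simp [hi]
          simp only [e, hB])
    simp only [Pi.single_zero, add_zero] at h
    refine h.trans_eq ?_
    rw [hB, Finset.card_insert_of_notMem hj, Finset.prod_insert hj]
    ring

theorem norm_sum_grid_le {s α L : ℕ} {F : (Fin s → ℝ) → ℝ} {D : (Fin s → ℕ) → (Fin s → ℝ) → ℝ}
    (hD : HasMixedPartials α F D) {c : ℝ} (hc : 0 < c) {β : ℕ → ℝ} (hβ : ∀ j, 0 < β j)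
    (hbound : ∀ ν : Fin s → ℕ, (∀ j, ν j ≤ α) → ∀ y ∈ Set.Icc (0 : Fin s → ℝ) 1,
      |D ν y| ≤ c * ((∑ j, ν j).factorial : ℝ) * ∏ j : Fin s, β j ^ ν j)
    (φ : Fin s → ℕ → ℂ) (r : Fin s → ℕ) (hr : ∀ j, r j ≤ α) (A : Fin s → ℝ) (hA : ∀ j, 0 ≤ A j)
    (hφ : ∀ j (f : ℕ → ℝ → ℂ) (B : ℝ), 0 ≤ B →
      (∀ i < r j, ∀ t ∈ Set.Icc (0 : ℝ) 1, HasDerivWithinAt (f i) (f (i + 1) t) (Set.Icc 0 1) t) →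
      (∀ t ∈ Set.Icc (0 : ℝ) 1, ‖f (r j) t‖ ≤ B) →
      ‖∑ x ∈ Finset.range L, f 0 (x / L) * φ j x‖ ≤ L * (B * A j)) :
    ‖∑ x ∈ Fintype.piFinset fun _ => Finset.range L,
        (F (fun j => (x j : ℝ) / L) : ℂ) * ∏ j, φ j (x j)‖
      ≤ (L : ℝ) ^ s * ((∏ j, A j) * (c * ((∑ j, r j).factorial : ℝ) * ∏ j : Fin s, β j ^ r j)) := by
  have h := norm_gridSum_le hD hc hβ hbound φ r hr A hA hφ Finset.univ 0 (fun _ => Nat.zero_le _)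
    (fun _ _ => rfl) 0 ⟨le_rfl, fun _ => zero_le_one⟩
  rw [gridSum_univ] at h
  simp only [Finset.mem_univ, if_true, Finset.card_univ, Fintype.card_fin] at h
  refine le_of_eq_of_le ?_ h
  congr 1
  refine Finset.sum_congr rfl fun x hx => ?_
  rw [hD.1]
  rw [Fintype.mem_piFinset] at hx
  exact ⟨fun j => (div_mem_Icc (Finset.mem_range.1 (hx j))).1,
    fun j => (div_mem_Icc (Finset.mem_range.1 (hx j))).2⟩


/-! ### Laurent series and the dual net -/

section Laurent

variable {b : ℕ}

theorem laurentOfPoly_mul (f g : (ZMod b)[X]) :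
    laurentOfPoly (f * g) = laurentOfPoly f * laurentOfPoly g := map_mul _ f g

theorem laurentOfPoly_X_pow (a : ℕ) :
    laurentOfPoly (Polynomial.X ^ a : (ZMod b)[X]) = HahnSeries.single (-(a : ℤ)) 1 := by
  rw [laurentOfPoly, map_pow, Polynomial.aeval_X, HahnSeries.single_pow, one_pow]
  congr 1
  simp

theorem laurentOfPoly_C (c : ZMod b) :
    laurentOfPoly (Polynomial.C c : (ZMod b)[X]) = HahnSeries.single 0 c := by
  rw [laurentOfPoly, Polynomial.aeval_C]
  exact RingHom.congr_fun (Subsingleton.elim _ (HahnSeries.C : ZMod b →+* LaurentSeries (ZMod b))) c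

theorem laurentOfPoly_coeff (f : (ZMod b)[X]) (n : ℤ) :
    (laurentOfPoly f).coeff n = if n ≤ 0 then f.coeff (-n).toNat else 0 := by
  induction f using Polynomial.induction_on' with
  | add f g hf hg =>
    have : laurentOfPoly (f + g) = laurentOfPoly f + laurentOfPoly g := map_add _ f g
    rw [this, HahnSeries.coeff_add, hf, hg, Polynomial.coeff_add]
    split_ifs <;> simp
  | monomial a c =>
    rw [← Polynomial.C_mul_X_pow_eq_monomial, laurentOfPoly_mul, laurentOfPoly_C,
      laurentOfPoly_X_pow, HahnSeries.coeff_single_mul, sub_zero, HahnSeries.coeff_single,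
      Polynomial.coeff_C_mul, Polynomial.coeff_X_pow]
    by_cases h : n = -(a : ℤ)
    · rw [if_pos h, if_pos (by omega), if_pos (by omega)]
    · rw [if_neg h, mul_zero]
      split_ifs <;> first | rfl | (exfalso; omega) | simp

theorem laurentOfPoly_ne_zero {f : (ZMod b)[X]} (hf : f ≠ 0) : laurentOfPoly f ≠ 0 := by
  intro h
  apply hf
  ext n
  have := congrArg (fun g : LaurentSeries (ZMod b) => g.coeff (-(n : ℤ))) h
  simpa [laurentOfPoly_coeff] using this

theorem laurentOfPoly_order {f : (ZMod b)[X]} (hf : f ≠ 0) :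
    (laurentOfPoly f).order = -(f.natDegree : ℤ) := by
  refine le_antisymm (HahnSeries.order_le_of_coeff_ne_zero ?_) ?_
  · rw [laurentOfPoly_coeff, if_pos (by omega)]
    simpa using hf
  · have h : (laurentOfPoly f).coeff (laurentOfPoly f).order ≠ 0 := fun h =>
      laurentOfPoly_ne_zero hf (HahnSeries.coeff_order_eq_zero.1 h)
    rw [laurentOfPoly_coeff] at h
    split_ifs at h with h0
    · have := Polynomial.le_natDegree_of_ne_zero h
      omega
    · exact absurd rfl h

variable [Fact b.Prime]

/-- The coefficient of `x⁻¹` in `f / P`, as an additive map in `f`. -/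
noncomputable def residueHom (P : (ZMod b)[X]) : (ZMod b)[X] →+ ZMod b :=
  AddMonoidHom.mk' (fun f => (laurentOfPoly f / laurentOfPoly P).coeff 1) fun f g => by
    have : laurentOfPoly (f + g) = laurentOfPoly f + laurentOfPoly g := map_add _ f g
    rw [this, add_div, HahnSeries.coeff_add]

theorem residueHom_apply (P f : (ZMod b)[X]) :
    residueHom P f = (laurentOfPoly f / laurentOfPoly P).coeff 1 := rfl

theorem residueHom_C_mul (P f : (ZMod b)[X]) (c : ZMod b) :
    residueHom P (Polynomial.C c * f) = c * residueHom P f := by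
  rw [residueHom_apply, residueHom_apply, laurentOfPoly_mul, laurentOfPoly_C, mul_div_assoc,
    HahnSeries.coeff_single_mul, sub_zero]

theorem residueHom_X_pow_mul (P f : (ZMod b)[X]) (a : ℕ) :
    residueHom P (Polynomial.X ^ a * f)
      = (laurentOfPoly f / laurentOfPoly P).coeff ((a + 1 : ℕ) : ℤ) := by
  rw [residueHom_apply, laurentOfPoly_mul, laurentOfPoly_X_pow, mul_div_assoc,
    HahnSeries.coeff_single_mul, one_mul]
  congr 1
  push_cast
  ring

theorem residueHom_eq_zero_of_dvd {P f : (ZMod b)[X]} (hP : P ≠ 0) (h : P ∣ f) :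
    residueHom P f = 0 := by
  obtain ⟨g, rfl⟩ := h
  rw [residueHom_apply, laurentOfPoly_mul, mul_div_cancel_left₀ _ (laurentOfPoly_ne_zero hP),
    laurentOfPoly_coeff, if_neg (by norm_num)]

/-- Nondegeneracy of the residue pairing. A nonzero remainder `R` of `G` makes `R / P` start at
`x^(-k)` with `k = deg P - deg R ≥ 1`; multiplication by `X ^ (k - 1)` moves this coefficient to
`x⁻¹`. -/
theorem dvd_of_residueHom_eq_zero {P G : (ZMod b)[X]} (hP : P ≠ 0)
    (h : ∀ f, residueHom P (f * G) = 0) : P ∣ G := by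
  rw [← EuclideanDomain.mod_eq_zero]
  by_contra hR
  set R := G % P with hRdef
  have hdeg : R.natDegree < P.natDegree ∨ P.natDegree = 0 := by
    by_cases h0 : P.natDegree = 0
    · exact Or.inr h0
    · exact Or.inl (Polynomial.natDegree_mod_lt G h0)
  have hdeg : R.natDegree < P.natDegree := by
    refine hdeg.resolve_right fun h0 => hR ?_
    rw [hRdef, EuclideanDomain.mod_eq_zero]
    exact (Polynomial.isUnit_iff_degree_eq_zero.2
      (by rw [Polynomial.degree_eq_natDegree hP, h0]; rfl)).dvd
  have hR0 : ∀ f, residueHom P (f * R) = 0 := by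
    intro f
    have e : f * R = f * G - P * (f * (G / P)) := by
      have := EuclideanDomain.div_add_mod G P
      rw [← hRdef] at this
      linear_combination f * this
    rw [e, map_sub, h f, residueHom_eq_zero_of_dvd hP (dvd_mul_right _ _), sub_zero]
  have hq : laurentOfPoly R / laurentOfPoly P ≠ 0 :=
    div_ne_zero (laurentOfPoly_ne_zero hR) (laurentOfPoly_ne_zero hP)
  have hord := HahnSeries.order_mul hq (laurentOfPoly_ne_zero hP)
  rw [div_mul_cancel₀ _ (laurentOfPoly_ne_zero hP), laurentOfPoly_order hR,
    laurentOfPoly_order hP] at hord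
  have hc : (laurentOfPoly R / laurentOfPoly P).coeff (laurentOfPoly R / laurentOfPoly P).order ≠ 0 :=
    fun h => hq (HahnSeries.coeff_order_eq_zero.1 h)
  apply hc
  have e : (laurentOfPoly R / laurentOfPoly P).order
      = ((P.natDegree - R.natDegree - 1 + 1 : ℕ) : ℤ) := by omega
  rw [e, ← residueHom_X_pow_mul, hR0]

/-- The residue of `f G / P` depends on `f` modulo `P` only, so the summand is an additive character
of `F`. It is nontrivial when `P` does not divide `G`. -/
theorem sum_stdAddChar_residueHom {m : ℕ} {P G : (ZMod b)[X]} {F : Type} [Field F] [Finite F]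
    {π : (ZMod b)[X] →+* F} (h : IsResidueMap P m π) (hG : ¬ P ∣ G) :
    ∑ n ∈ Finset.range (b ^ m), (ZMod.stdAddChar (residueHom P (digitPoly b m n * G)) : ℂ) = 0 := by
  have := Fintype.ofFinite F
  have hker : ∀ f g, π f = π g → residueHom P (f * G) = residueHom P (g * G) := by
    intro f g hfg
    rw [← sub_eq_zero, ← map_sub, ← sub_mul]
    refine residueHom_eq_zero_of_dvd h.ne_zero (Dvd.dvd.mul_right ?_ _)
    rw [← h.eq_zero_iff, map_sub, hfg, sub_self]
  set σ := Function.surjInv h.surjective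
  have hσ : ∀ y, π (σ y) = y := Function.surjInv_eq h.surjective
  let Λ : F →+ ZMod b := AddMonoidHom.mk' (fun y => residueHom P (σ y * G)) fun x y => by
    rw [← map_add, ← add_mul]
    exact hker _ _ (by rw [map_add, hσ, hσ, hσ])
  have hΛ : ∀ f, Λ (π f) = residueHom P (f * G) := fun f => hker _ _ (hσ _)
  have hne : (ZMod.stdAddChar.compAddMonoidHom Λ : AddChar F ℂ) ≠ 0 := by
    intro h0
    refine hG (dvd_of_residueHom_eq_zero h.ne_zero fun f => ?_)
    rw [← hΛ]
    apply ZMod.injective_stdAddChar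
    rw [AddChar.map_zero_eq_one, ← AddChar.compAddMonoidHom_apply, h0, AddChar.zero_apply]
  have key := h.sum_range_digitPoly fun y => (ZMod.stdAddChar.compAddMonoidHom Λ : AddChar F ℂ) y
  rw [AddChar.sum_eq_zero_iff_ne_zero.2 hne] at key
  simpa only [AddChar.compAddMonoidHom_apply, hΛ] using key

/-- Multiplication by `X ^ a` brings the coefficient of `x^(-a-1)` to `x⁻¹`, so pairing the digits
of `ℓ` with those of the points is taking a residue. The cast to `ZMod b` reduces each quotient to a
digit. -/
theorem residueHom_mul_sum_digitPoly {m : ℕ} (P f : (ZMod b)[X]) {ι : Type*} [Fintype ι]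
    (ℓ : ι → ℕ) (q : ι → (ZMod b)[X]) :
    residueHom P (f * ∑ c, digitPoly b m (ℓ c) * q c)
      = ∑ c, ∑ a ∈ Finset.range m, ((ℓ c / b ^ a : ℕ) : ZMod b)
        * (laurentOfPoly (f * q c) / laurentOfPoly P).coeff ((a + 1 : ℕ) : ℤ) := by
  rw [Finset.mul_sum, map_sum]
  refine Finset.sum_congr rfl fun c _ => ?_
  have e : f * (digitPoly b m (ℓ c) * q c) = ∑ a ∈ Finset.range m,
      Polynomial.C ((ℓ c / b ^ a : ℕ) : ZMod b) * (Polynomial.X ^ a * (f * q c)) := by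
    rw [digitPoly, Finset.sum_mul, Finset.mul_sum]
    refine Finset.sum_congr rfl fun a _ => ?_
    rw [ZMod.natCast_mod]
    ring
  rw [e, map_sum]
  refine Finset.sum_congr rfl fun a _ => ?_
  rw [residueHom_C_mul, residueHom_X_pow_mul]

end Laurent

/-! ### Digits of the interlaced points -/

section Points

variable {b : ℕ} [Fact b.Prime]

theorem digit_vMap (m : ℕ) (Y : LaurentSeries (ZMod b)) (a : ℕ) :
    digit b (vMap m Y) (a + 1) = if a < m then (Y.coeff ((a + 1 : ℕ) : ℤ)).val else 0 := by
  have hb := (Fact.out : b.Prime)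
  have hb0 : (b : ℝ) ≠ 0 := by exact_mod_cast hb.ne_zero
  set Z : ℕ := ∑ r ∈ Finset.range m, (Y.coeff ((m - r : ℕ) : ℤ)).val * b ^ r with hZ
  have hv : vMap m Y = Z / (b : ℝ) ^ m := by
    rw [vMap, hZ, ← Finset.sum_range_reflect, Finset.range_eq_Ico, ← Finset.Ico_add_one_right_eq_Icc,
      Finset.sum_Ico_eq_sum_range, Nat.add_sub_cancel]
    push_cast
    rw [Finset.sum_div, ← Finset.range_eq_Ico]
    refine Finset.sum_congr rfl fun r hr => ?_
    have hr := Finset.mem_range.1 hr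
    have e1 : m - (m - 1 - r) = 1 + r := by omega
    rw [e1, inv_pow, mul_div_assoc]
    congr 1
    rw [eq_div_iff (by positivity), inv_mul_eq_iff_eq_mul₀ (by positivity), ← pow_add]
    congr 1
    omega
  rw [digit, hv]
  split_ifs with ha
  · have e : (Z : ℝ) / (b : ℝ) ^ m * (b : ℝ) ^ (a + 1) = (Z : ℝ) / ((b ^ (m - 1 - a) : ℕ) : ℝ) := by
      push_cast
      rw [div_mul_eq_mul_div, div_eq_div_iff (by positivity) (by positivity), mul_assoc, ← pow_add]
      congr 2
      omega
    rw [e, Nat.floor_div_natCast, Nat.floor_natCast, hZ,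
      digit_sum_digits hb.pos m _ (fun r _ => ZMod.val_lt _) (by omega)]
    congr 3
    omega
  · have e : (Z : ℝ) / (b : ℝ) ^ m * (b : ℝ) ^ (a + 1) = ((Z * b ^ (a - m) * b : ℕ) : ℝ) := by
      push_cast
      rw [div_mul_eq_mul_div, div_eq_iff (by positivity), mul_assoc, mul_assoc, ← pow_succ',
        ← pow_add]
      congr 2
      omega
    rw [e, Nat.floor_natCast, Nat.mul_mod_left]

/-- The numerator of a coordinate of an interlaced point with respect to the denominator
`b ^ (α * M)`. -/
noncomputable def pointNum (m M : ℕ) {α : ℕ} (Y : Fin α → LaurentSeries (ZMod b)) : ℕ :=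
  ∑ r ∈ Finset.range (α * M), (if h : 0 < α then digit b
    (vMap m (Y ⟨(α * M - 1 - r) % α, Nat.mod_lt _ h⟩)) ((α * M - 1 - r) / α + 1) else 0) * b ^ r

theorem digit_lt (x : ℝ) (a : ℕ) : digit b x a < b := Nat.mod_lt _ (Fact.out : b.Prime).pos

theorem pointNum_lt (m M : ℕ) {α : ℕ} (Y : Fin α → LaurentSeries (ZMod b)) :
    pointNum m M Y < b ^ (α * M) := by
  refine sum_digits_lt (Fact.out : b.Prime).pos _ _ fun r _ => ?_
  split_ifs
  · exact digit_lt _ _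
  · exact (Fact.out : b.Prime).pos

theorem pointNum_digit (m M : ℕ) {α : ℕ} (Y : Fin α → LaurentSeries (ZMod b)) (i : Fin α) {a : ℕ}
    (ha : a < M) : ((pointNum m M Y / b ^ (α * M - 1 - (α * a + i)) : ℕ) : ZMod b)
      = if a < m then (Y i).coeff ((a + 1 : ℕ) : ℤ) else 0 := by
  have hα : 0 < α := i.pos
  have hp : α * a + i < α * M := by
    calc α * a + i < α * a + α := by omega
      _ = α * (a + 1) := by ring
      _ ≤ α * M := by gcongr; omega
  have e : α * M - 1 - (α * M - 1 - (α * a + i)) = α * a + i := by omega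
  have e1 : (α * a + (i : ℕ)) % α = i := by rw [Nat.mul_add_mod, Nat.mod_eq_of_lt i.2]
  have e2 : (α * a + (i : ℕ)) / α = a := by
    rw [Nat.mul_add_div hα, Nat.div_eq_of_lt i.2, add_zero]
  rw [← ZMod.natCast_mod, pointNum, digit_sum_digits (Fact.out : b.Prime).pos _ _ (fun r _ => ?_)
    (by omega), dif_pos hα]
  · simp only [e, e1, e2, digit_vMap]
    split_ifs
    · rw [ZMod.natCast_zmod_val]
    · rw [Nat.cast_zero]
  · rw [dif_pos hα]
    exact digit_lt _ _

theorem interlace_vMap {m M : ℕ} (hmM : m ≤ M) {α : ℕ} (Y : Fin α → LaurentSeries (ZMod b)) :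
    interlace b (fun i => vMap m (Y i)) = (pointNum m M Y : ℝ) / (b : ℝ) ^ (α * M) := by
  have hb0 : (b : ℝ) ≠ 0 := by exact_mod_cast (Fact.out : b.Prime).ne_zero
  rcases Nat.eq_zero_or_pos α with rfl | hα
  · simp [interlace, pointNum]
  rw [interlace, tsum_eq_sum (s := Finset.range M) fun a ha => ?_]
  · rw [pointNum, ← Finset.sum_range_reflect _ (α * M)]
    push_cast
    rw [Finset.sum_div, sum_range_mul]
    refine Finset.sum_congr rfl fun a ha => ?_
    have ha := Finset.mem_range.1 ha
    rw [Finset.sum_range]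
    refine Finset.sum_congr rfl fun i _ => ?_
    have hp : α * a + i < α * M := by
      calc α * a + i < α * a + α := by omega
        _ = α * (a + 1) := by ring
        _ ≤ α * M := by gcongr; omega
    have e : α * M - 1 - (α * M - 1 - (α * a + i)) = α * a + i := by omega
    have e1 : (α * a + (i : ℕ)) % α = i := by rw [Nat.mul_add_mod, Nat.mod_eq_of_lt i.2]
    have e2 : (α * a + (i : ℕ)) / α = a := by
      rw [Nat.mul_add_div hα, Nat.div_eq_of_lt i.2, add_zero]
    rw [dif_pos hα]
    simp only [e, e1, e2]
    rw [inv_pow, mul_div_assoc]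
    congr 1
    rw [eq_div_iff (by positivity), inv_mul_eq_iff_eq_mul₀ (by positivity), ← pow_add]
    congr 1
    rw [mul_comm a α]
    omega
  · rw [Finset.mem_range] at ha
    refine Finset.sum_eq_zero fun i _ => ?_
    rw [digit_vMap, if_neg (by omega), Nat.cast_zero, zero_mul]

end Points

/-! ### Orthogonality -/

theorem sum_stdAddChar_digits {b : ℕ} [Fact b.Prime] (n : ℕ) (t : ℕ → ZMod b) :
    ∑ ℓ ∈ Finset.range (b ^ n),
        (ZMod.stdAddChar (∑ a ∈ Finset.range n, ((ℓ / b ^ a : ℕ) : ZMod b) * t a) : ℂ)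
      = if ∀ a < n, t a = 0 then (b : ℂ) ^ n else 0 := by
  have hb := (Fact.out : b.Prime)
  induction n with
  | zero => simp
  | succ n ih =>
    have h1 : ∀ k ∈ Finset.range b, ∀ r ∈ Finset.range (b ^ n),
        (ZMod.stdAddChar (∑ a ∈ Finset.range (n + 1),
          (((b ^ n * k + r) / b ^ a : ℕ) : ZMod b) * t a) : ℂ)
        = ZMod.stdAddChar ((k : ZMod b) * t n)
          * ZMod.stdAddChar (∑ a ∈ Finset.range n, ((r / b ^ a : ℕ) : ZMod b) * t a) := by
      intro k _ r hr
      rw [Finset.sum_range_succ, add_comm, AddChar.map_add_eq_mul]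
      congr 2
      · rw [Nat.mul_add_div (Nat.pow_pos hb.pos), Nat.div_eq_of_lt (Finset.mem_range.1 hr), add_zero]
      · refine Finset.sum_congr rfl fun a ha => ?_
        have ha := Finset.mem_range.1 ha
        have hba : 0 < b ^ a := Nat.pow_pos hb.pos
        obtain ⟨d, rfl⟩ := Nat.exists_eq_add_of_lt ha
        have e : b ^ (a + d + 1) * k + r = b ^ a * (b * (b ^ d * k)) + r := by ring
        rw [e, Nat.mul_add_div hba]
        push_cast
        rw [CharP.cast_eq_zero, zero_mul, zero_add]
    rw [pow_succ, sum_range_mul, Finset.sum_congr rfl fun k hk => Finset.sum_congr rfl (h1 k hk)]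
    simp only [← Finset.mul_sum, ih, ← Finset.sum_mul]
    have h2 : ∑ k ∈ Finset.range b, (ZMod.stdAddChar ((k : ZMod b) * t n) : ℂ)
        = if t n = 0 then (b : ℂ) else 0 := by
      have h3 : ∑ k ∈ Finset.range b, (ZMod.stdAddChar ((k : ZMod b) * t n) : ℂ)
          = ∑ y : ZMod b, ZMod.stdAddChar (y * t n) := by
        refine Finset.sum_nbij' (fun k => (k : ZMod b)) ZMod.val (by simp)
          (fun y _ => Finset.mem_range.2 (ZMod.val_lt y))
          (fun k hk => ZMod.val_cast_of_lt (Finset.mem_range.1 hk)) (by simp) (by simp)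
      rw [h3, AddChar.sum_mulShift _ (ZMod.isPrimitive_stdAddChar b), ZMod.card]
      push_cast
      rfl
    rw [h2]
    have h4 : (∀ a < n + 1, t a = 0) ↔ t n = 0 ∧ ∀ a < n, t a = 0 := by
      constructor
      · exact fun h => ⟨h n (by omega), fun a ha => h a (by omega)⟩
      · rintro ⟨h, h'⟩ a ha
        rcases (Nat.lt_succ_iff_lt_or_eq.1 ha) with h0 | rfl
        · exact h' a h0
        · exact h
    simp only [h4, ite_and]
    split_ifs <;> ring


/-! ### Walsh coefficients with interlaced wave numbers -/

section Block

variable {b α M : ℕ} [Fact b.Prime]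

/-- The pairing of the digits of the wave numbers `ℓ 0, …, ℓ (α - 1)` with those of the numerator `x`
of an interlaced number. -/
def blockPhase (b α M : ℕ) (ℓ : ℕ → ℕ) (x : ℕ) : ZMod b :=
  ∑ i ∈ Finset.range α, ∑ a ∈ Finset.range M,
    ((ℓ i / b ^ a : ℕ) : ZMod b) * ((x / b ^ (α * M - 1 - (α * a + i)) : ℕ) : ZMod b)

/-- The digit of the interlaced wave number that is paired with the digit `x / b ^ e`. -/
def levelDigit (b α M : ℕ) (ℓ : ℕ → ℕ) (e : ℕ) : ZMod b :=
  ((ℓ ((α * M - 1 - e) % α) / b ^ ((α * M - 1 - e) / α) : ℕ) : ZMod b)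

theorem levelDigit_eq (hα : 0 < α) (ℓ : ℕ → ℕ) {i a : ℕ} (hi : i < α) (ha : a < M) :
    levelDigit b α M ℓ (α * M - 1 - (α * a + i)) = ((ℓ i / b ^ a : ℕ) : ZMod b) := by
  have hp : α * a + i < α * M := by
    calc α * a + i < α * a + α := by omega
      _ = α * (a + 1) := by ring
      _ ≤ α * M := by gcongr; omega
  have e : α * M - 1 - (α * M - 1 - (α * a + i)) = α * a + i := by omega
  rw [levelDigit, e, Nat.mul_add_mod, Nat.mod_eq_of_lt hi, Nat.mul_add_div hα,
    Nat.div_eq_of_lt hi, add_zero]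

/-- Brings the interlaced Walsh function into the form of powers of `ζ_e` with exponents `x / b ^
e`, as summation by parts requires. -/
theorem walshProd_eq_stdAddChar (hα : 0 < α) (ℓ : ℕ → ℕ) (x : ℕ) :
    walshProd b (fun e => ZMod.stdAddChar (levelDigit b α M ℓ e))
        ((Finset.range (α * M)).filter fun e => levelDigit b α M ℓ e ≠ 0) x
      = ZMod.stdAddChar (blockPhase b α M ℓ x) := by
  have h1 : walshProd b (fun e => ZMod.stdAddChar (levelDigit b α M ℓ e))
        ((Finset.range (α * M)).filter fun e => levelDigit b α M ℓ e ≠ 0) x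
      = ∏ e ∈ Finset.range (α * M),
        (ZMod.stdAddChar (levelDigit b α M ℓ e * ((x / b ^ e : ℕ) : ZMod b)) : ℂ) := by
    rw [walshProd, Finset.prod_filter]
    refine Finset.prod_congr rfl fun e _ => ?_
    split_ifs with h
    · rw [← AddChar.map_nsmul_eq_pow, nsmul_eq_mul, mul_comm]
    · rw [not_not.1 h, zero_mul, AddChar.map_zero_eq_one]
  rw [h1, ← addChar_map_sum, blockPhase, ← Finset.sum_range_reflect, sum_range_mul,
    Finset.sum_comm]
  congr 1
  refine Finset.sum_congr rfl fun i hi => Finset.sum_congr rfl fun a ha => ?_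
  rw [levelDigit_eq hα ℓ (Finset.mem_range.1 hi) (Finset.mem_range.1 ha)]

theorem natCast_div_pow_log_ne_zero {k : ℕ} (hk : k ≠ 0) :
    ((k / b ^ Nat.log b k : ℕ) : ZMod b) ≠ 0 := by
  have hb := (Fact.out : b.Prime).one_lt
  have h1 : 0 < k / b ^ Nat.log b k :=
    Nat.div_pos (Nat.pow_log_le_self b hk) (Nat.pow_pos (by omega))
  have h2 : k / b ^ Nat.log b k < b := by
    rw [Nat.div_lt_iff_lt_mul (Nat.pow_pos (by omega)), ← pow_succ']
    exact Nat.lt_pow_succ_log_self hb k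
  rw [Ne, ZMod.natCast_eq_zero_iff]
  exact fun h => absurd (Nat.le_of_dvd h1 h) (by omega)

/-- The indices of the nonzero wave numbers in a block. -/
def activeSet (α : ℕ) (ℓ : ℕ → ℕ) : Finset ℕ := (Finset.range α).filter fun i => ℓ i ≠ 0

omit [Fact b.Prime] in
-- The exponent equals `α μ₁(ℓ_i) - (α - 1 - i)`. The losses `α - 1 - i` add up to at most `α (α -
-- 1) / 2`, the source of that power of `b` in the criterion.
theorem prod_activeSet_le (hb : 1 ≤ b) (ℓ : ℕ → ℕ) :
    ∏ i ∈ activeSet α ℓ, ((b : ℝ)⁻¹) ^ (α * Nat.log b (ℓ i) + i + 1)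
      ≤ (b : ℝ) ^ (α * (α - 1) / 2) * ((b : ℝ)⁻¹) ^ (α * ∑ i ∈ Finset.range α, muOne b (ℓ i)) := by
  have hb0 : (1 : ℝ) ≤ b := by exact_mod_cast hb
  have h1 : ∀ i ∈ activeSet α ℓ, ((b : ℝ)⁻¹) ^ (α * Nat.log b (ℓ i) + i + 1)
      = (b : ℝ) ^ (α - 1 - i) * ((b : ℝ)⁻¹) ^ (α * muOne b (ℓ i)) := by
    intro i hi
    obtain ⟨hi, h0⟩ := Finset.mem_filter.1 hi
    have hi := Finset.mem_range.1 hi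
    rw [muOne, if_neg h0, inv_pow, inv_pow, inv_eq_iff_eq_inv, mul_inv, inv_inv,
      eq_inv_mul_iff_mul_eq₀ (by positivity), ← pow_add]
    congr 1
    rw [mul_add]
    omega
  rw [Finset.prod_congr rfl h1, Finset.prod_mul_distrib]
  have h2 : ∏ i ∈ activeSet α ℓ, (b : ℝ) ^ (α - 1 - i) ≤ (b : ℝ) ^ (α * (α - 1) / 2) := by
    rw [← Finset.sum_range_id, ← Finset.sum_range_reflect, Finset.prod_pow_eq_pow_sum]
    exact pow_le_pow_right₀ hb0 (Finset.sum_le_sum_of_subset (Finset.filter_subset _ _))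
  have h3 : ∏ i ∈ activeSet α ℓ, ((b : ℝ)⁻¹) ^ (α * muOne b (ℓ i))
      = ((b : ℝ)⁻¹) ^ (α * ∑ i ∈ Finset.range α, muOne b (ℓ i)) := by
    rw [Finset.mul_sum, ← Finset.prod_pow_eq_pow_sum, activeSet, Finset.prod_filter]
    refine Finset.prod_congr rfl fun i _ => ?_
    split_ifs with h
    · rfl
    · rw [not_not.1 h, muOne, if_pos rfl, mul_zero, pow_zero]
  rw [h3]
  gcongr

theorem norm_sum_blockPhase_le (hα : 2 ≤ α) {ℓ : ℕ → ℕ} (hℓ : ∀ i < α, ℓ i < b ^ M)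
    (D : ℕ → ℝ → ℂ) {B : ℝ} (hB : 0 ≤ B)
    (hD : ∀ i < (activeSet α ℓ).card, ∀ t ∈ Set.Icc (0 : ℝ) 1,
      HasDerivWithinAt (D i) (D (i + 1) t) (Set.Icc 0 1) t)
    (hDB : ∀ t ∈ Set.Icc (0 : ℝ) 1, ‖D (activeSet α ℓ).card t‖ ≤ B) :
    ‖∑ x ∈ Finset.range (b ^ (α * M)),
        D 0 (x / (b ^ (α * M) : ℕ)) * ZMod.stdAddChar (blockPhase b α M ℓ x)‖
      ≤ (b ^ (α * M) : ℕ) * (B * ((if (activeSet α ℓ).Nonempty then blockConst b α else 1)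
        * ((b : ℝ)⁻¹) ^ (α * ∑ i ∈ Finset.range α, muOne b (ℓ i)))) := by
  have hb := (Fact.out : b.Prime)
  have hα0 : 0 < α := by omega
  -- The level of the leading digit of `ℓ i` after interlacing. Only these levels are exploited, one
  -- for each nonzero wave number; they are distinct because their positions differ modulo `α`.
  set g : ℕ → ℕ := fun i => α * M - 1 - (α * Nat.log b (ℓ i) + i) with hg
  have hlog : ∀ i ∈ activeSet α ℓ, i < α ∧ Nat.log b (ℓ i) < M ∧
      α * Nat.log b (ℓ i) + i < α * M := by
    intro i hi
    obtain ⟨hi, h0⟩ := Finset.mem_filter.1 hi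
    have hi := Finset.mem_range.1 hi
    have h1 : Nat.log b (ℓ i) < M := Nat.log_lt_of_lt_pow h0 (hℓ i hi)
    refine ⟨hi, h1, ?_⟩
    calc α * Nat.log b (ℓ i) + i < α * Nat.log b (ℓ i) + α := by omega
      _ = α * (Nat.log b (ℓ i) + 1) := by ring
      _ ≤ α * M := by gcongr; omega
  have hinj : Set.InjOn g (activeSet α ℓ) := by
    intro i hi j hj hij
    obtain ⟨h1, h2, h3⟩ := hlog i hi
    obtain ⟨h4, h5, h6⟩ := hlog j hj
    have h7 : α * Nat.log b (ℓ i) + i = α * Nat.log b (ℓ j) + j := by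
      simp only [hg] at hij
      omega
    have h8 := congrArg (· % α) h7
    simpa only [Nat.mul_add_mod, Nat.mod_eq_of_lt h1, Nat.mod_eq_of_lt h4] using h8
  have hT : ((activeSet α ℓ).image g).card = (activeSet α ℓ).card := Finset.card_image_of_injOn hinj
  have key := norm_sum_walsh_le (b := b) (M := α * M) hα (k := levelDigit b α M ℓ)
    (S := (Finset.range (α * M)).filter fun e => levelDigit b α M ℓ e ≠ 0)
    (T := (activeSet α ℓ).image g)
    (fun e he => ⟨Finset.mem_range.1 (Finset.mem_filter.1 he).1, (Finset.mem_filter.1 he).2⟩)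
    (fun e he => by
      obtain ⟨i, hi, rfl⟩ := Finset.mem_image.1 he
      obtain ⟨h1, h2, h3⟩ := hlog i hi
      refine Finset.mem_filter.2 ⟨Finset.mem_range.2 (by simp only [hg]; omega), ?_⟩
      rw [hg, levelDigit_eq hα0 ℓ h1 h2]
      exact natCast_div_pow_log_ne_zero (Finset.mem_filter.1 hi).2)
    (by
      rw [hT]
      exact (Finset.card_filter_le _ _).trans_eq (Finset.card_range α))
    D hB (by rwa [hT]) (by rwa [hT])
  simp only [walshProd_eq_stdAddChar hα0] at key
  push_cast
  refine key.trans ?_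
  rw [Finset.prod_image hinj]
  have hprod : ∏ i ∈ activeSet α ℓ, ((b : ℝ) ^ g i / (b : ℝ) ^ (α * M))
      = ∏ i ∈ activeSet α ℓ, ((b : ℝ)⁻¹) ^ (α * Nat.log b (ℓ i) + i + 1) := by
    refine Finset.prod_congr rfl fun i hi => ?_
    have h3 := (hlog i hi).2.2
    have hb0 : (0 : ℝ) < b := by exact_mod_cast hb.pos
    rw [inv_pow, div_eq_iff (by positivity), eq_inv_mul_iff_mul_eq₀ (by positivity), ← pow_add]
    congr 1
    simp only [hg]
    omega
  rw [hprod]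
  simp only [Finset.image_nonempty]
  refine mul_le_mul_of_nonneg_left (mul_le_mul_of_nonneg_left ?_ hB) (by positivity)
  have h := prod_activeSet_le (b := b) (α := α) hb.one_lt.le ℓ
  split_ifs with hne
  · rw [blockConst, mul_assoc]
    exact mul_le_mul_of_nonneg_left h (walshConst_pos hb.one_lt hα0).le
  · rw [Finset.not_nonempty_iff_eq_empty] at hne
    rw [hne, Finset.prod_empty, Finset.sum_eq_zero, mul_zero, pow_zero]
    intro i hi
    have : i ∉ activeSet α ℓ := by rw [hne]; exact Finset.notMem_empty i
    rw [activeSet, Finset.mem_filter, not_and, not_not] at this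
    rw [this hi, muOne, if_pos rfl]

end Block


/-! ### Walsh coefficients against the weights of the search criterion. -/

theorem le_spodWeight {α : ℕ} {β : ℕ → ℝ} (hβ : ∀ j, 0 < β j) (u : Finset ℕ) (r : ℕ → ℕ)
    (hr : ∀ j ∈ u, 1 ≤ r j ∧ r j ≤ α) :
    ((∑ j ∈ u, r j).factorial : ℝ) * ∏ j ∈ u, β j ^ r j ≤ spodWeight α β u := by
  have h1 : (fun j : {j // j ∈ u} => r j) ∈
      Fintype.piFinset (fun _ : {j // j ∈ u} => Finset.Icc 1 α) :=
    Fintype.mem_piFinset.2 fun j => Finset.mem_Icc.2 (hr j j.2)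
  have h0 : ∀ ν : {j // j ∈ u} → ℕ, ∀ j, 0 ≤ (if ν j = α then (2 : ℝ) else 1) * β j ^ ν j :=
    fun ν j => mul_nonneg (by split_ifs <;> norm_num) (pow_nonneg (hβ j).le _)
  refine le_trans ?_ (Finset.single_le_sum (f := fun ν : {j // j ∈ u} → ℕ =>
    ((∑ j, ν j).factorial : ℝ) * ∏ j, ((if ν j = α then 2 else 1) * β j ^ ν j))
    (fun ν _ => mul_nonneg (Nat.cast_nonneg _) (Finset.prod_nonneg fun j _ => h0 ν j)) h1)
  rw [← Finset.sum_coe_sort u, ← Finset.prod_coe_sort u]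
  refine mul_le_mul_of_nonneg_left (Finset.prod_le_prod (fun j _ => pow_nonneg (hβ j).le _)
    fun j _ => le_mul_of_one_le_left (pow_nonneg (hβ j).le _) ?_) (Nat.cast_nonneg _)
  split_ifs <;> norm_num

/-- The wave numbers of the `J`-th block. -/
def blockOf {s α : ℕ} (ℓ : Fin (s * α) → ℕ) (J i : ℕ) : ℕ :=
  if h : J < s ∧ i < α then ℓ (finProdFinEquiv (⟨J, h.1⟩, ⟨i, h.2⟩)) else 0

theorem blockOf_apply {s α : ℕ} (ℓ : Fin (s * α) → ℕ) (j : Fin s) (i : Fin α) :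
    blockOf ℓ j i = ℓ (finProdFinEquiv (j, i)) := by
  rw [blockOf, dif_pos ⟨j.2, i.2⟩]

theorem mem_blocks_iff {s α : ℕ} (ℓ : Fin (s * α) → ℕ) (J : ℕ) :
    J ∈ blocks α (Finset.univ.filter fun c => ℓ c ≠ 0)
      ↔ J < s ∧ (activeSet α (blockOf ℓ J)).Nonempty := by
  constructor
  · intro h
    obtain ⟨c, hc, rfl⟩ := Finset.mem_image.1 h
    obtain ⟨⟨j, i⟩, rfl⟩ := finProdFinEquiv.surjective c
    have hα : 0 < α := i.pos
    have e : (finProdFinEquiv (j, i) : ℕ) / α = j := by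
      rw [finProdFinEquiv_apply_val, Nat.add_mul_div_left _ _ hα, Nat.div_eq_of_lt i.2, zero_add]
    rw [e]
    refine ⟨j.2, i, Finset.mem_filter.2 ⟨Finset.mem_range.2 i.2, ?_⟩⟩
    rw [blockOf_apply]
    exact (Finset.mem_filter.1 hc).2
  · rintro ⟨hJ, i, hi⟩
    obtain ⟨hi, h0⟩ := Finset.mem_filter.1 hi
    have hi := Finset.mem_range.1 hi
    have hα : 0 < α := by omega
    refine Finset.mem_image.2 ⟨finProdFinEquiv (⟨J, hJ⟩, ⟨i, hi⟩),
      Finset.mem_filter.2 ⟨Finset.mem_univ _, ?_⟩, ?_⟩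
    · rw [← blockOf_apply ℓ ⟨J, hJ⟩ ⟨i, hi⟩]
      exact h0
    · rw [finProdFinEquiv_apply_val, Nat.add_mul_div_left _ _ hα, Nat.div_eq_of_lt hi, zero_add]

theorem sum_blockOf {s α : ℕ} (ℓ : Fin (s * α) → ℕ) (f : ℕ → ℕ) :
    ∑ j : Fin s, ∑ i ∈ Finset.range α, f (blockOf ℓ j i) = ∑ c, f (ℓ c) := by
  rw [← finProdFinEquiv.sum_comp, Fintype.sum_prod_type]
  refine Finset.sum_congr rfl fun j _ => ?_
  rw [Finset.sum_range]
  exact Finset.sum_congr rfl fun i _ => by rw [blockOf_apply]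

/-- Variable `j` is differentiated as often as its block has nonzero wave numbers. Untouched blocks
contribute neither a constant nor a derivative, and the orders `r` form one of the multi-indices
summed in `spodWeight`. -/
theorem norm_walsh_le_cbcWeight {b s α M : ℕ} [Fact b.Prime] (hα : 2 ≤ α) {F : (Fin s → ℝ) → ℝ}
    {D : (Fin s → ℕ) → (Fin s → ℝ) → ℝ}
    (hD : HasMixedPartials α F D) {c : ℝ} (hc : 0 < c) {β : ℕ → ℝ} (hβ : ∀ j, 0 < β j)
    (hbound : ∀ ν : Fin s → ℕ, (∀ j, ν j ≤ α) → ∀ y ∈ Set.Icc (0 : Fin s → ℝ) 1,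
      |D ν y| ≤ c * ((∑ j, ν j).factorial : ℝ) * ∏ j : Fin s, β j ^ ν j)
    (ℓ : Fin (s * α) → ℕ) (hℓ : ∀ i, ℓ i < b ^ M) :
    ‖∑ x ∈ Fintype.piFinset fun _ : Fin s => Finset.range (b ^ (α * M)),
        (F (fun j => (x j : ℝ) / (b ^ (α * M) : ℕ)) : ℂ)
          * ∏ j : Fin s, ZMod.stdAddChar (blockPhase b α M (blockOf ℓ j) (x j))‖
      ≤ ((b ^ (α * M) : ℕ) : ℝ) ^ s
        * (c * (cbcWeight b α β (Finset.univ.filter fun i => ℓ i ≠ 0)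
          * ((b : ℝ)⁻¹) ^ (α * ∑ i, muOne b (ℓ i)))) := by
  have hb := (Fact.out : b.Prime)
  have hW : 0 < walshConst α b := walshConst_pos hb.one_lt (by omega)
  have hB : 0 < blockConst b α := mul_pos hW (pow_pos (by exact_mod_cast hb.pos) _)
  set r : ℕ → ℕ := fun J => (activeSet α (blockOf ℓ J)).card with hr
  have hrα : ∀ J, r J ≤ α := fun J =>
    (Finset.card_filter_le _ _).trans_eq (Finset.card_range α)
  set u := blocks α (Finset.univ.filter fun i => ℓ i ≠ 0) with hu
  have key := norm_sum_grid_le (L := b ^ (α * M)) hD hc hβ hbound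
    (fun j x => ZMod.stdAddChar (blockPhase b α M (blockOf ℓ j) x)) (fun j => r j)
    (fun j => hrα j)
    (fun j => (if (activeSet α (blockOf ℓ j)).Nonempty then blockConst b α else 1)
        * ((b : ℝ)⁻¹) ^ (α * ∑ i ∈ Finset.range α, muOne b (blockOf ℓ j i)))
    (fun j => mul_nonneg (by split_ifs <;> positivity) (by positivity))
    (fun j f B hB0 hf hfB => norm_sum_blockPhase_le hα (fun i hi => by
      rw [blockOf_apply ℓ j ⟨i, hi⟩]
      exact hℓ _) f hB0 hf hfB)
  refine key.trans (mul_le_mul_of_nonneg_left ?_ (by positivity))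
  rw [Finset.prod_mul_distrib, Finset.prod_pow_eq_pow_sum, ← Finset.mul_sum,
    sum_blockOf ℓ (muOne b)]
  have hsub : u ⊆ Finset.range s := fun J hJ =>
    Finset.mem_range.2 ((mem_blocks_iff ℓ J).1 hJ).1
  have hr0 : ∀ J ∈ Finset.range s, J ∉ u → r J = 0 := by
    intro J hJ hJu
    rw [hu, mem_blocks_iff, not_and] at hJu
    have := hJu (Finset.mem_range.1 hJ)
    rwa [Finset.not_nonempty_iff_eq_empty, ← Finset.card_eq_zero] at this
  have e1 : ∏ j : Fin s, (if (activeSet α (blockOf ℓ j)).Nonempty then blockConst b α else 1)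
      = blockConst b α ^ u.card := by
    rw [← Finset.prod_range
      (fun J => if (activeSet α (blockOf ℓ J)).Nonempty then blockConst b α else 1),
      ← Finset.prod_subset hsub, Finset.prod_congr rfl fun J hJ =>
        if_pos ((mem_blocks_iff ℓ J).1 hJ).2, Finset.prod_const]
    intro J hJ hJu
    rw [if_neg]
    rw [← Finset.card_pos]
    have := hr0 J hJ hJu
    simp only [hr] at this
    omega
  have e2 : ∑ j : Fin s, r j = ∑ J ∈ u, r J := by
    rw [← Finset.sum_range, ← Finset.sum_subset hsub hr0]
  have e3 : ∏ j : Fin s, β j ^ r j = ∏ J ∈ u, β J ^ r J := by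
    rw [← Finset.prod_range (fun J => β J ^ r J), ← Finset.prod_subset hsub]
    intro J hJ hJu
    rw [hr0 J hJ hJu, pow_zero]
  rw [e1, e2, e3]
  have h1 := le_spodWeight hβ u r fun J hJ =>
    ⟨Finset.card_pos.2 ((mem_blocks_iff ℓ J).1 hJ).2, hrα J⟩
  rw [cbcWeight, ← hu, pow_mul (b : ℝ) (α * (α - 1) / 2), mul_right_comm (walshConst α b ^ u.card), ← mul_pow, ← blockConst]
  calc _ = c * (blockConst b α ^ u.card * (((∑ J ∈ u, r J).factorial : ℝ) * ∏ J ∈ u, β J ^ r J)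
        * ((b : ℝ)⁻¹) ^ (α * ∑ i, muOne b (ℓ i))) := by ring
    _ ≤ _ := by gcongr

/-! ### The error of a quadrature rule on the grid -/

section Net

variable {b s α M : ℕ} [Fact b.Prime]

/-- The pairing of wave numbers with grid points. -/
def gridPhase (b M : ℕ) {s α : ℕ} (ℓ : Fin (s * α) → ℕ) (x : Fin s → ℕ) : ZMod b :=
  ∑ j : Fin s, blockPhase b α M (blockOf ℓ j) (x j)

theorem gridPhase_eq (ℓ : Fin (s * α) → ℕ) (x : Fin s → ℕ) :
    gridPhase b M ℓ x = ∑ j : Fin s, ∑ i : Fin α, ∑ a ∈ Finset.range M,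
      ((ℓ (finProdFinEquiv (j, i)) / b ^ a : ℕ) : ZMod b)
        * ((x j / b ^ (α * M - 1 - (α * a + i)) : ℕ) : ZMod b) := by
  refine Finset.sum_congr rfl fun j _ => ?_
  rw [blockPhase, Finset.sum_range]
  exact Finset.sum_congr rfl fun i _ => by rw [blockOf_apply]

/-- Each digit of each coordinate is paired with exactly one digit of one wave number, so the sum
factors over digits and detects any difference. -/
theorem sum_stdAddChar_gridPhase_sub {x y : Fin s → ℕ} (hx : ∀ j, x j < b ^ (α * M))
    (hy : ∀ j, y j < b ^ (α * M)) :
    ∑ ℓ ∈ Fintype.piFinset fun _ : Fin (s * α) => Finset.range (b ^ M),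
        (ZMod.stdAddChar (gridPhase b M ℓ x - gridPhase b M ℓ y) : ℂ)
      = if x = y then ((b : ℂ) ^ M) ^ (s * α) else 0 := by
  set t : Fin (s * α) → ℕ → ZMod b := fun c a =>
    ((x (finProdFinEquiv.symm c).1 / b ^ (α * M - 1 - (α * a + (finProdFinEquiv.symm c).2)) : ℕ)
      : ZMod b)
    - ((y (finProdFinEquiv.symm c).1 / b ^ (α * M - 1 - (α * a + (finProdFinEquiv.symm c).2)) : ℕ)
      : ZMod b) with ht
  have h1 : ∀ ℓ : Fin (s * α) → ℕ, (ZMod.stdAddChar (gridPhase b M ℓ x - gridPhase b M ℓ y) : ℂ)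
      = ∏ c, ZMod.stdAddChar (∑ a ∈ Finset.range M, ((ℓ c / b ^ a : ℕ) : ZMod b) * t c a) := by
    intro ℓ
    rw [← addChar_map_sum, ← finProdFinEquiv.sum_comp, Fintype.sum_prod_type, gridPhase_eq,
      gridPhase_eq]
    simp only [ht, Equiv.symm_apply_apply, mul_sub, Finset.sum_sub_distrib]
  simp only [h1]
  rw [← Finset.prod_univ_sum (fun _ => Finset.range (b ^ M)) fun c k =>
    (ZMod.stdAddChar (∑ a ∈ Finset.range M, ((k / b ^ a : ℕ) : ZMod b) * t c a) : ℂ)]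
  simp only [sum_stdAddChar_digits]
  split_ifs with hxy
  · subst hxy
    simp [ht]
  · obtain ⟨j, hj⟩ := Function.ne_iff.1 hxy
    have hne : ∃ r < α * M, x j / b ^ r % b ≠ y j / b ^ r % b := by
      by_contra! h
      exact hj (eq_of_digits_eq _ (hx j) (hy j) h)
    obtain ⟨r, hr, hne⟩ := hne
    have hα : 0 < α := by
      rcases Nat.eq_zero_or_pos α with rfl | h
      · simp at hr
      · exact h
    set p := α * M - 1 - r with hp
    have hpa : p / α < M := by
      rw [Nat.div_lt_iff_lt_mul hα, mul_comm]
      omega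
    have e : α * M - 1 - (α * (p / α) + p % α) = r := by
      rw [Nat.div_add_mod]
      omega
    refine Finset.prod_eq_zero (Finset.mem_univ (finProdFinEquiv (j, ⟨p % α, Nat.mod_lt _ hα⟩))) ?_
    rw [if_neg]
    intro h
    have h2 := h _ hpa
    simp only [ht, Equiv.symm_apply_apply, e, sub_eq_zero] at h2
    exact hne ((ZMod.natCast_eq_natCast_iff' _ _ _).1 h2)

/-- Expansion of the error into a sum over the nonzero wave numbers. -/
theorem norm_average_sub_le (f : (Fin s → ℕ) → ℂ) {N : ℕ} (x : ℕ → Fin s → ℕ)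
    (hx : ∀ n j, x n j < b ^ (α * M)) :
    ‖(∑ n ∈ Finset.range N, f (x n)) * ((b ^ (α * M) : ℕ) : ℂ) ^ s
        - N * ∑ z ∈ Fintype.piFinset fun _ : Fin s => Finset.range (b ^ (α * M)), f z‖
      ≤ ∑ ℓ ∈ (Fintype.piFinset fun _ : Fin (s * α) => Finset.range (b ^ M)).erase 0,
        ‖∑ z ∈ Fintype.piFinset fun _ : Fin s => Finset.range (b ^ (α * M)),
            f z * ZMod.stdAddChar (gridPhase b M ℓ z)‖
          * ‖∑ n ∈ Finset.range N, (ZMod.stdAddChar (-gridPhase b M ℓ (x n)) : ℂ)‖ := by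
  have hb := (Fact.out : b.Prime)
  set Z := Fintype.piFinset fun _ : Fin s => Finset.range (b ^ (α * M)) with hZ
  set Λ := Fintype.piFinset fun _ : Fin (s * α) => Finset.range (b ^ M) with hΛ
  have h0 : (0 : Fin (s * α) → ℕ) ∈ Λ :=
    Fintype.mem_piFinset.2 fun _ => Finset.mem_range.2 (Nat.pow_pos hb.pos)
  -- Fourier inversion on the grid. The term `ℓ = 0`, removed below, is `N` times the sum of `f`
  -- over the grid.
  have h1 : (∑ n ∈ Finset.range N, f (x n)) * ((b ^ (α * M) : ℕ) : ℂ) ^ s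
      = ∑ ℓ ∈ Λ, (∑ z ∈ Z, f z * ZMod.stdAddChar (gridPhase b M ℓ z))
          * ∑ n ∈ Finset.range N, (ZMod.stdAddChar (-gridPhase b M ℓ (x n)) : ℂ) := by
    simp only [Finset.sum_mul_sum]
    rw [Finset.sum_mul, Finset.sum_comm' (t' := Z) (s' := fun _ => Λ) (by simp [and_comm])]
    have h2 : ∀ z ∈ Z, ∑ ℓ ∈ Λ, ∑ n ∈ Finset.range N, f z * ZMod.stdAddChar (gridPhase b M ℓ z)
        * (ZMod.stdAddChar (-gridPhase b M ℓ (x n)) : ℂ)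
        = ∑ n ∈ Finset.range N, f z * if z = x n then ((b : ℂ) ^ M) ^ (s * α) else 0 := by
      intro z hz
      rw [Finset.sum_comm]
      refine Finset.sum_congr rfl fun n _ => ?_
      rw [← sum_stdAddChar_gridPhase_sub (fun j => Finset.mem_range.1 (Fintype.mem_piFinset.1 hz j))
        (hx n), Finset.mul_sum]
      refine Finset.sum_congr rfl fun ℓ _ => ?_
      rw [mul_assoc, ← AddChar.map_add_eq_mul, sub_eq_add_neg]
    rw [Finset.sum_congr rfl h2, Finset.sum_comm]
    refine Finset.sum_congr rfl fun n _ => ?_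
    rw [Finset.sum_eq_single_of_mem (x n)
      (Fintype.mem_piFinset.2 fun j => Finset.mem_range.2 (hx n j)) fun z _ hzx => by
        rw [if_neg hzx, mul_zero], if_pos rfl]
    congr 1
    push_cast
    rw [← pow_mul, ← pow_mul]
    congr 1
    ring
  have hph : ∀ z, gridPhase b M (0 : Fin (s * α) → ℕ) z = 0 := by
    intro z
    simp [gridPhase_eq]
  rw [h1, ← Finset.add_sum_erase Λ _ h0]
  simp only [hph, neg_zero, AddChar.map_zero_eq_one, mul_one, Finset.sum_const, Finset.card_range,
    nsmul_eq_mul]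
  rw [mul_comm (∑ z ∈ Z, f z) (N : ℂ), add_sub_cancel_left]
  exact (norm_sum_le _ _).trans_eq (Finset.sum_congr rfl fun ℓ _ => norm_mul _ _)

end Net


/-! ### Quadrature error against the grid average. -/

section Error

variable {b s α m M : ℕ} [Fact b.Prime]

theorem interlacedPoint_eq (hmM : m ≤ M) (P : (ZMod b)[X]) (q : Fin (s * α) → (ZMod b)[X]) (n : ℕ)
    (j : Fin s) : interlacedPoint m P q n j = (pointNum m M (fun i : Fin α =>
      laurentOfPoly (digitPoly b m n * q (finProdFinEquiv (j, i))) / laurentOfPoly P) : ℝ)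
        / (b ^ (α * M) : ℕ) := by
  rw [interlacedPoint, Nat.cast_pow]
  exact interlace_vMap hmM _

/-- The digits of the points are Laurent coefficients, and they vanish from position `m` on. This
truncates the wave numbers to `tr_m` and reduces the phase to the residue whose vanishing defines
the dual net. -/
theorem gridPhase_pointNum (hmM : m ≤ M) (P : (ZMod b)[X]) (q : Fin (s * α) → (ZMod b)[X]) (n : ℕ)
    (ℓ : Fin (s * α) → ℕ) :
    gridPhase b M ℓ (fun j => pointNum m M (fun i : Fin α =>
      laurentOfPoly (digitPoly b m n * q (finProdFinEquiv (j, i))) / laurentOfPoly P))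
      = residueHom P (digitPoly b m n * ∑ c, digitPoly b m (ℓ c) * q c) := by
  rw [residueHom_mul_sum_digitPoly, gridPhase_eq, ← finProdFinEquiv.sum_comp,
    Fintype.sum_prod_type]
  refine Finset.sum_congr rfl fun j _ => Finset.sum_congr rfl fun i _ => ?_
  rw [← Finset.sum_subset (Finset.range_mono hmM)]
  · refine Finset.sum_congr rfl fun a ha => ?_
    have ha := Finset.mem_range.1 ha
    rw [pointNum_digit m M _ i (by omega), if_pos ha]
  · intro a ha ham
    rw [pointNum_digit m M _ i (Finset.mem_range.1 ha), if_neg (by simpa using ham), mul_zero]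

open Classical in
theorem norm_sum_gridPhase_le (hmM : m ≤ M) {P : (ZMod b)[X]} (hP : Irreducible P)
    (hdeg : P.natDegree = m) (q : Fin (s * α) → (ZMod b)[X]) (ℓ : Fin (s * α) → ℕ) :
    ‖∑ n ∈ Finset.range (b ^ m), (ZMod.stdAddChar (-gridPhase b M ℓ (fun j => pointNum m M
      (fun i : Fin α => laurentOfPoly (digitPoly b m n * q (finProdFinEquiv (j, i)))
        / laurentOfPoly P))) : ℂ)‖
      ≤ if P ∣ ∑ c, digitPoly b m (ℓ c) * q c then (b : ℝ) ^ m else 0 := by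
  have : Fact (Irreducible P) := ⟨hP⟩
  have := finite_adjoinRoot (P := P)
  simp only [gridPhase_pointNum hmM]
  split_ifs with h
  · refine (norm_sum_le_of_le _ (n := fun _ => 1) fun n _ => ?_).trans_eq (by simp)
    rw [AddChar.norm_apply]
  · simp only [← map_neg, ← mul_neg]
    rw [sum_stdAddChar_residueHom (isResidueMap_mk hdeg) (by rwa [dvd_neg]), norm_zero]

open Classical in
-- Wave numbers are sorted by their support `v`. Restriction to `v` embeds each group in `dualNet m
-- P q v`, where the nonnegative series converges.
theorem sum_dual_le_searchCriterion (hα : 2 ≤ α) {β : ℕ → ℝ} (hβ : ∀ j, 0 < β j) {P : (ZMod b)[X]}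
    (hP : Irreducible P) (hdeg : P.natDegree = m) {D : ℕ} (q : Fin D → (ZMod b)[X])
    (Λ : Finset (Fin D → ℕ)) (h0 : 0 ∉ Λ) :
    ∑ ℓ ∈ Λ with P ∣ ∑ c, digitPoly b m (ℓ c) * q c,
        cbcWeight b α β (Finset.univ.filter fun i => ℓ i ≠ 0)
          * ((b : ℝ)⁻¹) ^ (α * ∑ i, muOne b (ℓ i)) ≤ searchCriterion m α P β q D := by
  have : Fact (Irreducible P) := ⟨hP⟩
  have := finite_adjoinRoot (P := P)
  have := Fintype.ofFinite (AdjoinRoot P)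
  rw [searchCriterion]
  rw [← Finset.sum_fiberwise_of_maps_to (t := Finset.univ.filter fun v : Finset (Fin D) =>
    v.Nonempty ∧ ∀ j : Fin D, j ∈ v → (j : ℕ) < D) (g := fun ℓ => Finset.univ.filter fun i => ℓ i ≠ 0)]
  · refine Finset.sum_le_sum fun v _ => ?_
    set W := (Λ.filter fun ℓ => P ∣ ∑ c, digitPoly b m (ℓ c) * q c).filter
      fun ℓ => (Finset.univ.filter fun i => ℓ i ≠ 0) = v with hW
    have h1 : ∀ ℓ ∈ W, cbcWeight b α β (Finset.univ.filter fun i => ℓ i ≠ 0)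
        * ((b : ℝ)⁻¹) ^ (α * ∑ i, muOne b (ℓ i))
        = cbcWeight b α β v * ((b : ℝ)⁻¹) ^ (α * ∑ i, muOne b (ℓ i)) := fun ℓ hℓ => by
      rw [(Finset.mem_filter.1 hℓ).2]
    rw [Finset.sum_congr rfl h1, ← Finset.mul_sum]
    refine mul_le_mul_of_nonneg_left ?_ (cbcWeight_nonneg (Fact.out : b.Prime).one_lt (by omega)
      (fun j => (hβ j).le) v)
    have hmem : ∀ ℓ ∈ W, ∀ i, ℓ i ≠ 0 ↔ i ∈ v := fun ℓ hℓ i => by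
      rw [← (Finset.mem_filter.1 hℓ).2, Finset.mem_filter]
      simp
    have hz : ∀ ℓ ∈ W, ∀ i, i ∉ v → ℓ i = 0 := fun ℓ hℓ i hi => by
      by_contra h
      exact hi ((hmem ℓ hℓ i).1 h)
    let e : W → dualNet m P q v := fun ℓ => ⟨fun j => ℓ.1 j, fun j =>
      Nat.pos_of_ne_zero ((hmem ℓ.1 ℓ.2 j).2 j.2), by
        have h2 := (Finset.mem_filter.1 (Finset.mem_filter.1 ℓ.2).1).2
        rw [← Finset.sum_subset (Finset.subset_univ v) fun i _ hi => by
          rw [hz ℓ.1 ℓ.2 i hi, digitPoly]; simp, ← Finset.sum_coe_sort] at h2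
        exact h2⟩
    have he : Function.Injective e := by
      intro ℓ ℓ' h
      ext i
      by_cases hi : i ∈ v
      · exact congrFun (congrArg Subtype.val h) ⟨i, hi⟩
      · rw [hz ℓ.1 ℓ.2 i hi, hz ℓ'.1 ℓ'.2 i hi]
    rw [← Finset.sum_coe_sort W, ← tsum_fintype (L := .unconditional _)]
    refine Summable.tsum_le_tsum_of_inj e he (fun _ _ => by positivity) (fun ℓ => ?_)
      (Summable.of_finite) (hasSum_dualNet (isResidueMap_mk hdeg) q v hα).summable
    refine le_of_eq ?_
    congr 2
    rw [← Finset.sum_subset (Finset.subset_univ v) fun i _ hi => by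
      rw [hz ℓ.1 ℓ.2 i hi, muOne, if_pos rfl], ← Finset.sum_coe_sort]
  · intro ℓ hℓ
    refine Finset.mem_filter.2 ⟨Finset.mem_univ _, ?_, fun j _ => j.2⟩
    by_contra hne
    rw [Finset.not_nonempty_iff_eq_empty, Finset.filter_eq_empty_iff] at hne
    have : ℓ = 0 := funext fun i => not_not.1 (hne (Finset.mem_univ i))
    exact h0 (this ▸ (Finset.mem_filter.1 hℓ).1)

open Classical in
theorem abs_quadrature_sub_le (hα : 2 ≤ α) (hmM : m ≤ M) {P : (ZMod b)[X]} (hP : Irreducible P)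
    (hdeg : P.natDegree = m) (q : Fin (s * α) → (ZMod b)[X]) {F : (Fin s → ℝ) → ℝ}
    {D : (Fin s → ℕ) → (Fin s → ℝ) → ℝ}
    (hD : HasMixedPartials α F D) {c : ℝ} (hc : 0 < c) {β : ℕ → ℝ} (hβ : ∀ j, 0 < β j)
    (hbound : ∀ ν : Fin s → ℕ, (∀ j, ν j ≤ α) → ∀ y ∈ Set.Icc (0 : Fin s → ℝ) 1,
      |D ν y| ≤ c * ((∑ j, ν j).factorial : ℝ) * ∏ j : Fin s, β j ^ ν j) :
    |(∑ z ∈ Fintype.piFinset fun _ : Fin s => Finset.range (b ^ (α * M)),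
        F (fun j => (z j : ℝ) / (b ^ (α * M) : ℕ))) / ((b ^ (α * M) : ℕ) : ℝ) ^ s
      - quadrature (b ^ m) (interlacedPoint m P q) F| ≤ c * searchCriterion m α P β q (s * α) := by
  have hb := (Fact.out : b.Prime)
  set x : ℕ → Fin s → ℕ := fun n j => pointNum m M (fun i : Fin α =>
      laurentOfPoly (digitPoly b m n * q (finProdFinEquiv (j, i))) / laurentOfPoly P) with hx
  set L : ℕ := b ^ (α * M) with hL
  have hL0 : (0 : ℝ) < (L : ℝ) ^ s := by
    have : 0 < L := Nat.pow_pos hb.pos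
    positivity
  have hN0 : (0 : ℝ) < (b : ℝ) ^ m := pow_pos (by exact_mod_cast hb.pos) _
  have hpt : ∀ n, interlacedPoint m P q n = fun j => (x n j : ℝ) / L := fun n =>
    funext fun j => interlacedPoint_eq hmM P q n j
  set A := ∑ z ∈ Fintype.piFinset fun _ : Fin s => Finset.range L, F (fun j => (z j : ℝ) / L) with hA
  have key := norm_average_sub_le (b := b) (α := α) (M := M) (N := b ^ m)
    (fun z => (F (fun j => (z j : ℝ) / L) : ℂ)) x (fun n j => pointNum_lt m M _)
  have h1 : ∀ ℓ ∈ (Fintype.piFinset fun _ : Fin (s * α) => Finset.range (b ^ M)).erase 0,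
      ‖∑ z ∈ Fintype.piFinset fun _ : Fin s => Finset.range (b ^ (α * M)),
            (F (fun j => (z j : ℝ) / L) : ℂ) * ZMod.stdAddChar (gridPhase b M ℓ z)‖
          * ‖∑ n ∈ Finset.range (b ^ m), (ZMod.stdAddChar (-gridPhase b M ℓ (x n)) : ℂ)‖
      ≤ (if P ∣ ∑ c, digitPoly b m (ℓ c) * q c then
          cbcWeight b α β (Finset.univ.filter fun i => ℓ i ≠ 0)
            * ((b : ℝ)⁻¹) ^ (α * ∑ i, muOne b (ℓ i)) else 0) * ((L : ℝ) ^ s * c * (b : ℝ) ^ m) := by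
    intro ℓ hℓ
    have h2 := norm_walsh_le_cbcWeight hα hD hc hβ hbound ℓ fun i =>
      Finset.mem_range.1 (Fintype.mem_piFinset.1 (Finset.mem_of_mem_erase hℓ) i)
    simp only [← addChar_map_sum] at h2
    refine (mul_le_mul h2 (norm_sum_gridPhase_le hmM hP hdeg q ℓ) (norm_nonneg _)
      ((norm_nonneg _).trans h2)).trans_eq ?_
    split_ifs
    · ring
    · simp
  have h3 := key.trans (Finset.sum_le_sum h1)
  rw [← Finset.sum_mul, ← Finset.sum_filter] at h3
  have h4 := sum_dual_le_searchCriterion hα hβ hP hdeg q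
    ((Fintype.piFinset fun _ : Fin (s * α) => Finset.range (b ^ M)).erase 0)
    (Finset.notMem_erase _ _)
  have h5 := h3.trans (mul_le_mul_of_nonneg_right h4 (by positivity))
  have e : (∑ n ∈ Finset.range (b ^ m), (F (fun j => (x n j : ℝ) / L) : ℂ))
        * ((b ^ (α * M) : ℕ) : ℂ) ^ s - ((b ^ m : ℕ) : ℂ)
          * ∑ z ∈ Fintype.piFinset fun _ : Fin s => Finset.range (b ^ (α * M)),
            (F (fun j => (z j : ℝ) / L) : ℂ)
      = ((-((L : ℝ) ^ s * (b : ℝ) ^ m) * (A / (L : ℝ) ^ s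
        - quadrature (b ^ m) (interlacedPoint m P q) F) : ℝ) : ℂ) := by
    have e' : -((L : ℝ) ^ s * (b : ℝ) ^ m) * (A / (L : ℝ) ^ s
        - quadrature (b ^ m) (interlacedPoint m P q) F)
        = (∑ n ∈ Finset.range (b ^ m), F (fun j => (x n j : ℝ) / L)) * (L : ℝ) ^ s
          - (b : ℝ) ^ m * A := by
      rw [quadrature]
      simp only [hpt]
      push_cast
      field_simp
      ring
    rw [e', hA, ← hL]
    push_cast
    rfl
  rw [e, Complex.norm_real, norm_mul, Real.norm_eq_abs, Real.norm_eq_abs, abs_neg,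
    abs_of_pos (by positivity)] at h5
  have h6 : (L : ℝ) ^ s * (b : ℝ) ^ m * |A / (L : ℝ) ^ s
      - quadrature (b ^ m) (interlacedPoint m P q) F|
      ≤ (L : ℝ) ^ s * (b : ℝ) ^ m * (c * searchCriterion m α P β q (s * α)) :=
    h5.trans_eq (by ring)
  exact le_of_mul_le_mul_left h6 (by positivity)

end Error

/-! ### Riemann sums -/

/-- Coordinates are changed one at a time with the mean value inequality. Existence of partial
derivatives alone would not give continuity; their boundedness does. -/
theorem abs_piecewise_sub_le {s α : ℕ} (hα : 1 ≤ α) {F : (Fin s → ℝ) → ℝ}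
    {D : (Fin s → ℕ) → (Fin s → ℝ) → ℝ} (hD : HasMixedPartials α F D) {K : ℝ}
    (hK : ∀ j, ∀ y ∈ Set.Icc (0 : Fin s → ℝ) 1, |D (Pi.single j 1) y| ≤ K) {y z : Fin s → ℝ}
    (hy : y ∈ Set.Icc (0 : Fin s → ℝ) 1) (hz : z ∈ Set.Icc (0 : Fin s → ℝ) 1)
    (J : Finset (Fin s)) :
    J.piecewise z y ∈ Set.Icc (0 : Fin s → ℝ) 1 ∧
      |F (J.piecewise z y) - F y| ≤ ∑ j ∈ J, K * |z j - y j| := by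
  induction J using Finset.induction_on with
  | empty => simpa using hy
  | insert j J hj ih =>
    set w := J.piecewise z y with hw
    rw [Finset.piecewise_insert, ← hw]
    have hwj : w j = y j := Finset.piecewise_eq_of_notMem _ _ _ hj
    have hzj : z j ∈ Set.Icc (0 : ℝ) 1 := ⟨hz.1 j, hz.2 j⟩
    have hyj : y j ∈ Set.Icc (0 : ℝ) 1 := ⟨hy.1 j, hy.2 j⟩
    have hmem := update_mem_Icc ih.1 j hzj
    refine ⟨hmem, ?_⟩
    have h1 : ∀ t ∈ Set.Icc (0 : ℝ) 1, HasDerivWithinAt (fun t => D 0 (Function.update w j t))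
        (D (Pi.single j 1) (Function.update w j t)) (Set.Icc 0 1) t := by
      intro t ht
      have h := hD.2 0 j (fun _ => Nat.zero_le _) hα (Function.update w j t)
        (update_mem_Icc ih.1 j ht)
      simpa only [Function.update_idem, Function.update_self, zero_add] using h
    have h2 := (convex_Icc (0 : ℝ) 1).norm_image_sub_le_of_norm_hasDerivWithin_le h1
      (fun t ht => hK j _ (update_mem_Icc ih.1 j ht)) hyj hzj
    rw [← hwj, Function.update_eq_self, hD.1 _ hmem, hD.1 _ ih.1, hwj, Real.norm_eq_abs,
      Real.norm_eq_abs] at h2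
    rw [Finset.sum_insert hj]
    exact (abs_sub_le _ (F w) _).trans (add_le_add h2 ih.2)

theorem continuousOn_of_hasMixedPartials {s α : ℕ} (hα : 1 ≤ α) {F : (Fin s → ℝ) → ℝ}
    {D : (Fin s → ℕ) → (Fin s → ℝ) → ℝ} (hD : HasMixedPartials α F D) {K : ℝ} (hK0 : 0 ≤ K)
    (hK : ∀ j, ∀ y ∈ Set.Icc (0 : Fin s → ℝ) 1, |D (Pi.single j 1) y| ≤ K) :
    ContinuousOn F (Set.Icc 0 1) := by
  refine (LipschitzOnWith.of_dist_le_mul (K := ⟨s * K, by positivity⟩) fun z hz y hy => ?_).continuousOn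
  have h := (abs_piecewise_sub_le hα hD hK hy hz Finset.univ).2
  rw [Finset.piecewise_univ] at h
  rw [Real.dist_eq]
  refine h.trans ?_
  calc ∑ j, K * |z j - y j| ≤ ∑ _j : Fin s, K * dist z y := by
        gcongr with j
        rw [← Real.dist_eq]
        exact dist_le_pi_dist z y j
    _ = _ := by
        rw [Finset.sum_const, Finset.card_univ, Fintype.card_fin, nsmul_eq_mul, ← mul_assoc]
        rfl

open scoped Pointwise in
theorem tendsto_grid_average {s : ℕ} {F : (Fin s → ℝ) → ℝ} (hF : ContinuousOn F (Set.Icc 0 1)) :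
    Filter.Tendsto (fun n : ℕ => (∑ z ∈ Fintype.piFinset fun _ : Fin s => Finset.range n,
      F (fun j => (z j : ℝ) / n)) / (n : ℝ) ^ s) Filter.atTop
      (nhds (∫ y in Set.Icc (0 : Fin s → ℝ) 1, F y)) := by
  -- The half-open cube contains precisely the lattice points `z / n` with `z < n`, and it differs
  -- from the closed cube by a null set.
  set S : Set (Fin s → ℝ) := Set.univ.pi fun _ => Set.Ico 0 1 with hS
  have hSI : S ⊆ Set.Icc 0 1 := fun y hy => ⟨fun j => (hy j trivial).1, fun j => (hy j trivial).2.le⟩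
  -- Clamping the coordinates extends `F` from the cube to a continuous function on the whole space.
  set G : (Fin s → ℝ) → ℝ := fun y => F fun j => max 0 (min 1 (y j)) with hG
  have hGF : ∀ y ∈ Set.Icc (0 : Fin s → ℝ) 1, G y = F y := fun y hy => by
    simp only [hG]
    congr 1
    ext j
    rw [min_eq_right (show y j ≤ 1 from hy.2 j), max_eq_right (show 0 ≤ y j from hy.1 j)]
  have hGc : Continuous G := hF.comp_continuous (by fun_prop)
    fun y => ⟨fun j => le_max_left _ _, fun j => max_le zero_le_one (min_le_left _ _)⟩
  have hconv : Convex ℝ S := convex_pi fun _ _ => convex_Ico 0 1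
  have h := tendsto_tsum_div_pow_atTop_integral S G hGc
    ((Metric.isBounded_Icc 0 1).subset hSI)
    (MeasurableSet.univ_pi fun _ => measurableSet_Ico) (hconv.addHaar_frontier _)
  have hint : ∫ y in S, G y = ∫ y in Set.Icc (0 : Fin s → ℝ) 1, F y := by
    rw [MeasureTheory.setIntegral_congr_fun measurableSet_Icc fun y hy => (hGF y hy).symm]
    refine MeasureTheory.setIntegral_congr_set ?_
    rw [hS, MeasureTheory.volume_pi]
    exact MeasureTheory.Measure.univ_pi_Ico_ae_eq_Icc
  rw [hint] at h
  refine h.congr' ?_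
  filter_upwards [Filter.eventually_gt_atTop 0] with n hn
  have : NeZero n := ⟨hn.ne'⟩
  have hn' : (0 : ℝ) < n := by exact_mod_cast hn
  rw [Fintype.card_fin]
  congr 1
  have hset : S ∩ (n : ℝ)⁻¹ • (Submodule.span ℤ (Set.range (Pi.basisFun ℝ (Fin s))) : Set (Fin s → ℝ))
      = ((Fintype.piFinset fun _ : Fin s => Finset.range n).image
        fun z j => (z j : ℝ) / n : Finset (Fin s → ℝ)) := by
    ext y
    rw [Set.mem_inter_iff, Finset.mem_coe, Finset.mem_image]
    constructor
    · rintro ⟨hy, hyL⟩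
      have hyL' := (BoxIntegral.unitPartition.mem_smul_span_iff (n := n)).1 hyL
      choose a ha using hyL'
      have ha' : ∀ j, (a j : ℝ) = n * y j := ha
      have ha0 : ∀ j, 0 ≤ a j := fun j => by
        have h1 := (hy j trivial).1
        have : (0 : ℝ) ≤ a j := by rw [ha']; positivity
        exact_mod_cast this
      refine ⟨fun j => (a j).toNat, Fintype.mem_piFinset.2 fun j => Finset.mem_range.2 ?_, ?_⟩
      · have h1 : (a j : ℝ) < n := by
          rw [ha']
          exact mul_lt_of_lt_one_right hn' (hy j trivial).2
        have h2 : a j < n := by exact_mod_cast h1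
        have := ha0 j
        omega
      · ext j
        have h1 : (((a j).toNat : ℤ) : ℝ) = a j := by rw [Int.toNat_of_nonneg (ha0 j)]
        rw [Int.cast_natCast] at h1
        simp only [h1, ha']
        field_simp
    · rintro ⟨z, hz, rfl⟩
      rw [Fintype.mem_piFinset] at hz
      refine ⟨fun j _ => ⟨by positivity, ?_⟩,
        (BoxIntegral.unitPartition.mem_smul_span_iff (n := n)).2 fun j => ⟨z j, ?_⟩⟩
      · rw [div_lt_one hn']
        exact_mod_cast Finset.mem_range.1 (hz j)
      · simp only [map_natCast]
        field_simp
  rw [hset, Finset.tsum_subtype' _ G, Finset.sum_image]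
  · refine Finset.sum_congr rfl fun z hz => hGF _ ?_
    rw [Fintype.mem_piFinset] at hz
    exact ⟨fun j => (div_mem_Icc (Finset.mem_range.1 (hz j))).1,
      fun j => (div_mem_Icc (Finset.mem_range.1 (hz j))).2⟩
  · intro z _ z' _ hzz
    ext j
    have h1 := congrFun hzz j
    simp only at h1
    rw [div_left_inj' hn'.ne'] at h1
    exact_mod_cast h1

/-- The error bound for interlaced polynomial lattice rules. -/
theorem abs_integral_sub_quadrature_le {b s α m : ℕ} [Fact b.Prime] (hα : 2 ≤ α)
    {P : (ZMod b)[X]} (hP : Irreducible P)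
    (hdeg : P.natDegree = m) (q : Fin (s * α) → (ZMod b)[X]) {F : (Fin s → ℝ) → ℝ}
    {D : (Fin s → ℕ) → (Fin s → ℝ) → ℝ}
    (hD : HasMixedPartials α F D) {c : ℝ} (hc : 0 < c) {β : ℕ → ℝ} (hβ : ∀ j, 0 < β j)
    (hbound : ∀ ν : Fin s → ℕ, (∀ j, ν j ≤ α) → ∀ y ∈ Set.Icc (0 : Fin s → ℝ) 1,
      |D ν y| ≤ c * ((∑ j, ν j).factorial : ℝ) * ∏ j : Fin s, β j ^ ν j) :
    MeasureTheory.IntegrableOn F (Set.Icc 0 1) ∧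
      |(∫ y in Set.Icc (0 : Fin s → ℝ) 1, F y) - quadrature (b ^ m) (interlacedPoint m P q) F|
        ≤ c * searchCriterion m α P β q (s * α) := by
  have hK : ∀ j : Fin s, ∀ y ∈ Set.Icc (0 : Fin s → ℝ) 1,
      |D (Pi.single j 1) y| ≤ ∑ j : Fin s, c * β j := by
    intro j y hy
    have h := hbound (Pi.single j 1) (fun i => by
      rcases eq_or_ne i j with rfl | hi
      · rw [Pi.single_eq_same]; omega
      · rw [Pi.single_eq_of_ne hi]; omega) y hy
    rw [Finset.sum_pi_single', if_pos (Finset.mem_univ j), Nat.factorial_one, Nat.cast_one, mul_one,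
      Finset.prod_eq_single_of_mem j (Finset.mem_univ j) fun i _ hi => by
        rw [Pi.single_eq_of_ne hi, pow_zero], Pi.single_eq_same, pow_one] at h
    exact h.trans (Finset.single_le_sum (f := fun j : Fin s => c * β j)
      (fun i _ => (mul_pos hc (hβ i)).le) (Finset.mem_univ j))
  have hF := continuousOn_of_hasMixedPartials (by omega) hD (K := ∑ j : Fin s, c * β j)
    (Finset.sum_nonneg fun i _ => (mul_pos hc (hβ i)).le) hK
  refine ⟨hF.integrableOn_compact isCompact_Icc, ?_⟩
  have hb := (Fact.out : b.Prime).one_lt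
  have ht : Filter.Tendsto (fun M : ℕ => b ^ (α * M)) Filter.atTop Filter.atTop :=
    (tendsto_pow_atTop_atTop_of_one_lt hb).comp
      (Filter.tendsto_id.const_mul_atTop' (by omega : 0 < α))
  refine le_of_tendsto (((tendsto_grid_average hF).comp ht).sub_const _).abs ?_
  filter_upwards [Filter.eventually_ge_atTop m] with M hM
  exact abs_quadrature_sub_le hα hM hP hdeg q hD hc hβ hbound


/-- The fast component-by-component algorithm. -/
theorem exists_fast_cbc (b m α s : ℕ) (P : (ZMod b)[X]) :
    ∃ t : CompTree (Fin (s * α) → (ZMod b)[X]), b.Prime → Irreducible P → P.natDegree = m →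
      1 ≤ m → 2 ≤ α → 1 ≤ s → ∀ β : ℕ → ℝ, IsCBCVector m α P β (t.output (inputMemory s β)) ∧
        (t.cost (inputMemory s β) : ℝ) ≤ 1000 * (α * s * ((b : ℝ) ^ m) * Real.log ((b : ℝ) ^ m)
          + (α : ℝ) ^ 2 * (s : ℝ) ^ 2 * (b : ℝ) ^ m) := by
  classical
  by_cases h : b.Prime ∧ Irreducible P ∧ P.natDegree = m ∧ 1 ≤ m ∧ 2 ≤ α ∧ 1 ≤ s
  · obtain ⟨hb, hP, hdeg, hm, hα, hs⟩ := h
    have : Fact b.Prime := ⟨hb⟩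
    have : Fact (Irreducible P) := ⟨hP⟩
    have := finite_adjoinRoot (P := P)
    let := Fintype.ofFinite (AdjoinRoot P)
    obtain ⟨t, ht⟩ := exists_cbc_compTree (isResidueMap_mk hdeg) hα s
    exact ⟨t, fun _ _ _ _ _ _ β => ⟨(ht β).1,
      (Nat.cast_le.2 (ht β).2).trans (totalCost_le hb.two_le hm hα hs)⟩⟩
  -- A dummy tree for inadmissible parameters, since a tree is needed for all of them.
  · exact ⟨.ret 0, fun hb hP hdeg hm hα hs => absurd ⟨hb, hP, hdeg, hm, hα, hs⟩ h⟩

end QMC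

theorem mainTheorem1 :
    ∃ (K : ℝ) (A : ∀ b _ α s : ℕ, (ZMod b)[X] → QMC.CompTree (Fin (s * α) → (ZMod b)[X])),
      ∀ (b : ℕ) [Fact b.Prime] (p : ℝ) (β : ℕ → ℝ) (α : ℕ),
        0 < p → p ≤ 1 → (∀ j, 0 < β j) → Summable (fun j => β j ^ p) →
        ((∀ p' : ℝ, 0 < p' → p' < 1 → ¬ Summable (fun j => β j ^ p')) →
          ∑' j, β j < QMC.smallBound b) →
        α = ⌊1 / p⌋₊ + 1 →
        ∃ C : ℝ, 0 < C ∧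
          ∀ (s m : ℕ) (P : (ZMod b)[X]) (q : Fin (s * α) → (ZMod b)[X]),
            1 ≤ s → 1 ≤ m → Irreducible P → P.natDegree = m →
            q = (A b m α s P).output (QMC.inputMemory s β) →
            ((A b m α s P).cost (QMC.inputMemory s β) : ℝ) ≤
                K * (α * s * ((b : ℝ) ^ m) * Real.log ((b : ℝ) ^ m)
                  + (α : ℝ) ^ 2 * (s : ℝ) ^ 2 * (b : ℝ) ^ m) ∧
            QMC.IsCBCVector m α P β q ∧
            ∀ (F : (Fin s → ℝ) → ℝ) (D : (Fin s → ℕ) → (Fin s → ℝ) → ℝ) (c : ℝ),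
              0 < c → QMC.HasMixedPartials α F D →
              (∀ ν : Fin s → ℕ, (∀ j, ν j ≤ α) → ∀ y ∈ Set.Icc (0 : Fin s → ℝ) 1,
                |D ν y| ≤ c * ((∑ j, ν j).factorial : ℝ) * ∏ j : Fin s, β j ^ ν j) →
              MeasureTheory.IntegrableOn F (Set.Icc 0 1) ∧
              |(∫ y in Set.Icc (0 : Fin s → ℝ) 1, F y)
                  - QMC.quadrature (b ^ m) (QMC.interlacedPoint m P q) F|
                ≤ c * C * ((b : ℝ) ^ m) ^ (-(1 / p)) := by
  -- The trees are chosen before `β` and `p` appear, so they depend on `b`, `m`, `α`, `s` and `P`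
  -- only.
  choose A hA using QMC.exists_fast_cbc
  refine ⟨1000, A, fun b _ p β α hp hp1 hβ hsum hsmall hα => ?_⟩
  obtain ⟨C, hC, hbound⟩ := QMC.hasCBCBound hp hp1 hβ hsum hsmall hα
  have hα2 : 2 ≤ α := by
    have h1 : 1 ≤ 1 / p := by rwa [le_div_iff₀ hp, one_mul]
    have : 1 ≤ ⌊1 / p⌋₊ := Nat.one_le_floor_iff _ |>.2 h1
    omega
  refine ⟨C, hC, fun s m P q hs hm hP hdeg hq => ?_⟩
  obtain ⟨hcbc, hcost⟩ := hA b m α s P Fact.out hP hdeg hm hα2 hs β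
  rw [← hq] at hcbc
  refine ⟨hcost, hcbc, fun F D c hc hD hF => ?_⟩
  obtain ⟨hint, herr⟩ := QMC.abs_integral_sub_quadrature_le hα2 hP hdeg q hD hc hβ hF
  refine ⟨hint, herr.trans ?_⟩
  rw [mul_assoc]
  exact mul_le_mul_of_nonneg_left (hbound s m P q hm hP hdeg hcbc) hc.le
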